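/- Let $k$ be a field, $H$ a Hopf algebra over $k$ with antipode $S$, $A$ a right $H$-comodule algebra over $k$ with coaction $a\mapsto a_{(0)}\otimes a_{(1)}$, $C$ a right $H$-module coalgebra over $k$, and $e\in C$ a group-like element. Let $C$ coact on $A$ by $\rho(a)=a_{(0)}\otimes e\,a_{(1)}$, put $B=A^{\mathrm{co}\,C}=\{b\in A : \rho(ba)=b\rho(a)\text{ for all }a\in A\}$, and assume that the extension $B\subseteq A$ is $C$-Galois, i.e. that the canonical map $A\otimes_B A\to A\otimes C$, $a\otimes_B a'\mapsto aa'_{(0)}\otimes e\,a'_{(1)}$, is bijective. Let $Z(A|B)$ be the cyclic module of the extension: $Z_n=A^{\widehat\otimes_B(n+1)}$ is the cyclic tensor product, i.e. the quotient of $A^{\otimes(n+1)}$ by the relations $\cdots\otimes a^ib\otimes a^{i+1}\otimes\cdots=\cdots\otimes a^i\otimes ba^{i+1}\otimes\cdots$ for $b\in B$ and $i\in\mathbb Z/(n+1)$; the face $d_i$ multiplies $a^i$ and $a^{i+1}$ for $i<n$, and $d_n(a^0\otimes\cdots\otimes a^n)=a^na^0\otimes a^1\otimes\cdots\otimes a^{n-1}$;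 the degeneracy $s_j$ inserts $1$ after $a^j$; and $t(a^0\otimes\cdots\otimes a^n)=a^n\otimes a^0\otimes\cdots\otimes a^{n-1}$. Let $M=(H\otimes A)/\langle ha'_{(1)}\otimes aa'_{(0)}-h\otimes a'a \mid h\in H,\ a,a'\in A\rangle$, with the action $h'[h\otimes a]=[h'h\otimes a]$ and the coaction $[h\otimes a]\mapsto[h_{(2)}\otimes a_{(0)}]\otimes h_{(3)}a_{(1)}S(h_{(1)})$; this is a stable anti-Yetter-Drinfeld module over $H$. Let $Y(C,M)$ be the Hopf-cyclic module: $Y_n=C^{\otimes(n+1)}\otimes_H M$ for the diagonal right action of $H$ on $C^{\otimes (n+1)}$, where the face $d_i$ applies the counit to $c^i$, the degeneracy $s_j$ applies the comultiplication to $c^j$, and $t(c^0\otimes\cdots\otimes c^n\otimes_H m)=c^nm_{(1)}\otimes c^0\otimes\cdots\otimes c^{n-1}\otimes_H m_{(0)}$. For a cyclic module $X$ let $HP_\bullet(X)$ be its periodic cyclic homology, i.e. the homology of the $\mathbb Z/2$-graded complex $\prod_{q\equiv\bullet\,(2)}X_q$ with differential $b+B$ (Hochschild boundary plus Connes operator).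 Put $HP_\bullet(A|B)=HP_\bullet(Z(A|B))$ and $HP^H_\bullet(C,M)=HP_\bullet(Y(C,M))$. Then there is an isomorphism of cyclic modules $\Phi: Z(A|B)\to Y(C,M)$ given by $$\Phi_n(a^0\,\widehat\otimes_B\cdots\widehat\otimes_B\,a^n)=\bigl(e\,a^1_{(1)}\cdots a^n_{(1)}\otimes e\,a^2_{(2)}\cdots a^n_{(2)}\otimes\cdots\otimes e\,a^n_{(n)}\otimes e\bigr)\otimes_H[1\otimes a^0a^1_{(0)}\cdots a^n_{(0)}],$$ and in both parities it induces, by $[(z_q)_q]\mapsto[(\Phi_q(z_q))_q]$, a $k$-linear isomorphism $$HP_\bullet(A|B)\;\cong\;HP^H_\bullet(C,M).$$ -/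

import Mathlib

open scoped TensorProduct

namespace HopfCyclic

universe u v w x y

section TensorPowers

variable (k : Type u) [Field k] (V : Type v) [AddCommGroup V] [Module k V]

/-- `TPow k V n` is the tensor power `V ⊗ (V ⊗ (⋯ ⊗ V))` with `n + 1` factors, over `k`.
The factors are numbered `0, …, n`. -/
noncomputable def TPow : ℕ → ModuleCat.{v} k
  | 0 => ModuleCat.of k V
  | n + 1 => ModuleCat.of k (V ⊗[k] TPow n)

/-- `v₀ ⊗ ⋯ ⊗ vₙ₊₁ ↦ (v₀ ⊗ ⋯ ⊗ vₙ) ⊗ vₙ₊₁`. -/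
noncomputable def splitLast : ∀ n : ℕ, TPow k V (n + 1) →ₗ[k] TPow k V n ⊗[k] V
  | 0 => (LinearMap.id : V ⊗[k] V →ₗ[k] V ⊗[k] V)
  | n + 1 => (TensorProduct.assoc k V (TPow k V n) V).symm.toLinearMap ∘ₗ
      (splitLast n).lTensor V

/-- The rotation `v₀ ⊗ ⋯ ⊗ vₙ ↦ vₙ ⊗ v₀ ⊗ ⋯ ⊗ vₙ₋₁`. -/
noncomputable def rot : ∀ n : ℕ, TPow k V n →ₗ[k] TPow k V n
  | 0 => LinearMap.id
  | n + 1 => (TensorProduct.comm k (TPow k V n) V).toLinearMap ∘ₗ splitLast k V n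

variable {k V}

/-- `slot f n i` applies the endomorphism `f` to the factor number `i`. -/
noncomputable def slot (f : V →ₗ[k] V) :
    ∀ n : ℕ, Fin (n + 1) → (TPow k V n →ₗ[k] TPow k V n)
  | 0, _ => f
  | n + 1, i => Fin.cases (f.rTensor (TPow k V n)) (fun j => (slot f n j).lTensor V) i

/-- `splitAt δ n j` applies `δ : V → V ⊗ V` to the factor number `j`. -/
noncomputable def splitAt (δ : V →ₗ[k] V ⊗[k] V) :
    ∀ n : ℕ, Fin (n + 1) → (TPow k V n →ₗ[k] TPow k V (n + 1))
  | 0, _ => δ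
  | n + 1, j => Fin.cases
      ((TensorProduct.assoc k V V (TPow k V n)).toLinearMap ∘ₗ δ.rTensor (TPow k V n))
      (fun j => (splitAt δ n j).lTensor V) j

/-- `mergeAt μ n i` applies `μ : V ⊗ V → V` to the adjacent factors number `i` and `i + 1`. -/
noncomputable def mergeAt (μ : V ⊗[k] V →ₗ[k] V) :
    ∀ n : ℕ, Fin (n + 1) → (TPow k V (n + 1) →ₗ[k] TPow k V n)
  | 0, _ => μ
  | n + 1, i => Fin.cases
      (μ.rTensor (TPow k V n) ∘ₗ (TensorProduct.assoc k V V (TPow k V n)).symm.toLinearMap)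
      (fun j => (mergeAt μ n j).lTensor V) i

/-- `dropAt ε n i` applies the functional `ε` to the factor number `i`. -/
noncomputable def dropAt (ε : V →ₗ[k] k) :
    ∀ n : ℕ, Fin (n + 2) → (TPow k V (n + 1) →ₗ[k] TPow k V n)
  | 0, i => Fin.cases
      ((TensorProduct.lid k V).toLinearMap ∘ₗ ε.rTensor V)
      (fun _ => (TensorProduct.rid k V).toLinearMap ∘ₗ ε.lTensor V) i
  | n + 1, i => Fin.cases
      ((TensorProduct.lid k (TPow k V (n + 1))).toLinearMap ∘ₗ ε.rTensor (TPow k V (n + 1)))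
      (fun j => (dropAt ε n j).lTensor V) i

end TensorPowers

section TensorPowerLemmas

variable {k : Type u} [Field k] {V : Type v} [AddCommGroup V] [Module k V]
variable {W : Type w} [AddCommGroup W] [Module k W]

/-- Prepend a factor. -/
noncomputable def cons (n : ℕ) : V →ₗ[k] TPow k V n →ₗ[k] TPow k V (n + 1) :=
  TensorProduct.mk k V (TPow k V n)

/-- Append a factor. -/
noncomputable def snoc : ∀ n : ℕ, TPow k V n →ₗ[k] V →ₗ[k] TPow k V (n + 1)
  | 0 => TensorProduct.mk k V V
  | n + 1 => TensorProduct.lift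
      ((LinearMap.llcomp k V (TPow k V (n + 1)) (TPow k V (n + 2))).compl₁₂
        (cons (n + 1)) LinearMap.id |>.compl₂ (snoc n))

theorem hom_ext_cons {n : ℕ} {F G : TPow k V (n + 1) →ₗ[k] W}
    (h : ∀ v x, F (cons n v x) = G (cons n v x)) : F = G :=
  TensorProduct.ext' (g := F) (h := G) h

theorem snoc_cons (n : ℕ) (a : V) (x : TPow k V n) (v : V) :
    snoc (n + 1) (cons n a x) v = cons (n + 1) a (snoc n x v) := rfl

theorem hom_ext_snoc {n : ℕ} {F G : TPow k V (n + 1) →ₗ[k] W}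
    (h : ∀ x v, F (snoc n x v) = G (snoc n x v)) : F = G := by
  induction n generalizing W with
  | zero => exact hom_ext_cons h
  | succ n ih =>
    refine hom_ext_cons fun a y => ?_
    have : F ∘ₗ cons (n + 1) a = G ∘ₗ cons (n + 1) a := ih fun x v => h (cons n a x) v
    exact LinearMap.congr_fun this y

theorem splitLast_snoc (n : ℕ) (x : TPow k V n) (v : V) :
    splitLast k V n (snoc n x v) = x ⊗ₜ v := by
  induction n with
  | zero => rfl
  | succ n ih =>
    have : splitLast k V (n + 1) ∘ₗ (snoc (n + 1)).flip v =
        (TensorProduct.mk k (TPow k V (n + 1)) V).flip v := by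
      refine hom_ext_cons fun a y => ?_
      change (TensorProduct.assoc k V (TPow k V n) V).symm (a ⊗ₜ splitLast k V n (snoc n y v)) = _
      rw [ih]; rfl
    exact LinearMap.congr_fun this x

theorem rot_snoc (n : ℕ) (x : TPow k V n) (v : V) :
    rot k V (n + 1) (snoc n x v) = cons n v x := by
  change TensorProduct.comm k (TPow k V n) V (splitLast k V n (snoc n x v)) = _
  rw [splitLast_snoc]; rfl

theorem snoc_induction {n : ℕ} {P : TPow k V (n + 1) → Prop} (h0 : P 0)
    (hadd : ∀ y y', P y → P y' → P (y + y')) (hsnoc : ∀ z c, P (snoc n z c))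
    (y : TPow k V (n + 1)) : P y := by
  have : TensorProduct.lift (snoc n) (splitLast k V n y) = y :=
    LinearMap.congr_fun (f := TensorProduct.lift (snoc n) ∘ₗ splitLast k V n) (g := LinearMap.id)
      (hom_ext_snoc fun z c => by rw [LinearMap.comp_apply, splitLast_snoc]; rfl) y
  rw [← this]
  generalize splitLast k V n y = w
  induction w using TensorProduct.induction_on with
  | zero => rw [map_zero]; exact h0
  | tmul z c => exact hsnoc z c
  | add p q hp hq => rw [map_add]; exact hadd _ _ hp hq

theorem rot_zero (x : TPow k V 0) : rot k V 0 x = x := rfl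

theorem slot_zero_cons (f : V →ₗ[k] V) (n : ℕ) (a : V) (x : TPow k V n) :
    slot f (n + 1) 0 (cons n a x) = cons n (f a) x := rfl
theorem slot_succ_cons (f : V →ₗ[k] V) (n : ℕ) (i : Fin (n + 1)) (a : V) (x : TPow k V n) :
    slot f (n + 1) i.succ (cons n a x) = cons n a (slot f n i x) := rfl

theorem slot_castSucc_snoc (f : V →ₗ[k] V) (n : ℕ) (i : Fin (n + 1)) (x : TPow k V n) (v : V) :
    slot f (n + 1) i.castSucc (snoc n x v) = snoc n (slot f n i x) v := by
  induction n with
  | zero => rw [Subsingleton.elim (α := Fin 1) i 0]; rfl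
  | succ n ih =>
    refine LinearMap.congr_fun (f := slot f (n + 2) i.castSucc ∘ₗ (snoc (n + 1)).flip v)
      (g := (snoc (n + 1)).flip v ∘ₗ slot f (n + 1) i) (hom_ext_cons fun a y => ?_) x
    change slot f (n + 2) i.castSucc (cons (n + 1) a (snoc n y v)) =
      snoc (n + 1) (slot f (n + 1) i (cons n a y)) v
    cases i using Fin.cases with
    | zero => rfl
    | succ j =>
      rw [slot_succ_cons, snoc_cons, ← ih]; rfl

theorem slot_last_snoc (f : V →ₗ[k] V) (n : ℕ) (x : TPow k V n) (v : V) :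
    slot f (n + 1) (Fin.last _) (snoc n x v) = snoc n x (f v) := by
  induction n with
  | zero => rfl
  | succ n ih =>
    refine LinearMap.congr_fun (f := slot f (n + 2) (Fin.last _) ∘ₗ (snoc (n + 1)).flip v)
      (g := (snoc (n + 1)).flip (f v)) (hom_ext_cons fun a y => ?_) x
    change slot f (n + 2) (Fin.last (n + 1)).succ (cons (n + 1) a (snoc n y v)) =
      cons (n + 1) a (snoc n y (f v))
    rw [slot_succ_cons, ih]

theorem rot_slot (f : V →ₗ[k] V) (n : ℕ) (i : Fin (n + 1)) (x : TPow k V n) :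
    rot k V n (slot f n i x) = slot f n (i + 1) (rot k V n x) := by
  cases n with
  | zero => rfl
  | succ n =>
    refine LinearMap.congr_fun (f := rot k V _ ∘ₗ slot f (n + 1) i)
      (g := slot f (n + 1) (i + 1) ∘ₗ rot k V _) (hom_ext_snoc fun x v => ?_) x
    simp only [LinearMap.comp_apply]
    cases i using Fin.lastCases with
    | last =>
      rw [slot_last_snoc, rot_snoc, rot_snoc, Fin.last_add_one, slot_zero_cons]
    | cast i =>
      rw [slot_castSucc_snoc, rot_snoc, rot_snoc, Fin.coeSucc_eq_succ, slot_succ_cons]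

/-! splitting -/

variable (δ : V →ₗ[k] V ⊗[k] V) (μ : V ⊗[k] V →ₗ[k] V) (ε : V →ₗ[k] k)

theorem splitAt_succ_cons (n : ℕ) (i : Fin (n + 1)) (a : V) (x : TPow k V n) :
    splitAt δ (n + 1) i.succ (cons n a x) = cons (n + 1) a (splitAt δ n i x) := rfl
theorem mergeAt_succ_cons (n : ℕ) (i : Fin (n + 1)) (a : V) (x : TPow k V (n + 1)) :
    mergeAt μ (n + 1) i.succ (cons (n + 1) a x) = cons n a (mergeAt μ n i x) := rfl
theorem mergeAt_zero_cons (n : ℕ) (a b : V) (x : TPow k V n) :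
    mergeAt μ (n + 1) 0 (cons (n + 1) a (cons n b x)) = cons n (μ (a ⊗ₜ b)) x := rfl
theorem dropAt_succ_cons (n : ℕ) (i : Fin (n + 2)) (a : V) (x : TPow k V (n + 1)) :
    dropAt ε (n + 1) i.succ (cons (n + 1) a x) = cons n a (dropAt ε n i x) := rfl
theorem dropAt_zero_cons (n : ℕ) (a : V) (x : TPow k V n) :
    dropAt ε n 0 (cons n a x) = ε a • x := by
  cases n <;> rfl

/-- Prepend two factors. -/
noncomputable def cons2 (n : ℕ) : V ⊗[k] V →ₗ[k] TPow k V n →ₗ[k] TPow k V (n + 2) :=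
  TensorProduct.lift ((LinearMap.llcomp k (TPow k V n) (TPow k V (n + 1)) (TPow k V (n + 2))
     ∘ₗ cons (n + 1)).compl₂ (cons n))
theorem cons2_tmul (n : ℕ) (a b : V) (x : TPow k V n) :
    cons2 n (a ⊗ₜ b) x = cons (n + 1) a (cons n b x) := rfl
theorem splitAt_zero_cons (n : ℕ) (a : V) (x : TPow k V n) :
    splitAt δ (n + 1) 0 (cons n a x) = cons2 n (δ a) x := by
  change TensorProduct.assoc k V V (TPow k V n) (δ a ⊗ₜ x) = _
  induction δ a using TensorProduct.induction_on with
  | zero => simp; rfl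
  | tmul => rfl
  | add p q hp hq => rw [TensorProduct.add_tmul, map_add, hp, hq, map_add]; rfl

/-- Append two factors. -/
noncomputable def snoc2 (n : ℕ) : TPow k V n →ₗ[k] V ⊗[k] V →ₗ[k] TPow k V (n + 2) :=
  LinearMap.flip (TensorProduct.lift ((LinearMap.llcomp k (TPow k V n) (TPow k V (n + 1)) (TPow k V (n + 2))
     ∘ₗ (snoc (n + 1)).flip).compl₂ (snoc n).flip) ∘ₗ (TensorProduct.comm k V V).toLinearMap)
theorem snoc2_tmul (n : ℕ) (a b : V) (x : TPow k V n) :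
    snoc2 n x (a ⊗ₜ b) = snoc (n + 1) (snoc n x a) b := rfl
theorem snoc2_cons (n : ℕ) (a : V) (x : TPow k V n) (z : V ⊗[k] V) :
    snoc2 (n + 1) (cons n a x) z = cons (n + 2) a (snoc2 n x z) := by
  induction z using TensorProduct.induction_on with
  | zero => simp
  | tmul => rfl
  | add p q hp hq => simp only [map_add, hp, hq]

theorem splitAt_castSucc_snoc (n : ℕ) (i : Fin (n + 1)) (x : TPow k V n) (v : V) :
    splitAt δ (n + 1) i.castSucc (snoc n x v) = snoc (n + 1) (splitAt δ n i x) v := by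
  induction n with
  | zero =>
    rw [Subsingleton.elim (α := Fin 1) i 0]
    refine (splitAt_zero_cons δ 0 (show V from x) v).trans ?_
    change cons2 0 (δ x) v = snoc 1 (δ x) v
    induction δ x using TensorProduct.induction_on with
    | zero => simp; exact (LinearMap.congr_fun (snoc (k := k) (V := V) 1).map_zero v).symm
    | tmul => rfl
    | add p q hp hq =>
      have h₁ := LinearMap.congr_fun ((cons2 (k := k) (V := V) 0).map_add p q) v
      have h₂ := LinearMap.congr_fun ((snoc (k := k) (V := V) 1).map_add p q) v
      exact h₁.trans ((congrArg₂ (· + ·) hp hq).trans h₂.symm)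
  | succ n ih =>
    refine LinearMap.congr_fun (f := splitAt δ (n + 2) i.castSucc ∘ₗ (snoc (n + 1)).flip v)
      (g := (snoc (n + 2)).flip v ∘ₗ splitAt δ (n + 1) i) (hom_ext_cons fun a y => ?_) x
    change splitAt δ (n + 2) i.castSucc (cons (n + 1) a (snoc n y v)) =
      snoc (n + 2) (splitAt δ (n + 1) i (cons n a y)) v
    cases i using Fin.cases with
    | zero =>
      rw [Fin.castSucc_zero, splitAt_zero_cons, splitAt_zero_cons]
      induction δ a using TensorProduct.induction_on with
      | zero => simp
      | tmul => rfl
      | add p q hp hq => simp only [map_add, LinearMap.add_apply, hp, hq]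
    | succ j =>
      rw [splitAt_succ_cons, snoc_cons, ← ih]; rfl

theorem splitAt_last_snoc (n : ℕ) (x : TPow k V n) (v : V) :
    splitAt δ (n + 1) (Fin.last _) (snoc n x v) = snoc2 n x (δ v) := by
  induction n with
  | zero =>
    change cons 1 x (δ v) = _
    induction δ v using TensorProduct.induction_on with
    | zero => rw [map_zero]; exact (cons (k := k) (V := V) 1 x).map_zero
    | tmul => rfl
    | add p q hp hq => rw [map_add, ← hp, ← hq]; exact (cons (k := k) (V := V) 1 x).map_add p q
  | succ n ih =>
    refine LinearMap.congr_fun (f := splitAt δ (n + 2) (Fin.last _) ∘ₗ (snoc (n + 1)).flip v)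
      (g := (snoc2 (n + 1)).flip (δ v)) (hom_ext_cons fun a y => ?_) x
    change splitAt δ (n + 2) (Fin.last (n + 1)).succ (cons (n + 1) a (snoc n y v)) =
      snoc2 (n + 1) (cons n a y) (δ v)
    rw [splitAt_succ_cons, ih, snoc2_cons]

theorem mergeAt_castSucc_snoc (n : ℕ) (i : Fin (n + 1)) (x : TPow k V (n + 1)) (v : V) :
    mergeAt μ (n + 1) i.castSucc (snoc (n + 1) x v) = snoc n (mergeAt μ n i x) v := by
  induction n with
  | zero =>
    rw [Subsingleton.elim (α := Fin 1) i 0]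
    refine LinearMap.congr_fun (f := mergeAt μ 1 0 ∘ₗ (snoc 1).flip v)
      (g := (snoc 0).flip v ∘ₗ mergeAt μ 0 0) (hom_ext_cons fun a y => ?_) x
    rfl
  | succ n ih =>
    refine LinearMap.congr_fun (f := mergeAt μ (n + 2) i.castSucc ∘ₗ (snoc (n + 2)).flip v)
      (g := (snoc (n + 1)).flip v ∘ₗ mergeAt μ (n + 1) i) (hom_ext_cons fun a y => ?_) x
    change mergeAt μ (n + 2) i.castSucc (cons (n + 2) a (snoc (n + 1) y v)) =
      snoc (n + 1) (mergeAt μ (n + 1) i (cons (n + 1) a y)) v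
    cases i using Fin.cases with
    | zero =>
      refine LinearMap.congr_fun (f := mergeAt μ (n + 2) 0 ∘ₗ cons (n + 2) a ∘ₗ (snoc (n + 1)).flip v)
       (g := (snoc (n + 1)).flip v ∘ₗ mergeAt μ (n + 1) 0 ∘ₗ cons (n + 1) a) (hom_ext_cons fun b z => ?_) y
      rfl
    | succ j =>
      rw [mergeAt_succ_cons, snoc_cons, ← ih]; rfl

theorem mergeAt_last_snoc (n : ℕ) (x : TPow k V n) (a v : V) :
    mergeAt μ (n + 1) (Fin.last _) (snoc (n + 1) (snoc n x a) v) = snoc n x (μ (a ⊗ₜ v)) := by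
  induction n with
  | zero => rfl
  | succ n ih =>
    refine LinearMap.congr_fun
      (f := mergeAt μ (n + 2) (Fin.last _) ∘ₗ (snoc (n + 2)).flip v ∘ₗ (snoc (n + 1)).flip a)
      (g := (snoc (n + 1)).flip (μ (a ⊗ₜ v))) (hom_ext_cons fun b y => ?_) x
    change mergeAt μ (n + 2) (Fin.last (n + 1)).succ (cons (n + 2) b (snoc (n + 1) (snoc n y a) v)) =
      cons (n + 1) b (snoc n y (μ (a ⊗ₜ v)))
    rw [mergeAt_succ_cons, ih]

theorem dropAt_castSucc_snoc (n : ℕ) (i : Fin (n + 2)) (x : TPow k V (n + 1)) (v : V) :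
    dropAt ε (n + 1) i.castSucc (snoc (n + 1) x v) = snoc n (dropAt ε n i x) v := by
  induction n with
  | zero =>
    refine LinearMap.congr_fun (f := dropAt ε 1 i.castSucc ∘ₗ (snoc 1).flip v)
      (g := (snoc 0).flip v ∘ₗ dropAt ε 0 i) (hom_ext_cons fun a y => ?_) x
    cases i using Fin.cases with
    | zero =>
      exact (dropAt_zero_cons ε 1 a (snoc 0 y v)).trans
        (LinearMap.congr_fun ((snoc (k := k) (V := V) 0).map_smul (ε a) y) v).symm
    | succ j =>
      rw [Subsingleton.elim (α := Fin 1) j 0]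
      change a ⊗ₜ[k] (ε y • v) = (ε y • a) ⊗ₜ[k] v
      rw [TensorProduct.smul_tmul]
  | succ n ih =>
    refine LinearMap.congr_fun (f := dropAt ε (n + 2) i.castSucc ∘ₗ (snoc (n + 2)).flip v)
      (g := (snoc (n + 1)).flip v ∘ₗ dropAt ε (n + 1) i) (hom_ext_cons fun a y => ?_) x
    change dropAt ε (n + 2) i.castSucc (cons (n + 2) a (snoc (n + 1) y v)) =
      snoc (n + 1) (dropAt ε (n + 1) i (cons (n + 1) a y)) v
    cases i using Fin.cases with
    | zero =>
      rw [Fin.castSucc_zero, dropAt_zero_cons, dropAt_zero_cons, map_smul, LinearMap.smul_apply]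
    | succ j =>
      rw [dropAt_succ_cons, snoc_cons, ← ih]; rfl

theorem dropAt_last_snoc (n : ℕ) (x : TPow k V n) (v : V) :
    dropAt ε n (Fin.last _) (snoc n x v) = ε v • x := by
  induction n with
  | zero => rfl
  | succ n ih =>
    refine LinearMap.congr_fun
      (f := dropAt ε (n + 1) (Fin.last _) ∘ₗ (snoc (n + 1)).flip v)
      (g := ε v • LinearMap.id) (hom_ext_cons fun b y => ?_) x
    change dropAt ε (n + 1) (Fin.last (n + 1)).succ (cons (n + 1) b (snoc n y v)) =
      ε v • cons n b y
    rw [dropAt_succ_cons, ih, map_smul]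

end TensorPowerLemmas

section TensorPowerLaws

variable {k : Type u} [Field k] {V : Type v} [AddCommGroup V] [Module k V]
variable (δ : V →ₗ[k] V ⊗[k] V) (μ : V ⊗[k] V →ₗ[k] V) (ε : V →ₗ[k] k)

theorem cons2_natural (n m : ℕ) (F : TPow k V n →ₗ[k] TPow k V m)
    (G : TPow k V (n + 1) →ₗ[k] TPow k V (m + 1)) (H : TPow k V (n + 2) →ₗ[k] TPow k V (m + 2))
    (hG : ∀ a x, G (cons n a x) = cons m a (F x))
    (hH : ∀ a x, H (cons (n + 1) a x) = cons (m + 1) a (G x))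
    (z : V ⊗[k] V) (x : TPow k V n) :
    H (cons2 n z x) = cons2 m z (F x) := by
  induction z using TensorProduct.induction_on with
  | zero => simp
  | tmul a b => rw [cons2_tmul, cons2_tmul, hH, hG]
  | add p q hp hq => simp only [map_add, LinearMap.add_apply, hp, hq]

theorem snoc2_splitLast (n : ℕ) (x : TPow k V n) (z : V ⊗[k] V) :
    rot k V _ (rot k V _ (snoc2 n x z)) = cons2 n z x := by
  induction z using TensorProduct.induction_on with
  | zero => simp
  | tmul a b =>
    rw [snoc2_tmul, rot_snoc, cons2_tmul]
    cases n with
    | zero => rfl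
    | succ n => rw [← snoc_cons, rot_snoc]
  | add p q hp hq => simp only [map_add, LinearMap.add_apply, hp, hq]

theorem snoc_cons_rot (n : ℕ) (x : TPow k V n) (a v : V) :
    rot k V _ (cons (n + 1) v (snoc n x a)) = cons (n + 1) a (cons n v x) := by
  rw [← snoc_cons, rot_snoc]

theorem splitAt_rot (n : ℕ) (j : Fin (n + 1)) (x : TPow k V (n + 1)) :
    splitAt δ (n + 1) j.succ (rot k V _ x) = rot k V _ (splitAt δ (n + 1) j.castSucc x) := by
  refine LinearMap.congr_fun (f := splitAt δ (n + 1) j.succ ∘ₗ rot k V _)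
    (g := rot k V _ ∘ₗ splitAt δ (n + 1) j.castSucc) (hom_ext_snoc fun x v => ?_) x
  simp only [LinearMap.comp_apply]
  rw [rot_snoc, splitAt_castSucc_snoc, rot_snoc, splitAt_succ_cons]

theorem splitAt_zero_rot (n : ℕ) (x : TPow k V n) :
    splitAt δ n 0 (rot k V _ x) = rot k V _ (rot k V _ (splitAt δ n (Fin.last n) x)) := by
  cases n with
  | zero =>
    refine LinearMap.congr_fun (f := LinearMap.id) (g := rot k V 1 ∘ₗ rot k V 1)
      (hom_ext_cons fun a y => rfl) (δ x)
  | succ n =>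
    refine LinearMap.congr_fun (f := splitAt δ (n + 1) 0 ∘ₗ rot k V _)
      (g := rot k V _ ∘ₗ rot k V _ ∘ₗ splitAt δ (n + 1) (Fin.last _))
      (hom_ext_snoc fun x v => ?_) x
    simp only [LinearMap.comp_apply]
    rw [rot_snoc, splitAt_last_snoc, snoc2_splitLast, splitAt_zero_cons]

theorem mergeAt_rot (n : ℕ) (i : Fin (n + 1)) (x : TPow k V (n + 2)) :
    mergeAt μ (n + 1) i.succ (rot k V _ x) = rot k V _ (mergeAt μ (n + 1) i.castSucc x) := by
  refine LinearMap.congr_fun (f := mergeAt μ (n + 1) i.succ ∘ₗ rot k V _)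
    (g := rot k V _ ∘ₗ mergeAt μ (n + 1) i.castSucc) (hom_ext_snoc fun x v => ?_) x
  simp only [LinearMap.comp_apply]
  rw [rot_snoc, mergeAt_castSucc_snoc, rot_snoc, mergeAt_succ_cons]

theorem mergeAt_zero_rot_rot (n : ℕ) (x : TPow k V (n + 1)) :
    mergeAt μ n 0 (rot k V _ (rot k V _ x)) = rot k V _ (mergeAt μ n (Fin.last n) x) := by
  cases n with
  | zero =>
    refine LinearMap.congr_fun (f := mergeAt μ 0 0 ∘ₗ rot k V 1 ∘ₗ rot k V 1) (g := mergeAt μ 0 0)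
      (hom_ext_cons fun a y => rfl) x
  | succ n =>
    refine LinearMap.congr_fun (f := mergeAt μ (n + 1) 0 ∘ₗ rot k V _ ∘ₗ rot k V _)
      (g := rot k V _ ∘ₗ mergeAt μ (n + 1) (Fin.last _)) (hom_ext_snoc fun y v => ?_) x
    refine LinearMap.congr_fun
      (f := mergeAt μ (n + 1) 0 ∘ₗ rot k V _ ∘ₗ rot k V _ ∘ₗ (snoc (n + 1)).flip v)
      (g := rot k V _ ∘ₗ mergeAt μ (n + 1) (Fin.last _) ∘ₗ (snoc (n + 1)).flip v)
      (hom_ext_snoc fun z a => ?_) y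
    simp only [LinearMap.comp_apply, LinearMap.flip_apply]
    rw [rot_snoc, snoc_cons_rot, mergeAt_last_snoc, rot_snoc, mergeAt_zero_cons]

theorem dropAt_rot (n : ℕ) (i : Fin (n + 2)) (x : TPow k V (n + 2)) :
    dropAt ε (n + 1) i.succ (rot k V _ x) = rot k V _ (dropAt ε (n + 1) i.castSucc x) := by
  refine LinearMap.congr_fun (f := dropAt ε (n + 1) i.succ ∘ₗ rot k V _)
    (g := rot k V _ ∘ₗ dropAt ε (n + 1) i.castSucc) (hom_ext_snoc fun x v => ?_) x
  simp only [LinearMap.comp_apply]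
  rw [rot_snoc, dropAt_castSucc_snoc, rot_snoc, dropAt_succ_cons]

theorem dropAt_one_rot (x : TPow k V 1) (i : Fin 1) :
    dropAt ε 0 i.succ (rot k V _ x) = rot k V _ (dropAt ε 0 i.castSucc x) := by
  rw [Subsingleton.elim i 0]
  refine LinearMap.congr_fun (f := dropAt ε 0 1 ∘ₗ rot k V _)
    (g := dropAt ε 0 0) (hom_ext_snoc fun x v => ?_) x
  rfl

theorem dropAt_zero_rot (n : ℕ) (x : TPow k V (n + 1)) :
    dropAt ε n 0 (rot k V _ x) = dropAt ε n (Fin.last _) x := by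
  refine LinearMap.congr_fun (f := dropAt ε n 0 ∘ₗ rot k V _)
    (g := dropAt ε n (Fin.last _)) (hom_ext_snoc fun x v => ?_) x
  simp only [LinearMap.comp_apply]
  rw [rot_snoc, dropAt_last_snoc, dropAt_zero_cons]

theorem mergeAt_mergeAt (hμ : ∀ a b c, μ (μ (a ⊗ₜ b) ⊗ₜ c) = μ (a ⊗ₜ μ (b ⊗ₜ c)))
    (n : ℕ) (i j : Fin (n + 1)) (h : i ≤ j) (x : TPow k V (n + 2)) :
    mergeAt μ n i (mergeAt μ (n + 1) j.succ x) =
      mergeAt μ n j (mergeAt μ (n + 1) i.castSucc x) := by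
  suffices H : mergeAt μ n i ∘ₗ mergeAt μ (n + 1) j.succ =
      mergeAt μ n j ∘ₗ mergeAt μ (n + 1) i.castSucc from LinearMap.congr_fun H x
  clear x
  induction n with
  | zero =>
    rw [Subsingleton.elim (α := Fin 1) i 0, Subsingleton.elim (α := Fin 1) j 0]
    refine hom_ext_cons fun a y => ?_
    refine LinearMap.congr_fun (f := mergeAt μ 0 0 ∘ₗ mergeAt μ 1 1 ∘ₗ cons 1 a)
      (g := mergeAt μ 0 0 ∘ₗ mergeAt μ 1 0 ∘ₗ cons 1 a) (hom_ext_cons fun b c => ?_) y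
    exact (hμ a b c).symm
  | succ n ih =>
    refine hom_ext_cons fun a y => ?_
    simp only [LinearMap.comp_apply]
    rw [mergeAt_succ_cons]
    cases i using Fin.cases with
    | zero =>
      cases j using Fin.cases with
      | zero =>
        refine LinearMap.congr_fun (f := mergeAt μ (n + 1) 0 ∘ₗ cons (n + 1) a ∘ₗ mergeAt μ (n + 1) 0)
          (g := mergeAt μ (n + 1) 0 ∘ₗ mergeAt μ (n + 2) 0 ∘ₗ cons (n + 2) a)
          (hom_ext_cons fun b z => ?_) y
        refine LinearMap.congr_fun
          (f := mergeAt μ (n + 1) 0 ∘ₗ cons (n + 1) a ∘ₗ mergeAt μ (n + 1) 0 ∘ₗ cons (n + 1) b)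
          (g := mergeAt μ (n + 1) 0 ∘ₗ mergeAt μ (n + 2) 0 ∘ₗ cons (n + 2) a ∘ₗ cons (n + 1) b)
          (hom_ext_cons fun c w => ?_) z
        simp only [LinearMap.comp_apply]
        rw [mergeAt_zero_cons, mergeAt_zero_cons, mergeAt_zero_cons, mergeAt_zero_cons, hμ]
      | succ j =>
        refine LinearMap.congr_fun
          (f := mergeAt μ (n + 1) 0 ∘ₗ cons (n + 1) a ∘ₗ mergeAt μ (n + 1) j.succ)
          (g := mergeAt μ (n + 1) j.succ ∘ₗ mergeAt μ (n + 2) 0 ∘ₗ cons (n + 2) a)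
          (hom_ext_cons fun b z => ?_) y
        simp only [LinearMap.comp_apply]
        rw [mergeAt_succ_cons, mergeAt_zero_cons, mergeAt_zero_cons, mergeAt_succ_cons]
    | succ i =>
      cases j using Fin.cases with
      | zero => exact absurd h (by simp)
      | succ j =>
        rw [mergeAt_succ_cons, Fin.castSucc_succ, mergeAt_succ_cons, mergeAt_succ_cons]
        exact congrArg _ (LinearMap.congr_fun (ih i j (Fin.succ_le_succ_iff.mp h)) y)

theorem dropAt_dropAt (n : ℕ) (i j : Fin (n + 2)) (h : i ≤ j) (x : TPow k V (n + 2)) :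
    dropAt ε n i (dropAt ε (n + 1) j.succ x) = dropAt ε n j (dropAt ε (n + 1) i.castSucc x) := by
  suffices H : dropAt ε n i ∘ₗ dropAt ε (n + 1) j.succ =
      dropAt ε n j ∘ₗ dropAt ε (n + 1) i.castSucc from LinearMap.congr_fun H x
  clear x
  induction n with
  | zero =>
    refine hom_ext_cons fun a y => ?_
    simp only [LinearMap.comp_apply]
    rw [dropAt_succ_cons]
    cases i using Fin.cases with
    | zero => rw [dropAt_zero_cons, Fin.castSucc_zero, dropAt_zero_cons, map_smul]
    | succ i =>
      rw [Subsingleton.elim (α := Fin 1) i 0] at h ⊢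
      cases j using Fin.cases with
      | zero => exact absurd h (by simp)
      | succ j =>
        rw [Subsingleton.elim (α := Fin 1) j 0]
        refine LinearMap.congr_fun
          (f := dropAt ε 0 1 ∘ₗ cons 0 a ∘ₗ dropAt ε 0 1)
          (g := dropAt ε 0 1 ∘ₗ cons 0 a ∘ₗ dropAt ε 0 0) (hom_ext_cons fun b c => ?_) y
        change ε (ε c • b) • a = ε (ε b • c) • a
        exact congrArg (· • a) ((ε.map_smul (ε c) b).trans
          ((mul_comm (ε c) (ε b)).trans (ε.map_smul (ε b) c).symm))
  | succ n ih =>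
    refine hom_ext_cons fun a y => ?_
    simp only [LinearMap.comp_apply]
    rw [dropAt_succ_cons]
    cases i using Fin.cases with
    | zero => rw [dropAt_zero_cons, Fin.castSucc_zero, dropAt_zero_cons, map_smul]
    | succ i =>
      cases j using Fin.cases with
      | zero => exact absurd h (by simp)
      | succ j =>
        rw [dropAt_succ_cons, Fin.castSucc_succ, dropAt_succ_cons, dropAt_succ_cons]
        exact congrArg _ (LinearMap.congr_fun (ih i j (Fin.succ_le_succ_iff.mp h)) y)

/-- Prepend three factors. -/
noncomputable def cons3 (n : ℕ) : V ⊗[k] (V ⊗[k] V) →ₗ[k] TPow k V n →ₗ[k] TPow k V (n + 3) :=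
  TensorProduct.lift ((LinearMap.llcomp k (TPow k V n) (TPow k V (n + 2)) (TPow k V (n + 3))
     ∘ₗ cons (n + 2)).compl₂ (cons2 n))

theorem splitAt_zero_cons2 (n : ℕ) (z : V ⊗[k] V) (x : TPow k V n) :
    splitAt δ (n + 2) 0 (cons2 n z x) = cons3 n (TensorProduct.assoc k V V V (δ.rTensor V z)) x := by
  induction z using TensorProduct.induction_on with
  | zero => simp
  | tmul a b =>
    rw [cons2_tmul, splitAt_zero_cons, LinearMap.rTensor_tmul]
    induction δ a using TensorProduct.induction_on with
    | zero => simp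
    | tmul => rfl
    | add p q hp hq => simp only [map_add, LinearMap.add_apply, hp, hq, TensorProduct.add_tmul]
  | add p q hp hq => simp only [map_add, LinearMap.add_apply, hp, hq]

theorem splitAt_one_cons2 (n : ℕ) (z : V ⊗[k] V) (x : TPow k V n) :
    splitAt δ (n + 2) 1 (cons2 n z x) = cons3 n (δ.lTensor V z) x := by
  induction z using TensorProduct.induction_on with
  | zero => simp
  | tmul a b =>
    rw [cons2_tmul, LinearMap.lTensor_tmul]
    change cons (n + 2) a (splitAt δ (n + 1) 0 (cons n b x)) = _
    rw [splitAt_zero_cons]; rfl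
  | add p q hp hq => simp only [map_add, LinearMap.add_apply, hp, hq]

theorem splitAt_one_zero (z : V ⊗[k] V) :
    splitAt δ 1 0 z = TensorProduct.assoc k V V V (δ.rTensor V z) := rfl

theorem splitAt_splitAt
    (hδ : ∀ a, TensorProduct.assoc k V V V (δ.rTensor V (δ a)) = δ.lTensor V (δ a))
    (n : ℕ) (i j : Fin (n + 1)) (h : i ≤ j) (x : TPow k V n) :
    splitAt δ (n + 1) i.castSucc (splitAt δ n j x) = splitAt δ (n + 1) j.succ (splitAt δ n i x) := by
  induction n with
  | zero =>
    rw [Subsingleton.elim (α := Fin 1) i 0, Subsingleton.elim (α := Fin 1) j 0]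
    exact hδ x
  | succ n ih =>
    refine LinearMap.congr_fun (f := splitAt δ (n + 2) i.castSucc ∘ₗ splitAt δ (n + 1) j)
      (g := splitAt δ (n + 2) j.succ ∘ₗ splitAt δ (n + 1) i) (hom_ext_cons fun a y => ?_) x
    simp only [LinearMap.comp_apply]
    cases i using Fin.cases with
    | zero =>
      rw [Fin.castSucc_zero]
      cases j using Fin.cases with
      | zero =>
        rw [splitAt_zero_cons, splitAt_zero_cons2, hδ]
        exact (splitAt_one_cons2 δ n (δ a) y).symm
      | succ j =>
        rw [splitAt_succ_cons, splitAt_zero_cons, splitAt_zero_cons]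
        exact (cons2_natural n (n + 1) (splitAt δ n j) (splitAt δ (n + 1) j.succ) _
          (fun _ _ => rfl) (fun _ _ => rfl) _ _).symm
    | succ i =>
      cases j using Fin.cases with
      | zero => exact absurd h (by simp)
      | succ j =>
        rw [splitAt_succ_cons, splitAt_succ_cons, Fin.castSucc_succ, splitAt_succ_cons,
          splitAt_succ_cons, ih _ _ (Fin.succ_le_succ_iff.mp h)]

theorem dropAt_splitAt_le (n : ℕ) (i : Fin (n + 2)) (j : Fin (n + 1)) (h : i ≤ j.castSucc)
    (x : TPow k V (n + 1)) :
    dropAt ε (n + 1) i.castSucc (splitAt δ (n + 1) j.succ x) = splitAt δ n j (dropAt ε n i x) := by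
  induction n with
  | zero =>
    rw [Subsingleton.elim (α := Fin 1) j 0] at h ⊢
    obtain rfl : i = 0 := Fin.le_zero_iff.mp h
    refine LinearMap.congr_fun (f := dropAt ε 1 0 ∘ₗ splitAt δ 1 1)
      (g := splitAt δ 0 0 ∘ₗ dropAt ε 0 0) (hom_ext_cons fun a y => ?_) x
    simp only [LinearMap.comp_apply]
    rw [dropAt_zero_cons, map_smul]
    exact dropAt_zero_cons _ _ _ _
  | succ n ih =>
    refine LinearMap.congr_fun (f := dropAt ε (n + 2) i.castSucc ∘ₗ splitAt δ (n + 2) j.succ)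
      (g := splitAt δ (n + 1) j ∘ₗ dropAt ε (n + 1) i) (hom_ext_cons fun a y => ?_) x
    simp only [LinearMap.comp_apply]
    rw [splitAt_succ_cons]
    cases i using Fin.cases with
    | zero => rw [Fin.castSucc_zero, dropAt_zero_cons, dropAt_zero_cons, map_smul]
    | succ i =>
      cases j using Fin.cases with
      | zero => exact absurd h (by simp)
      | succ j =>
        rw [Fin.castSucc_succ, dropAt_succ_cons, dropAt_succ_cons, splitAt_succ_cons,
          ih _ _ (by simpa using h)]

theorem dropAt_zero_cons2 (n : ℕ) (z : V ⊗[k] V) (x : TPow k V n) :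
    dropAt ε (n + 1) 0 (cons2 n z x) = cons n (TensorProduct.lid k V (ε.rTensor V z)) x := by
  induction z using TensorProduct.induction_on with
  | zero => simp
  | tmul a b => rw [cons2_tmul, dropAt_zero_cons]; simp
  | add p q hp hq => simp only [map_add, LinearMap.add_apply, hp, hq]

theorem dropAt_one_cons2 (n : ℕ) (z : V ⊗[k] V) (x : TPow k V n) :
    dropAt ε (n + 1) 1 (cons2 n z x) = cons n (TensorProduct.rid k V (ε.lTensor V z)) x := by
  induction z using TensorProduct.induction_on with
  | zero => simp
  | tmul a b =>
    rw [cons2_tmul]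
    change cons n a (dropAt ε n 0 (cons n b x)) = _
    rw [dropAt_zero_cons]; simp
  | add p q hp hq => simp only [map_add, LinearMap.add_apply, hp, hq]

theorem dropAt_splitAt_self (hl : ∀ a, TensorProduct.lid k V (ε.rTensor V (δ a)) = a)
    (n : ℕ) (i : Fin (n + 1)) (x : TPow k V n) :
    dropAt ε n i.castSucc (splitAt δ n i x) = x := by
  induction n with
  | zero =>
    rw [Subsingleton.elim (α := Fin 1) i 0]
    exact hl x
  | succ n ih =>
    refine LinearMap.congr_fun (f := dropAt ε (n + 1) i.castSucc ∘ₗ splitAt δ (n + 1) i)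
      (g := LinearMap.id) (hom_ext_cons fun a y => ?_) x
    simp only [LinearMap.comp_apply, LinearMap.id_apply]
    cases i using Fin.cases with
    | zero => rw [Fin.castSucc_zero, splitAt_zero_cons, dropAt_zero_cons2, hl]
    | succ i => rw [Fin.castSucc_succ, splitAt_succ_cons, dropAt_succ_cons, ih]

theorem dropAt_splitAt_succ (hr : ∀ a, TensorProduct.rid k V (ε.lTensor V (δ a)) = a)
    (n : ℕ) (i : Fin (n + 1)) (x : TPow k V n) :
    dropAt ε n i.succ (splitAt δ n i x) = x := by
  induction n with
  | zero =>
    rw [Subsingleton.elim (α := Fin 1) i 0]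
    exact hr x
  | succ n ih =>
    refine LinearMap.congr_fun (f := dropAt ε (n + 1) i.succ ∘ₗ splitAt δ (n + 1) i)
      (g := LinearMap.id) (hom_ext_cons fun a y => ?_) x
    simp only [LinearMap.comp_apply, LinearMap.id_apply]
    cases i using Fin.cases with
    | zero =>
      rw [splitAt_zero_cons]
      exact (dropAt_one_cons2 ε n _ y).trans (by rw [hr])
    | succ i => rw [splitAt_succ_cons, dropAt_succ_cons, ih]

theorem dropAt_splitAt_gt (n : ℕ) (i : Fin (n + 2)) (j : Fin (n + 1)) (h : j.castSucc < i)
    (x : TPow k V (n + 1)) :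
    dropAt ε (n + 1) i.succ (splitAt δ (n + 1) j.castSucc x) = splitAt δ n j (dropAt ε n i x) := by
  induction n with
  | zero =>
    rw [Subsingleton.elim (α := Fin 1) j 0] at h ⊢
    obtain rfl : i = 1 := by fin_cases i <;> simp_all
    refine LinearMap.congr_fun (f := dropAt ε 1 2 ∘ₗ splitAt δ 1 0)
      (g := splitAt δ 0 0 ∘ₗ dropAt ε 0 1) (hom_ext_cons fun a (y : V) => ?_) x
    refine (congrArg (dropAt ε 1 2) (splitAt_zero_cons δ 0 a y)).trans ?_
    refine Eq.trans ?_ (δ.map_smul (ε y) a).symm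
    change dropAt ε 1 2 (cons2 0 (δ a) y) = ε y • δ a
    refine LinearMap.congr_fun (f := dropAt ε 1 2 ∘ₗ (cons2 0).flip y)
      (g := ε y • (LinearMap.id : V ⊗[k] V →ₗ[k] V ⊗[k] V))
      (TensorProduct.ext' fun p q => ?_) (δ a)
    change p ⊗ₜ[k] (ε y • q) = ε y • p ⊗ₜ[k] q
    rw [TensorProduct.tmul_smul]
  | succ n ih =>
    refine LinearMap.congr_fun (f := dropAt ε (n + 2) i.succ ∘ₗ splitAt δ (n + 2) j.castSucc)
      (g := splitAt δ (n + 1) j ∘ₗ dropAt ε (n + 1) i) (hom_ext_cons fun a y => ?_) x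
    simp only [LinearMap.comp_apply]
    cases i using Fin.cases with
    | zero => exact absurd h (by simp)
    | succ i =>
      cases j using Fin.cases with
      | zero =>
        rw [Fin.castSucc_zero, splitAt_zero_cons, dropAt_succ_cons, splitAt_zero_cons]
        exact cons2_natural (n + 1) n (dropAt ε n i) (dropAt ε (n + 1) i.succ) _
          (fun _ _ => rfl) (fun _ _ => rfl) _ _
      | succ j =>
        rw [Fin.castSucc_succ, splitAt_succ_cons, dropAt_succ_cons, dropAt_succ_cons,
          splitAt_succ_cons, ih _ _ (by simpa using h)]

end TensorPowerLaws

section TensorPowerAlgebraLaws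

variable {k : Type u} [Field k] {V : Type v} [AddCommGroup V] [Module k V]
variable (μ : V ⊗[k] V →ₗ[k] V) (e : V)

/-- `v ↦ v ⊗ e`. -/
noncomputable def insertRight : V →ₗ[k] V ⊗[k] V := (TensorProduct.mk k V V).flip e

theorem splitAt_insert_zero_cons (n : ℕ) (a : V) (x : TPow k V n) :
    splitAt (insertRight e) (n + 1) 0 (cons n a x) = cons (n + 1) a (cons n e x) := by
  rw [splitAt_zero_cons]; rfl

theorem mergeAt_splitAt_le (n : ℕ) (i j : Fin (n + 1)) (h : i ≤ j) (x : TPow k V (n + 1)) :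
    mergeAt μ (n + 1) i.castSucc (splitAt (insertRight e) (n + 1) j.succ x) =
      splitAt (insertRight e) n j (mergeAt μ n i x) := by
  induction n with
  | zero =>
    rw [Subsingleton.elim (α := Fin 1) i 0, Subsingleton.elim (α := Fin 1) j 0]
    refine LinearMap.congr_fun (f := mergeAt μ 1 0 ∘ₗ splitAt (insertRight e) 1 1)
      (g := splitAt (insertRight e) 0 0 ∘ₗ mergeAt μ 0 0) (hom_ext_cons fun a y => rfl) x
  | succ n ih =>
    refine LinearMap.congr_fun
      (f := mergeAt μ (n + 2) i.castSucc ∘ₗ splitAt (insertRight e) (n + 2) j.succ)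
      (g := splitAt (insertRight e) (n + 1) j ∘ₗ mergeAt μ (n + 1) i)
      (hom_ext_cons fun a y => ?_) x
    simp only [LinearMap.comp_apply]
    rw [splitAt_succ_cons]
    cases i using Fin.cases with
    | zero =>
      rw [Fin.castSucc_zero]
      refine LinearMap.congr_fun
        (f := mergeAt μ (n + 2) 0 ∘ₗ cons (n + 2) a ∘ₗ splitAt (insertRight e) (n + 1) j)
        (g := splitAt (insertRight e) (n + 1) j ∘ₗ mergeAt μ (n + 1) 0 ∘ₗ cons (n + 1) a)
        (hom_ext_cons fun b z => ?_) y
      simp only [LinearMap.comp_apply]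
      rw [mergeAt_zero_cons]
      cases j using Fin.cases with
      | zero => rw [splitAt_insert_zero_cons, splitAt_insert_zero_cons, mergeAt_zero_cons]
      | succ j => rw [splitAt_succ_cons, splitAt_succ_cons, mergeAt_zero_cons]
    | succ i =>
      cases j using Fin.cases with
      | zero => exact absurd h (by simp)
      | succ j =>
        rw [Fin.castSucc_succ, mergeAt_succ_cons, mergeAt_succ_cons, splitAt_succ_cons,
          ih _ _ (Fin.succ_le_succ_iff.mp h)]

theorem mergeAt_splitAt_self (hr : ∀ a, μ (a ⊗ₜ e) = a)
    (n : ℕ) (i : Fin (n + 1)) (x : TPow k V n) :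
    mergeAt μ n i (splitAt (insertRight e) n i x) = x := by
  induction n with
  | zero =>
    rw [Subsingleton.elim (α := Fin 1) i 0]
    exact hr x
  | succ n ih =>
    refine LinearMap.congr_fun (f := mergeAt μ (n + 1) i ∘ₗ splitAt (insertRight e) (n + 1) i)
      (g := LinearMap.id) (hom_ext_cons fun a y => ?_) x
    simp only [LinearMap.comp_apply, LinearMap.id_apply]
    cases i using Fin.cases with
    | zero => rw [splitAt_insert_zero_cons, mergeAt_zero_cons, hr]
    | succ i => rw [splitAt_succ_cons, mergeAt_succ_cons, ih]

theorem mergeAt_splitAt_succ (hl : ∀ a, μ (e ⊗ₜ a) = a)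
    (n : ℕ) (i : Fin (n + 1)) (x : TPow k V (n + 1)) :
    mergeAt μ (n + 1) i.succ (splitAt (insertRight e) (n + 1) i.castSucc x) = x := by
  induction n with
  | zero =>
    rw [Subsingleton.elim (α := Fin 1) i 0]
    refine LinearMap.congr_fun (f := mergeAt μ 1 1 ∘ₗ splitAt (insertRight e) 1 0)
      (g := LinearMap.id) (hom_ext_cons fun a (y : V) => ?_) x
    change a ⊗ₜ[k] μ (e ⊗ₜ y) = a ⊗ₜ y
    rw [hl]
  | succ n ih =>
    refine LinearMap.congr_fun
      (f := mergeAt μ (n + 2) i.succ ∘ₗ splitAt (insertRight e) (n + 2) i.castSucc)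
      (g := LinearMap.id) (hom_ext_cons fun a y => ?_) x
    simp only [LinearMap.comp_apply, LinearMap.id_apply]
    cases i using Fin.cases with
    | zero =>
      rw [Fin.castSucc_zero]
      refine LinearMap.congr_fun
        (f := mergeAt μ (n + 2) 1 ∘ₗ splitAt (insertRight e) (n + 2) 0 ∘ₗ cons (n + 1) a)
        (g := cons (n + 1) a) (hom_ext_cons fun b z => ?_) y
      simp only [LinearMap.comp_apply]
      rw [splitAt_insert_zero_cons]
      exact (mergeAt_succ_cons μ (n + 1) 0 a _).trans (by rw [mergeAt_zero_cons, hl])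
    | succ i => rw [Fin.castSucc_succ, splitAt_succ_cons, mergeAt_succ_cons, ih]

theorem mergeAt_zero_rot_splitAt_last (hl : ∀ a, μ (e ⊗ₜ a) = a) (n : ℕ) (x : TPow k V n) :
    mergeAt μ n 0 (rot k V _ (splitAt (insertRight e) n (Fin.last n) x)) = x := by
  have key : ∀ (n : ℕ) (x : TPow k V n), splitAt (insertRight e) n (Fin.last n) x = snoc n x e := by
    intro n x
    cases n with
    | zero => rfl
    | succ n =>
      refine LinearMap.congr_fun (f := splitAt (insertRight e) (n + 1) (Fin.last _))
        (g := (snoc (n + 1)).flip e) (hom_ext_snoc fun y v => ?_) x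
      rw [splitAt_last_snoc]; rfl
  rw [key, rot_snoc]
  cases n with
  | zero => exact hl x
  | succ n =>
    refine LinearMap.congr_fun (f := mergeAt μ (n + 1) 0 ∘ₗ cons (n + 1) e)
      (g := LinearMap.id) (hom_ext_cons fun b z => ?_) x
    simp only [LinearMap.comp_apply]
    rw [mergeAt_zero_cons, hl]; rfl

theorem mergeAt_splitAt_gt (n : ℕ) (i j : Fin (n + 1)) (h : j < i) (x : TPow k V (n + 1)) :
    mergeAt μ (n + 1) i.succ (splitAt (insertRight e) (n + 1) j.castSucc x) =
      splitAt (insertRight e) n j (mergeAt μ n i x) := by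
  induction n with
  | zero =>
    rw [Subsingleton.elim (α := Fin 1) i j] at h
    exact absurd h (lt_irrefl _)
  | succ n ih =>
    refine LinearMap.congr_fun
      (f := mergeAt μ (n + 2) i.succ ∘ₗ splitAt (insertRight e) (n + 2) j.castSucc)
      (g := splitAt (insertRight e) (n + 1) j ∘ₗ mergeAt μ (n + 1) i)
      (hom_ext_cons fun a y => ?_) x
    simp only [LinearMap.comp_apply]
    cases i using Fin.cases with
    | zero => exact absurd h (by simp)
    | succ i =>
      cases j using Fin.cases with
      | zero =>
        rw [Fin.castSucc_zero, splitAt_insert_zero_cons, mergeAt_succ_cons, mergeAt_succ_cons,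
          mergeAt_succ_cons, splitAt_insert_zero_cons]
      | succ j =>
        rw [Fin.castSucc_succ, splitAt_succ_cons, mergeAt_succ_cons, mergeAt_succ_cons,
          splitAt_succ_cons, ih _ _ (Fin.succ_lt_succ_iff.mp h)]

/-- Pure tensors. -/
noncomputable def pure : ∀ n : ℕ, (Fin (n + 1) → V) → TPow k V n
  | 0, x => x 0
  | n + 1, x => cons n (x 0) (pure n (fun i => x i.succ))

variable {W : Type w} [AddCommGroup W] [Module k W]

theorem hom_ext_pure {n : ℕ} {F G : TPow k V n →ₗ[k] W}
    (h : ∀ x, F (pure n x) = G (pure n x)) : F = G := by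
  induction n with
  | zero => exact LinearMap.ext fun v => h fun _ => v
  | succ n ih =>
    refine hom_ext_cons fun a y => ?_
    refine LinearMap.congr_fun (f := F ∘ₗ cons n a) (g := G ∘ₗ cons n a) (ih fun x => ?_) y
    exact h (Fin.cons a x)

theorem pure_snoc (n : ℕ) (x : Fin (n + 2) → V) :
    pure (k := k) (n + 1) x = snoc n (pure n fun i => x i.castSucc) (x (Fin.last _)) := by
  induction n with
  | zero => rfl
  | succ n ih => rw [pure, ih]; rfl

theorem rot_pure (n : ℕ) (x : Fin (n + 1) → V) :
    rot k V n (pure n x) = pure n fun i => x (i - 1) := by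
  cases n with
  | zero => rfl
  | succ n =>
    rw [pure_snoc, rot_snoc, pure]
    congr 2
    · rw [zero_sub, eq_neg_of_add_eq_zero_left (Fin.last_add_one (n + 1))]
    · funext i; congr 1
      rw [eq_sub_iff_add_eq, Fin.coeSucc_eq_succ]

theorem rot_pow (n : ℕ) : (rot k V n) ^ (n + 1) = 1 := by
  have key : ∀ (m : ℕ) (x : Fin (n + 1) → V),
      ((rot k V n) ^ m) (pure n x) = pure n fun i => x (i - m • (1 : Fin (n + 1))) := by
    intro m
    induction m with
    | zero => intro x; simp
    | succ m ih =>
      intro x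
      rw [pow_succ', Module.End.mul_apply, ih, rot_pure]
      congr 1; funext i; congr 1; rw [succ_nsmul, sub_sub, add_comm (1 : Fin (n + 1))]
  refine hom_ext_pure fun x => ?_
  rw [key]
  have h0 : (n + 1) • (1 : Fin (n + 1)) = 0 := by
    simpa using card_nsmul_eq_zero' (G := Fin (n + 1)) (x := 1)
  simp [h0]

end TensorPowerAlgebraLaws

section CyclicModules

/-- A simplicial `k`-module `X` with faces `d`, degeneracies `s` and operators `t` satisfying all the
identities of a cyclic module, except possibly `tₙ ^ (n + 1) = 1`. -/
structure ParacyclicModule (k : Type u) [Field k] where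
  X : ℕ → Type w
  [grp : ∀ n, AddCommGroup (X n)]
  [mod : ∀ n, Module k (X n)]
  d : ∀ n, Fin (n + 2) → (X (n + 1) →ₗ[k] X n)
  s : ∀ n, Fin (n + 1) → (X n →ₗ[k] X (n + 1))
  t : ∀ n, X n →ₗ[k] X n
  d_d : ∀ n (i j : Fin (n + 2)), i ≤ j → ∀ x, d n i (d (n + 1) j.succ x) =
    d n j (d (n + 1) i.castSucc x)
  s_s : ∀ n (i j : Fin (n + 1)), i ≤ j → ∀ x, s (n + 1) i.castSucc (s n j x) =
    s (n + 1) j.succ (s n i x)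
  d_s_of_le : ∀ n (i : Fin (n + 2)) (j : Fin (n + 1)), i ≤ j.castSucc → ∀ x,
    d (n + 1) i.castSucc (s (n + 1) j.succ x) = s n j (d n i x)
  d_s_self : ∀ n (i : Fin (n + 1)) x, d n i.castSucc (s n i x) = x
  d_s_succ : ∀ n (i : Fin (n + 1)) x, d n i.succ (s n i x) = x
  d_s_of_gt : ∀ n (i : Fin (n + 2)) (j : Fin (n + 1)), j.castSucc < i → ∀ x,
    d (n + 1) i.succ (s (n + 1) j.castSucc x) = s n j (d n i x)
  d_succ_t : ∀ n (i : Fin (n + 1)) x, d n i.succ (t (n + 1) x) = t n (d n i.castSucc x)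
  d_zero_t : ∀ n x, d n 0 (t (n + 1) x) = d n (Fin.last (n + 1)) x
  s_succ_t : ∀ n (j : Fin (n + 1)) x, s (n + 1) j.succ (t (n + 1) x) =
    t (n + 2) (s (n + 1) j.castSucc x)
  s_zero_t : ∀ n x, s n 0 (t n x) = t (n + 1) (t (n + 1) (s n (Fin.last n) x))

attribute [instance] ParacyclicModule.grp ParacyclicModule.mod

/-- A cyclic `k`-module: a simplicial module with operators `tₙ` of order `n + 1`, such that
`dᵢ tₙ = tₙ₋₁ dᵢ₋₁` and `sᵢ tₙ = tₙ₊₁ sᵢ₋₁` for `i ≥ 1`, `d₀ tₙ = dₙ` and `s₀ tₙ = tₙ₊₁ ^ 2 sₙ`. -/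
structure CyclicModule (k : Type u) [Field k] extends ParacyclicModule.{u, w} k where
  t_pow : ∀ n x, (t n ^ (n + 1)) x = x

/-- The quotient of a paracyclic module by submodules which are stable under all operators and
contain all the elements `tₙ ^ (n + 1) x - x`. -/
def ParacyclicModule.quot {k : Type u} [Field k] (P : ParacyclicModule.{u, w} k)
    (R : ∀ n, Submodule k (P.X n))
    (hd : ∀ n i, R (n + 1) ≤ (R n).comap (P.d n i))
    (hs : ∀ n i, R n ≤ (R (n + 1)).comap (P.s n i))
    (ht : ∀ n, R n ≤ (R n).comap (P.t n))
    (hpow : ∀ n x, (P.t n ^ (n + 1)) x - x ∈ R n) : CyclicModule.{u, w} k where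
  X n := P.X n ⧸ R n
  d n i := (R (n + 1)).mapQ (R n) (P.d n i) (hd n i)
  s n i := (R n).mapQ (R (n + 1)) (P.s n i) (hs n i)
  t n := (R n).mapQ (R n) (P.t n) (ht n)
  d_d n i j h := by
    rintro ⟨x⟩; exact congrArg (R n).mkQ (P.d_d n i j h x)
  s_s n i j h := by
    rintro ⟨x⟩; exact congrArg (R (n + 2)).mkQ (P.s_s n i j h x)
  d_s_of_le n i j h := by
    rintro ⟨x⟩; exact congrArg (R (n + 1)).mkQ (P.d_s_of_le n i j h x)
  d_s_self n i := by
    rintro ⟨x⟩; exact congrArg (R n).mkQ (P.d_s_self n i x)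
  d_s_succ n i := by
    rintro ⟨x⟩; exact congrArg (R n).mkQ (P.d_s_succ n i x)
  d_s_of_gt n i j h := by
    rintro ⟨x⟩; exact congrArg (R (n + 1)).mkQ (P.d_s_of_gt n i j h x)
  d_succ_t n i := by
    rintro ⟨x⟩; exact congrArg (R n).mkQ (P.d_succ_t n i x)
  d_zero_t n := by
    rintro ⟨x⟩; exact congrArg (R n).mkQ (P.d_zero_t n x)
  s_succ_t n j := by
    rintro ⟨x⟩; exact congrArg (R (n + 2)).mkQ (P.s_succ_t n j x)
  s_zero_t n := by
    rintro ⟨x⟩; exact congrArg (R (n + 1)).mkQ (P.s_zero_t n x)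
  t_pow n := by
    have key : ∀ (m : ℕ) (x : P.X n), ((R n).mapQ (R n) (P.t n) (ht n) ^ m) ((R n).mkQ x) =
        (R n).mkQ ((P.t n ^ m) x) := by
      intro m
      induction m with
      | zero => intro x; rfl
      | succ m ih => intro x; rw [pow_succ, pow_succ]; exact ih (P.t n x)
    rintro ⟨x⟩
    exact (key (n + 1) x).trans ((Submodule.Quotient.eq (R n)).mpr (hpow n x))

namespace CyclicModule

variable {k : Type u} [Field k] (Z : CyclicModule.{u, w} k)

/-- The Hochschild boundary `b = ∑ (-1) ^ i dᵢ`. -/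
noncomputable def b (n : ℕ) : Z.X (n + 1) →ₗ[k] Z.X n :=
  ∑ i : Fin (n + 2), (-1 : k) ^ (i : ℕ) • Z.d n i

/-- The signed cyclic operator `(-1) ^ n tₙ`. -/
noncomputable def st (n : ℕ) : Z.X n →ₗ[k] Z.X n := (-1 : k) ^ n • Z.t n

/-- The norm operator, the sum of the powers `0, …, n` of the signed cyclic operator. -/
noncomputable def norm (n : ℕ) : Z.X n →ₗ[k] Z.X n :=
  ∑ i ∈ Finset.range (n + 1), (Z.st n) ^ i

/-- The Connes operator `B = (1 - t) s N`: here `t` is the signed cyclic operator, `N` the norm, and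
`s = tₙ₊₁ sₙ` the extra degeneracy, formed with the unsigned cyclic operator. -/
noncomputable def B (n : ℕ) : Z.X n →ₗ[k] Z.X (n + 1) :=
  (LinearMap.id - Z.st (n + 1)) ∘ₗ (Z.t (n + 1) ∘ₗ Z.s n (Fin.last n)) ∘ₗ Z.norm n

/-- The periodic chains of parity `p`: the product of all the `X q` with `q ≡ p` modulo `2`. -/
abbrev PChain (p : ZMod 2) : Type w := ∀ q : {q : ℕ // (q : ZMod 2) = p}, Z.X q.1

/-- The component in degree `q` of the operator `B` on periodic chains. It is zero for `q = 0`. -/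
noncomputable def BInto (p p' : ZMod 2) (h : p' = p + 1) :
    ∀ q : {q : ℕ // (q : ZMod 2) = p'}, Z.PChain p →ₗ[k] Z.X q.1
  | ⟨0, _⟩ => 0
  | ⟨q + 1, hq⟩ => Z.B q ∘ₗ LinearMap.proj
      (⟨q, by rw [h] at hq; push_cast at hq; exact add_right_cancel hq⟩ :
        {q : ℕ // (q : ZMod 2) = p})

theorem parity_succ {p p' : ZMod 2} (h : p' = p + 1) {q : ℕ} (hq : (q : ZMod 2) = p') :
    ((q + 1 : ℕ) : ZMod 2) = p := by
  subst h; push_cast; rw [hq, add_assoc, CharTwo.add_self_eq_zero, add_zero]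

/-- The differential `b + B` of the periodic complex, from parity `p` to parity `p + 1`. -/
noncomputable def D (p p' : ZMod 2) (h : p' = p + 1) : Z.PChain p →ₗ[k] Z.PChain p' :=
  LinearMap.pi fun q =>
    Z.b q.1 ∘ₗ LinearMap.proj
      (⟨q.1 + 1, parity_succ h q.2⟩ : {q : ℕ // (q : ZMod 2) = p}) + Z.BInto p p' h q

/-- The cycles of parity `p` of the periodic complex. -/
noncomputable abbrev PCycles (p : ZMod 2) : Submodule k (Z.PChain p) :=
  LinearMap.ker (Z.D p (p + 1) rfl)

/-- The boundaries of parity `p` of the periodic complex. -/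
noncomputable abbrev PBoundaries (p : ZMod 2) : Submodule k (Z.PChain p) :=
  LinearMap.range (Z.D (p + 1) p (by rw [add_assoc, CharTwo.add_self_eq_zero, add_zero]))

/-- Periodic cyclic homology of a cyclic module, in degrees of parity `p`: the homology of the
`ℤ/2`-graded complex of periodic chains with the differential `b + B`. -/
abbrev HP (p : ZMod 2) : Type w :=
  Z.PCycles p ⧸ (Z.PBoundaries p).comap (Z.PCycles p).subtype

end CyclicModule
end CyclicModules

section AlgebraExtensions

variable (k : Type u) [Field k] (A : Type v) [Ring A] [Algebra k A]

/-- The face `dᵢ` of the cyclic module of an algebra: it multiplies the factors number `i` and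
`i + 1`; the last face multiplies the last factor with the first one, `aₙ₊₁ a₀ ⊗ a₁ ⊗ ⋯ ⊗ aₙ`. -/
noncomputable def algFace (n : ℕ) (i : Fin (n + 2)) : TPow k A (n + 1) →ₗ[k] TPow k A n :=
  Fin.lastCases (mergeAt (LinearMap.mul' k A) n 0 ∘ₗ rot k A (n + 1))
    (fun i => mergeAt (LinearMap.mul' k A) n i) i

theorem algFace_castSucc (n : ℕ) (i : Fin (n + 1)) :
    algFace k A n i.castSucc = mergeAt (LinearMap.mul' k A) n i := by
  simp [algFace]

theorem algFace_last (n : ℕ) (x : TPow k A (n + 1)) :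
    algFace k A n (Fin.last _) x = mergeAt (LinearMap.mul' k A) n 0 (rot k A (n + 1) x) := by
  simp [algFace]

theorem algFace_zero (n : ℕ) : algFace k A n 0 = mergeAt (LinearMap.mul' k A) n 0 :=
  algFace_castSucc k A n 0

theorem algFace_succ_rot (n : ℕ) (i : Fin (n + 1)) (x : TPow k A (n + 1)) :
    algFace k A n i.succ (rot k A (n + 1) x) = rot k A n (algFace k A n i.castSucc x) := by
  rw [algFace_castSucc]
  cases i using Fin.lastCases with
  | last => rw [Fin.succ_last, algFace_last, mergeAt_zero_rot_rot]
  | cast i =>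
    cases n with
    | zero => exact i.elim0
    | succ n => rw [← Fin.castSucc_succ, algFace_castSucc, mergeAt_rot]

theorem mul'_assoc (a b c : A) : LinearMap.mul' k A (LinearMap.mul' k A (a ⊗ₜ b) ⊗ₜ c) =
    LinearMap.mul' k A (a ⊗ₜ LinearMap.mul' k A (b ⊗ₜ c)) := by
  simp [mul_assoc]

/-- The cyclic module of an algebra over `k`: the degeneracy `sⱼ` inserts `1` after the factor
number `j`, and the cyclic operator is the rotation. -/
noncomputable def algParacyclic : ParacyclicModule.{u, v} k where
  X n := TPow k A n
  d := algFace k A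
  s := splitAt (insertRight (1 : A))
  t := rot k A
  d_d n i j h x := by
    cases i using Fin.lastCases with
    | last =>
      obtain rfl : j = Fin.last _ := Fin.last_le_iff.mp h
      rw [Fin.succ_last, algFace_last, algFace_last, algFace_last, algFace_castSucc,
        ← mergeAt_zero_rot_rot]
      have h1 := mergeAt_rot (LinearMap.mul' k A) n 0 (rot k A (n + 2) x)
      have h2 := mergeAt_mergeAt _ (mul'_assoc k A) n 0 0 le_rfl
        (rot k A (n + 2) (rot k A (n + 2) x))
      rw [Fin.castSucc_zero] at h1 h2
      rw [← h1, h2]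
    | cast i =>
      rw [algFace_castSucc, algFace_castSucc]
      cases j using Fin.lastCases with
      | last =>
        rw [Fin.succ_last, algFace_last, algFace_last, ← mergeAt_rot,
          mergeAt_mergeAt _ (mul'_assoc k A) n 0 i (Fin.zero_le _)]
        rfl
      | cast j =>
        rw [← Fin.castSucc_succ, algFace_castSucc, algFace_castSucc,
          mergeAt_mergeAt _ (mul'_assoc k A) n i j (by simpa using h)]
  s_s n i j h x := splitAt_splitAt _ (fun a => rfl) n i j h x
  d_s_of_le n i j h x := by
    cases i using Fin.lastCases with
    | last => exact absurd h (not_le.mpr (Fin.castSucc_lt_last j))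
    | cast i =>
      rw [algFace_castSucc, algFace_castSucc, mergeAt_splitAt_le _ _ _ _ _ (by simpa using h)]
  d_s_self n i x := by
    rw [algFace_castSucc, mergeAt_splitAt_self _ _ (by simp)]
  d_s_succ n i x := by
    cases i using Fin.lastCases with
    | last => rw [Fin.succ_last, algFace_last, mergeAt_zero_rot_splitAt_last _ _ (by simp)]
    | cast i =>
      cases n with
      | zero => exact i.elim0
      | succ n =>
        rw [← Fin.castSucc_succ, algFace_castSucc, mergeAt_splitAt_succ _ _ (by simp)]
  d_s_of_gt n i j h x := by
    cases i using Fin.lastCases with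
    | last =>
      rw [Fin.succ_last, algFace_last, algFace_last, ← splitAt_rot, ← Fin.castSucc_zero,
        mergeAt_splitAt_le _ _ _ _ _ (Fin.zero_le _)]
    | cast i =>
      rw [← Fin.castSucc_succ, algFace_castSucc, algFace_castSucc,
        mergeAt_splitAt_gt _ _ _ _ _ (by simpa using h)]
  d_succ_t := algFace_succ_rot k A
  d_zero_t n x := by rw [algFace_zero, algFace_last]
  s_succ_t n j x := splitAt_rot _ n j x
  s_zero_t n x := splitAt_zero_rot _ n x

variable {k A} (B : Subalgebra k A)

/-- The submodule of `A ⊗ ⋯ ⊗ A` (`n + 1` factors) spanned by the elements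
`⋯ ⊗ aᵢ b ⊗ aᵢ₊₁ ⊗ ⋯ - ⋯ ⊗ aᵢ ⊗ b aᵢ₊₁ ⊗ ⋯` with `b ∈ B`, the indices being read cyclically:
for `i = n` these are the elements `a₀ ⊗ ⋯ ⊗ aₙ b - b a₀ ⊗ ⋯ ⊗ aₙ`. -/
noncomputable def cyclicRel (n : ℕ) : Submodule k (TPow k A n) :=
  Submodule.span k {z | ∃ (i : Fin (n + 1)) (b : A) (_ : b ∈ B) (x : TPow k A n),
    z = slot (LinearMap.mulRight k b) n i x - slot (LinearMap.mulLeft k b) n (i + 1) x}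

theorem cyclicRel_mem {n : ℕ} (i : Fin (n + 1)) {b : A} (hb : b ∈ B) (x : TPow k A n) :
    slot (LinearMap.mulRight k b) n i x - slot (LinearMap.mulLeft k b) n (i + 1) x ∈
      cyclicRel B n := Submodule.subset_span ⟨i, b, hb, x, rfl⟩

theorem cyclicRel_le {n : ℕ} {P : Submodule k (TPow k A n)}
    (h : ∀ (i : Fin (n + 1)) (b : A) (_ : b ∈ B) (x : TPow k A n),
      slot (LinearMap.mulRight k b) n i x - slot (LinearMap.mulLeft k b) n (i + 1) x ∈ P) :
    cyclicRel B n ≤ P := by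
  refine Submodule.span_le.mpr ?_
  rintro _ ⟨i, b, hb, x, rfl⟩
  exact h i b hb x

theorem cyclicRel_rot (n : ℕ) : cyclicRel B n ≤ (cyclicRel B n).comap (rot k A n) := by
  refine cyclicRel_le B fun i b hb x => ?_
  rw [Submodule.mem_comap, map_sub, rot_slot, rot_slot]
  exact cyclicRel_mem B _ hb _

theorem rot_surjective (n : ℕ) (x : TPow k A n) : ∃ y, rot k A n y = x :=
  ⟨(rot k A n ^ n) x, by rw [← Module.End.mul_apply, ← pow_succ', rot_pow]; rfl⟩

theorem cyclicRel_of_rot (n : ℕ) : ∀ x ∈ cyclicRel B n, ∃ y ∈ cyclicRel B n, rot k A n y = x := by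
  suffices H : cyclicRel B n ≤ (cyclicRel B n).map (rot k A n) from fun x hx => H hx
  refine cyclicRel_le B fun i b hb x => ?_
  obtain ⟨y, rfl⟩ := rot_surjective n x
  refine ⟨_, cyclicRel_mem B (i - 1) hb y, ?_⟩
  rw [map_sub, rot_slot, rot_slot]
  simp

theorem slot_succ_mergeAt_zero (f : A →ₗ[k] A) (n : ℕ) (j : Fin (n + 1)) (hj : j ≠ 0)
    (x : TPow k A (n + 1)) : mergeAt (LinearMap.mul' k A) n 0 (slot f (n + 1) j.succ x) =
      slot f n j (mergeAt (LinearMap.mul' k A) n 0 x) := by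
  cases n with
  | zero => exact absurd (Subsingleton.elim (α := Fin 1) j 0) hj
  | succ n =>
    obtain ⟨j, rfl⟩ := Fin.exists_succ_eq.mpr hj
    refine LinearMap.congr_fun (f := mergeAt (LinearMap.mul' k A) (n + 1) 0 ∘ₗ slot f _ j.succ.succ)
      (g := slot f _ j.succ ∘ₗ mergeAt (LinearMap.mul' k A) (n + 1) 0)
      (hom_ext_cons fun a y => ?_) x
    refine LinearMap.congr_fun
      (f := mergeAt (LinearMap.mul' k A) (n + 1) 0 ∘ₗ slot f _ j.succ.succ ∘ₗ cons (n + 1) a)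
      (g := slot f _ j.succ ∘ₗ mergeAt (LinearMap.mul' k A) (n + 1) 0 ∘ₗ cons (n + 1) a)
      (hom_ext_cons fun b z => ?_) y
    simp only [LinearMap.comp_apply]
    rw [slot_succ_cons, slot_succ_cons, mergeAt_zero_cons, mergeAt_zero_cons, slot_succ_cons]

/-- An identity of operators in the first two factors. -/
theorem mergeAt_zero_ext (n : ℕ) {W : Type v} [AddCommGroup W] [Module k W]
    {F G : TPow k A (n + 1) →ₗ[k] W}
    (h0 : ∀ (hn : n = 0) (a b : A), F (hn ▸ (a ⊗ₜ[k] b : TPow k A 1)) = G (hn ▸ (a ⊗ₜ[k] b : TPow k A 1)))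
    (h1 : ∀ (m : ℕ) (hm : n = m + 1) (a b : A) (z : TPow k A m),
      F (hm ▸ cons (m + 1) a (cons m b z)) = G (hm ▸ cons (m + 1) a (cons m b z))) : F = G := by
  cases n with
  | zero => exact hom_ext_cons fun a b => h0 rfl a b
  | succ n =>
    refine hom_ext_cons fun a y => ?_
    exact LinearMap.congr_fun (f := F ∘ₗ cons (n + 1) a) (g := G ∘ₗ cons (n + 1) a)
      (hom_ext_cons fun b z => h1 n rfl a b z) y

theorem slot_mergeAt_zero_right (b : A) (n : ℕ) (x : TPow k A (n + 1)) :
    mergeAt (LinearMap.mul' k A) n 0 (slot (LinearMap.mulRight k b) (n + 1) 1 x) =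
      slot (LinearMap.mulRight k b) n 0 (mergeAt (LinearMap.mul' k A) n 0 x) := by
  refine LinearMap.congr_fun
    (f := mergeAt (LinearMap.mul' k A) n 0 ∘ₗ slot (LinearMap.mulRight k b) (n + 1) 1)
    (g := slot (LinearMap.mulRight k b) n 0 ∘ₗ mergeAt (LinearMap.mul' k A) n 0)
    (mergeAt_zero_ext n ?_ ?_) x
  · rintro rfl a c
    exact (mul_assoc a c b).symm
  · rintro m rfl a c z
    change cons m (a * (c * b)) z = cons m (a * c * b) z
    rw [mul_assoc]

theorem slot_mergeAt_zero_left (b : A) (n : ℕ) (x : TPow k A (n + 1)) :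
    mergeAt (LinearMap.mul' k A) n 0 (slot (LinearMap.mulLeft k b) (n + 1) 0 x) =
      slot (LinearMap.mulLeft k b) n 0 (mergeAt (LinearMap.mul' k A) n 0 x) := by
  refine LinearMap.congr_fun
    (f := mergeAt (LinearMap.mul' k A) n 0 ∘ₗ slot (LinearMap.mulLeft k b) (n + 1) 0)
    (g := slot (LinearMap.mulLeft k b) n 0 ∘ₗ mergeAt (LinearMap.mul' k A) n 0)
    (mergeAt_zero_ext n ?_ ?_) x
  · rintro rfl a c
    exact mul_assoc b a c
  · rintro m rfl a c z
    change cons m (b * a * c) z = cons m (b * (a * c)) z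
    rw [mul_assoc]

theorem slot_mergeAt_zero_middle (b : A) (n : ℕ) (x : TPow k A (n + 1)) :
    mergeAt (LinearMap.mul' k A) n 0 (slot (LinearMap.mulRight k b) (n + 1) 0 x) =
      mergeAt (LinearMap.mul' k A) n 0 (slot (LinearMap.mulLeft k b) (n + 1) 1 x) := by
  refine LinearMap.congr_fun
    (f := mergeAt (LinearMap.mul' k A) n 0 ∘ₗ slot (LinearMap.mulRight k b) (n + 1) 0)
    (g := mergeAt (LinearMap.mul' k A) n 0 ∘ₗ slot (LinearMap.mulLeft k b) (n + 1) 1)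
    (mergeAt_zero_ext n ?_ ?_) x
  · rintro rfl a c
    exact mul_assoc a b c
  · rintro m rfl a c z
    change cons m (a * b * c) z = cons m (a * (b * c)) z
    rw [mul_assoc]

theorem fin_succ_add_one (n : ℕ) (j : Fin (n + 1)) :
    (j.succ + 1 : Fin (n + 2)) = if j = Fin.last n then 0 else (j + 1).succ := by
  cases j using Fin.lastCases with
  | last => rw [if_pos rfl, Fin.succ_last, Fin.last_add_one]
  | cast j =>
    cases n with
    | zero => exact j.elim0
    | succ n =>
      rw [if_neg (Fin.castSucc_lt_last j).ne, ← Fin.castSucc_succ, Fin.coeSucc_eq_succ,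
        Fin.coeSucc_eq_succ]

theorem fin_add_one_ne_zero (n : ℕ) (j : Fin (n + 1)) (h : j ≠ Fin.last n) : j + 1 ≠ 0 := by
  intro h'
  apply h
  rw [eq_neg_of_add_eq_zero_left h', eq_neg_of_add_eq_zero_left (Fin.last_add_one n)]

theorem cyclicRel_mergeAt_zero (n : ℕ) : cyclicRel B (n + 1) ≤
    (cyclicRel B n).comap (mergeAt (LinearMap.mul' k A) n 0) := by
  refine cyclicRel_le B fun i b hb x => ?_
  rw [Submodule.mem_comap, map_sub]
  cases i using Fin.cases with
  | zero => rw [zero_add, slot_mergeAt_zero_middle, sub_self]; exact zero_mem _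
  | succ j =>
    have hR : mergeAt (LinearMap.mul' k A) n 0 (slot (LinearMap.mulRight k b) (n + 1) j.succ x) =
        slot (LinearMap.mulRight k b) n j (mergeAt (LinearMap.mul' k A) n 0 x) := by
      by_cases hj : j = 0
      · subst hj; exact slot_mergeAt_zero_right b n x
      · exact slot_succ_mergeAt_zero _ n j hj x
    have hL : mergeAt (LinearMap.mul' k A) n 0
          (slot (LinearMap.mulLeft k b) (n + 1) (j.succ + 1) x) =
        slot (LinearMap.mulLeft k b) n (j + 1) (mergeAt (LinearMap.mul' k A) n 0 x) := by
      rw [fin_succ_add_one]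
      split_ifs with h
      · rw [h, Fin.last_add_one, slot_mergeAt_zero_left]
      · exact slot_succ_mergeAt_zero _ n _ (fin_add_one_ne_zero n j h) x
    rw [hR, hL]
    exact cyclicRel_mem B j hb _

theorem cyclicRel_algFace (n : ℕ) (i : Fin (n + 2)) : cyclicRel B (n + 1) ≤
    (cyclicRel B n).comap (algFace k A n i) := by
  induction i using Fin.induction with
  | zero => rw [algFace_zero]; exact cyclicRel_mergeAt_zero B n
  | succ i ih =>
    intro x hx
    obtain ⟨y, hy, rfl⟩ := cyclicRel_of_rot B _ x hx
    rw [Submodule.mem_comap, algFace_succ_rot]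
    exact cyclicRel_rot B n (ih hy)

theorem slot_splitAt_zero (f : A →ₗ[k] A) (n : ℕ) (j : Fin (n + 1)) (hj : j ≠ 0)
    (x : TPow k A n) : splitAt (insertRight (1 : A)) n 0 (slot f n j x) =
      slot f (n + 1) j.succ (splitAt (insertRight (1 : A)) n 0 x) := by
  cases n with
  | zero => exact absurd (Subsingleton.elim (α := Fin 1) j 0) hj
  | succ n =>
    obtain ⟨j, rfl⟩ := Fin.exists_succ_eq.mpr hj
    refine LinearMap.congr_fun (f := splitAt (insertRight (1 : A)) (n + 1) 0 ∘ₗ slot f _ j.succ)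
      (g := slot f _ j.succ.succ ∘ₗ splitAt (insertRight (1 : A)) (n + 1) 0)
      (hom_ext_cons fun a y => ?_) x
    simp only [LinearMap.comp_apply]
    rw [slot_succ_cons, splitAt_insert_zero_cons, splitAt_insert_zero_cons, slot_succ_cons,
      slot_succ_cons]

theorem slot_zero_splitAt_zero (f : A →ₗ[k] A) (n : ℕ) (x : TPow k A n) :
    splitAt (insertRight (1 : A)) n 0 (slot f n 0 x) =
      slot f (n + 1) 0 (splitAt (insertRight (1 : A)) n 0 x) := by
  cases n with
  | zero => rfl
  | succ n =>
    refine LinearMap.congr_fun (f := splitAt (insertRight (1 : A)) (n + 1) 0 ∘ₗ slot f _ 0)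
      (g := slot f _ 0 ∘ₗ splitAt (insertRight (1 : A)) (n + 1) 0)
      (hom_ext_cons fun a y => ?_) x
    simp only [LinearMap.comp_apply]
    rw [slot_zero_cons, splitAt_insert_zero_cons, splitAt_insert_zero_cons, slot_zero_cons]

theorem slot_one_splitAt_zero (b : A) (n : ℕ) (x : TPow k A n) :
    slot (LinearMap.mulLeft k b) (n + 1) 1 (splitAt (insertRight (1 : A)) n 0 x) =
      slot (LinearMap.mulRight k b) (n + 1) 1 (splitAt (insertRight (1 : A)) n 0 x) := by
  cases n with
  | zero =>
    change x ⊗ₜ[k] (b * 1) = x ⊗ₜ[k] (1 * b)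
    rw [mul_one, one_mul]
  | succ n =>
    refine LinearMap.congr_fun
      (f := slot (LinearMap.mulLeft k b) (n + 2) 1 ∘ₗ splitAt (insertRight (1 : A)) (n + 1) 0)
      (g := slot (LinearMap.mulRight k b) (n + 2) 1 ∘ₗ splitAt (insertRight (1 : A)) (n + 1) 0)
      (hom_ext_cons fun a y => ?_) x
    simp only [LinearMap.comp_apply]
    rw [splitAt_insert_zero_cons]
    change cons (n + 1) a (cons n (b * 1) y) = cons (n + 1) a (cons n (1 * b) y)
    rw [mul_one, one_mul]

theorem cyclicRel_splitAt_zero (n : ℕ) : cyclicRel B n ≤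
    (cyclicRel B (n + 1)).comap (splitAt (insertRight (1 : A)) n 0) := by
  refine cyclicRel_le B fun i b hb x => ?_
  rw [Submodule.mem_comap, map_sub]
  set y := splitAt (insertRight (1 : A)) n 0 x with hy
  have hL : splitAt (insertRight (1 : A)) n 0 (slot (LinearMap.mulLeft k b) n (i + 1) x) =
      slot (LinearMap.mulLeft k b) (n + 1) (i.succ + 1) y := by
    rw [fin_succ_add_one]
    split_ifs with h
    · rw [h, Fin.last_add_one, slot_zero_splitAt_zero]
    · exact slot_splitAt_zero _ n _ (fin_add_one_ne_zero n i h) x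
  rw [hL]
  by_cases hi : i = 0
  · subst hi
    rw [slot_zero_splitAt_zero]
    have h1 := cyclicRel_mem B (0 : Fin (n + 2)) hb y
    have h2 := cyclicRel_mem B (1 : Fin (n + 2)) hb y
    rw [zero_add, hy, slot_one_splitAt_zero, ← hy] at h1
    have h3 := add_mem h1 h2
    rw [sub_add_sub_cancel] at h3
    exact h3
  · rw [slot_splitAt_zero _ _ _ hi]
    exact cyclicRel_mem B i.succ hb y

theorem cyclicRel_splitAt (n : ℕ) (j : Fin (n + 1)) : cyclicRel B n ≤
    (cyclicRel B (n + 1)).comap (splitAt (insertRight (1 : A)) n j) := by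
  induction j using Fin.induction with
  | zero => exact cyclicRel_splitAt_zero B n
  | succ i ih =>
    intro x hx
    cases n with
    | zero => exact i.elim0
    | succ n =>
      obtain ⟨y, hy, rfl⟩ := cyclicRel_of_rot B _ x hx
      rw [Submodule.mem_comap, splitAt_rot]
      exact cyclicRel_rot B _ (ih hy)

/-- The cyclic module of the algebra extension `B ⊆ A`. -/
noncomputable def relativeCyclic : CyclicModule.{u, v} k :=
  (algParacyclic k A).quot (cyclicRel B) (cyclicRel_algFace B) (cyclicRel_splitAt B)
    (cyclicRel_rot B) (fun n x => by
      have h : (rot k A n ^ (n + 1)) x = x := by rw [rot_pow]; rfl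
      exact (congrArg (· ∈ cyclicRel B n) (sub_eq_zero.mpr h)).mpr (zero_mem _))

end AlgebraExtensions

section Convolution

variable {k : Type u} [Field k] {H : Type v} [Ring H] [HopfAlgebra k H]
variable {E : Type w} [Ring E] [Algebra k E] {F : Type x} [Ring F] [Algebra k F]

/-- Convolution `h ↦ f(h₁) g(h₂)`. -/
noncomputable def cv (f g : H →ₗ[k] E) : H →ₗ[k] E :=
  LinearMap.mul' k E ∘ₗ TensorProduct.map f g ∘ₗ Coalgebra.comul

theorem cv_assoc (f g h : H →ₗ[k] E) : cv (cv f g) h = cv f (cv g h) := by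
  have := mul_assoc (WithConv.toConv f) (WithConv.toConv g) (WithConv.toConv h)
  exact congrArg WithConv.ofConv this

/-- The unit for the convolution. -/
noncomputable def cvOne (k : Type u) [Field k] (H : Type v) [Ring H] [HopfAlgebra k H]
    (E : Type w) [Ring E] [Algebra k E] : H →ₗ[k] E :=
  Algebra.linearMap k E ∘ₗ Coalgebra.counit

theorem cvOne_cv (f : H →ₗ[k] E) : cv (cvOne k H E) f = f :=
  congrArg WithConv.ofConv (one_mul (WithConv.toConv f))

theorem cv_cvOne (f : H →ₗ[k] E) : cv f (cvOne k H E) = f :=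
  congrArg WithConv.ofConv (mul_one (WithConv.toConv f))

theorem cv_comp (φ : E →ₐ[k] F) (f g : H →ₗ[k] E) :
    cv (φ.toLinearMap ∘ₗ f) (φ.toLinearMap ∘ₗ g) = φ.toLinearMap ∘ₗ cv f g :=
  (LinearMap.algHom_comp_convMul_distrib φ (WithConv.toConv f) (WithConv.toConv g)).symm

theorem comp_cvOne (φ : E →ₐ[k] F) : φ.toLinearMap ∘ₗ cvOne k H E = cvOne k H F := by
  ext h
  exact φ.commutes _

theorem cv_antipode_id : cv (HopfAlgebra.antipode k (A := H)) LinearMap.id = cvOne k H H :=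
  congrArg WithConv.ofConv LinearMap.antipode_mul_id

theorem cv_id_antipode : cv LinearMap.id (HopfAlgebra.antipode k (A := H)) = cvOne k H H :=
  congrArg WithConv.ofConv LinearMap.id_mul_antipode

/-- `h ↦ h ⊗ 1`. -/
noncomputable def inL : H →ₗ[k] H ⊗[k] H :=
  (Algebra.TensorProduct.includeLeft : H →ₐ[k] H ⊗[k] H).toLinearMap
/-- `h ↦ 1 ⊗ h`. -/
noncomputable def inR : H →ₗ[k] H ⊗[k] H :=
  (Algebra.TensorProduct.includeRight : H →ₐ[k] H ⊗[k] H).toLinearMap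

theorem cv_inL_inR : cv (inL (k := k) (H := H)) inR = Coalgebra.comul := by
  have : LinearMap.mul' k (H ⊗[k] H) ∘ₗ TensorProduct.map (inL (k := k) (H := H)) inR =
      LinearMap.id := TensorProduct.ext' fun a b => by simp [inL, inR]
  rw [cv, ← LinearMap.comp_assoc, this, LinearMap.id_comp]

/-- The antipode is an anti-homomorphism of coalgebras: `Δ(S h) = S h₂ ⊗ S h₁`. -/
theorem comul_antipode : Coalgebra.comul ∘ₗ HopfAlgebra.antipode k (A := H) =
    cv (inR ∘ₗ HopfAlgebra.antipode k (A := H)) (inL ∘ₗ HopfAlgebra.antipode k (A := H)) := by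
  set S := HopfAlgebra.antipode k (A := H)
  have hR : cv (inR ∘ₗ S) inR = cvOne k H (H ⊗[k] H) := by
    have := cv_comp (Algebra.TensorProduct.includeRight : H →ₐ[k] H ⊗[k] H) S LinearMap.id
    rw [cv_antipode_id, comp_cvOne] at this
    exact this
  have hL : cv (inL ∘ₗ S) inL = cvOne k H (H ⊗[k] H) := by
    have := cv_comp (Algebra.TensorProduct.includeLeft : H →ₐ[k] H ⊗[k] H) S LinearMap.id
    rw [cv_antipode_id, comp_cvOne] at this
    exact this
  have h1 : cv (cv (inR ∘ₗ S) (inL ∘ₗ S)) Coalgebra.comul = cvOne k H (H ⊗[k] H) := by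
    rw [← cv_inL_inR, cv_assoc, ← cv_assoc (inL ∘ₗ S), hL, cvOne_cv, hR]
  have h2 : cv Coalgebra.comul (Coalgebra.comul ∘ₗ S) = cvOne k H (H ⊗[k] H) := by
    have := cv_comp (Bialgebra.comulAlgHom k H) LinearMap.id S
    rw [cv_id_antipode, comp_cvOne] at this
    exact this
  rw [← cvOne_cv (Coalgebra.comul ∘ₗ S), ← h1, cv_assoc, h2, cv_cvOne]

/-- `h ↦ h₁ ⊗ (h₂ ⊗ h₃)`. -/
noncomputable def comul3 (k : Type u) [Field k] (H : Type v) [Ring H] [HopfAlgebra k H] :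
    H →ₗ[k] H ⊗[k] (H ⊗[k] H) :=
  (Coalgebra.comul (R := k) (A := H)).lTensor H ∘ₗ Coalgebra.comul

end Convolution

section SAYD

variable (k : Type u) [Field k] (H : Type v) [Ring H] [HopfAlgebra k H]

variable {k H} in
/-- For a left action `n ↦ h n` of `H` on `N`: the linear map which sends `p ⊗ (q ⊗ r)` to the
operator `n ⊗ g ↦ q n ⊗ r g S(p)` of `N ⊗ H`. -/
noncomputable def aydPre {N : Type w} [AddCommGroup N] [Module k N] (act : H →ₗ[k] N →ₗ[k] N) :
    H ⊗[k] (H ⊗[k] H) →ₗ[k] (N ⊗[k] H →ₗ[k] N ⊗[k] H) :=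
  TensorProduct.lift ((LinearMap.llcomp k (N ⊗[k] H) (N ⊗[k] H) (N ⊗[k] H)).compl₁₂
      (LinearMap.lTensorHom N ∘ₗ (LinearMap.mul k H).flip ∘ₗ HopfAlgebra.antipode k)
      (TensorProduct.map₂ act (LinearMap.mul k H)))

variable {k H} in
/-- For a left action `n ↦ h n` of `H` on `N`: the operator `n ⊗ g ↦ h₂ n ⊗ h₃ g S(h₁)` of
`N ⊗ H`. -/
noncomputable def aydTwist {N : Type w} [AddCommGroup N] [Module k N] (act : H →ₗ[k] N →ₗ[k] N) :
    H →ₗ[k] (N ⊗[k] H →ₗ[k] N ⊗[k] H) :=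
  aydPre act ∘ₗ comul3 k H

/-- A left-right stable anti-Yetter-Drinfeld module over `H`: a left `H`-module and a right
`H`-comodule `N` such that `(h n)₀ ⊗ (h n)₁ = h₂ n₀ ⊗ h₃ n₁ S(h₁)` (the anti-Yetter-Drinfeld
condition) and `n₁ n₀ = n` (stability). -/
structure SAYDModule (N : Type w) [AddCommGroup N] [Module k N] where
  act : H →ₗ[k] N →ₗ[k] N
  one_act : ∀ n, act 1 n = n
  mul_act : ∀ g h n, act (g * h) n = act g (act h n)
  coact : N →ₗ[k] N ⊗[k] H
  coassoc : ∀ n, TensorProduct.assoc k N H H (coact.rTensor H (coact n)) =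
    (Coalgebra.comul (R := k) (A := H)).lTensor N (coact n)
  counit : ∀ n, TensorProduct.rid k N
    ((Coalgebra.counit (R := k) (A := H)).lTensor N (coact n)) = n
  ayd : ∀ h n, coact (act h n) = aydTwist act h (coact n)
  stable : ∀ n, TensorProduct.lift act.flip (coact n) = n

/-- The structure of a right `H`-comodule algebra on `A`: a coassociative and counital coaction
`A → A ⊗ H` which is a homomorphism of algebras. -/
structure ComoduleAlgebra (A : Type w) [Ring A] [Algebra k A] where
  coact : A →ₐ[k] A ⊗[k] H
  coassoc : ∀ a, TensorProduct.assoc k A H H (coact.toLinearMap.rTensor H (coact a)) =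
    (Coalgebra.comul (R := k) (A := H)).lTensor A (coact a)
  counit : ∀ a, TensorProduct.rid k A
    ((Coalgebra.counit (R := k) (A := H)).lTensor A (coact a)) = a

/-- The structure of a right `H`-module coalgebra on `C`: a right action `(c, h) ↦ c h` with
`Δ(c h) = c₁ h₁ ⊗ c₂ h₂` and `ε(c h) = ε(c) ε(h)`. -/
structure ModuleCoalgebra (C : Type x) [AddCommGroup C] [Module k C] [Coalgebra k C] where
  act : C →ₗ[k] H →ₗ[k] C
  act_one : ∀ c, act c 1 = c
  act_mul : ∀ c g h, act c (g * h) = act (act c g) h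
  comul_act : ∀ c h, Coalgebra.comul (R := k) (act c h) =
    TensorProduct.map₂ act act (Coalgebra.comul c) (Coalgebra.comul h)
  counit_act : ∀ c h, Coalgebra.counit (R := k) (act c h) =
    Coalgebra.counit (R := k) c * Coalgebra.counit (R := k) h

end SAYD

section Twist

variable {k : Type u} [Field k] {H : Type v} [Ring H] [HopfAlgebra k H]
variable {N : Type w} [AddCommGroup N] [Module k N] {N' : Type x} [AddCommGroup N'] [Module k N']
variable {X : Type y} [AddCommGroup X] [Module k X]

open HopfAlgebra

theorem aydTwist_eq (act : H →ₗ[k] N →ₗ[k] N) (h : H) :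
    aydTwist act h = aydPre act (comul3 k H h) := rfl

theorem aydPre_tmul (act : H →ₗ[k] N →ₗ[k] N) (p q r g : H) (n : N) :
    aydPre act (p ⊗ₜ (q ⊗ₜ r)) (n ⊗ₜ g) = act q n ⊗ₜ (r * g * antipode k p) := rfl

theorem hom_ext_three {F G : H ⊗[k] (H ⊗[k] H) →ₗ[k] X}
    (h : ∀ p q r, F (p ⊗ₜ (q ⊗ₜ r)) = G (p ⊗ₜ (q ⊗ₜ r))) : F = G := by
  ext p q r; exact h p q r

theorem aydTwist_natural (act : H →ₗ[k] N →ₗ[k] N) (act' : H →ₗ[k] N' →ₗ[k] N') (f : N →ₗ[k] N')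
    (hf : ∀ h n, f (act h n) = act' h (f n)) (h : H) (w : N ⊗[k] H) :
    f.rTensor H (aydTwist act h w) = aydTwist act' h (f.rTensor H w) := by
  rw [aydTwist_eq, aydTwist_eq]
  generalize comul3 k H h = z
  induction w using TensorProduct.induction_on with
  | zero => simp
  | add p q hp hq => simp only [map_add, hp, hq]
  | tmul n g =>
    refine LinearMap.congr_fun (f := f.rTensor H ∘ₗ (aydPre act).flip (n ⊗ₜ g))
      (g := (aydPre act').flip (f n ⊗ₜ g)) (hom_ext_three fun p q r => ?_) z
    simp only [LinearMap.comp_apply, LinearMap.flip_apply, aydPre_tmul, LinearMap.rTensor_tmul, hf]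

theorem comul3_mul (g h : H) : comul3 k H (g * h) = comul3 k H g * comul3 k H h :=
  ((Algebra.TensorProduct.map (AlgHom.id k H) (Bialgebra.comulAlgHom k H)).comp
    (Bialgebra.comulAlgHom k H)).map_mul g h

theorem comul3_one : comul3 k H 1 = 1 :=
  ((Algebra.TensorProduct.map (AlgHom.id k H) (Bialgebra.comulAlgHom k H)).comp
    (Bialgebra.comulAlgHom k H)).map_one

theorem aydTwist_mul (act : H →ₗ[k] N →ₗ[k] N)
    (hact : ∀ g h n, act (g * h) n = act g (act h n)) (g h : H) (w : N ⊗[k] H) :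
    aydTwist act (g * h) w = aydTwist act g (aydTwist act h w) := by
  rw [aydTwist_eq, aydTwist_eq, aydTwist_eq, comul3_mul]
  generalize comul3 k H g = y
  generalize comul3 k H h = z
  induction w using TensorProduct.induction_on with
  | zero => simp
  | add p q hp hq => simp only [map_add, hp, hq]
  | tmul n x =>
    refine LinearMap.congr_fun
      (f := (aydPre act).flip (n ⊗ₜ x) ∘ₗ LinearMap.mulLeft k y)
      (g := aydPre act y ∘ₗ (aydPre act).flip (n ⊗ₜ x)) (hom_ext_three fun p q r => ?_) z
    simp only [LinearMap.comp_apply, LinearMap.flip_apply, aydPre_tmul, LinearMap.mulLeft_apply]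
    refine LinearMap.congr_fun
      (f := (aydPre act).flip (n ⊗ₜ x) ∘ₗ LinearMap.mulRight k (p ⊗ₜ[k] (q ⊗ₜ[k] r)))
      (g := (aydPre act).flip (act q n ⊗ₜ (r * x * antipode k p)))
      (hom_ext_three fun p' q' r' => ?_) y
    simp only [LinearMap.comp_apply, LinearMap.flip_apply, aydPre_tmul, LinearMap.mulRight_apply,
      Algebra.TensorProduct.tmul_mul_tmul, hact, HopfAlgebra.antipode_mul_antidistrib, mul_assoc]

theorem aydTwist_one (act : H →ₗ[k] N →ₗ[k] N) (hact : ∀ n, act 1 n = n) (w : N ⊗[k] H) :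
    aydTwist act 1 w = w := by
  rw [aydTwist_eq, comul3_one]
  induction w using TensorProduct.induction_on with
  | zero => simp
  | add p q hp hq => simp only [map_add, hp, hq]
  | tmul n x =>
    change aydPre act (1 ⊗ₜ (1 ⊗ₜ 1)) _ = _
    rw [aydPre_tmul, hact, antipode_one, one_mul, mul_one]

/-- The inclusion of the first factor. -/
noncomputable def j1 (k : Type u) [Field k] (H : Type v) [Ring H] [HopfAlgebra k H] :
    H →ₐ[k] H ⊗[k] (H ⊗[k] H) := Algebra.TensorProduct.includeLeft
/-- The inclusion of the last two factors. -/
noncomputable def j23 (k : Type u) [Field k] (H : Type v) [Ring H] [HopfAlgebra k H] :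
    H ⊗[k] H →ₐ[k] H ⊗[k] (H ⊗[k] H) := Algebra.TensorProduct.includeRight

theorem comul3_eq_cv : comul3 k H = cv (j1 k H).toLinearMap
    ((j23 k H).toLinearMap ∘ₗ Coalgebra.comul) := by
  have : LinearMap.mul' k _ ∘ₗ TensorProduct.map (j1 k H).toLinearMap (j23 k H).toLinearMap =
      LinearMap.id := TensorProduct.ext' fun a b => by simp [j1, j23]
  have h2 : TensorProduct.map (j1 k H).toLinearMap ((j23 k H).toLinearMap ∘ₗ Coalgebra.comul) =
      TensorProduct.map (j1 k H).toLinearMap (j23 k H).toLinearMap ∘ₗ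
        (Coalgebra.comul (R := k) (A := H)).lTensor H :=
    TensorProduct.ext' fun a b => rfl
  rw [cv, h2, LinearMap.comp_assoc, ← LinearMap.comp_assoc, this]; rfl

/-- `S(h₁) h₂ ⊗ (h₃ ⊗ h₄) = 1 ⊗ (h₁ ⊗ h₂)`. -/
theorem word_antipode_left : cv ((j1 k H).toLinearMap ∘ₗ antipode k)
    (cv (j1 k H).toLinearMap ((j23 k H).toLinearMap ∘ₗ Coalgebra.comul)) =
    (j23 k H).toLinearMap ∘ₗ Coalgebra.comul := by
  rw [← cv_assoc]
  have := cv_comp (j1 k H) (antipode k) LinearMap.id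
  rw [LinearMap.comp_id] at this
  rw [this, cv_antipode_id, comp_cvOne, cvOne_cv]

/-- `h₁ S(h₂) ⊗ (h₃ ⊗ h₄) = 1 ⊗ (h₁ ⊗ h₂)`. -/
theorem word_antipode_right : cv (j1 k H).toLinearMap
    (cv ((j1 k H).toLinearMap ∘ₗ antipode k) ((j23 k H).toLinearMap ∘ₗ Coalgebra.comul)) =
    (j23 k H).toLinearMap ∘ₗ Coalgebra.comul := by
  rw [← cv_assoc]
  have := cv_comp (j1 k H) LinearMap.id (antipode k)
  rw [LinearMap.comp_id] at this
  rw [this, cv_id_antipode, comp_cvOne, cvOne_cv]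

theorem map_comul_left (f : H →ₗ[k] N) (g : H ⊗[k] H →ₗ[k] N') :
    TensorProduct.map f (g ∘ₗ Coalgebra.comul) ∘ₗ Coalgebra.comul =
      TensorProduct.map f g ∘ₗ comul3 k H := by
  rw [comul3, ← LinearMap.comp_assoc]
  congr 1
  exact TensorProduct.ext' fun a b => rfl

/-- `h₁ ⊗ h₂ ↦ aydTwist h₂ (n ⊗ g h₁)` gives `h₁ n ⊗ h₂ g`. -/
theorem aydTwist_right (act : H →ₗ[k] N →ₗ[k] N) (n : N) (g h : H) :
    TensorProduct.lift (((aydTwist act).flip ∘ₗ TensorProduct.mk k N H n ∘ₗ LinearMap.mulLeft k g))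
      (Coalgebra.comul h) =
    TensorProduct.map (act.flip n) (LinearMap.mulRight k g) (Coalgebra.comul h) := by
  -- the linear map `u ⊗ (v ⊗ w) ↦ v n ⊗ w g u`
  let L : H ⊗[k] (H ⊗[k] H) →ₗ[k] N ⊗[k] H :=
    TensorProduct.lift ((LinearMap.llcomp k (H ⊗[k] H) (N ⊗[k] H) (N ⊗[k] H)).flip
        (TensorProduct.map (act.flip n) (LinearMap.mulRight k g)) ∘ₗ
      LinearMap.lTensorHom N ∘ₗ (LinearMap.mul k H).flip)
  have hL : ∀ a b c, L (a ⊗ₜ (b ⊗ₜ c)) = act b n ⊗ₜ (c * g * a) := fun a b c => rfl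
  have key := congrArg L (LinearMap.congr_fun (word_antipode_right (k := k) (H := H)) h)
  have hr : L (((j23 k H).toLinearMap ∘ₗ Coalgebra.comul) h) =
      TensorProduct.map (act.flip n) (LinearMap.mulRight k g) (Coalgebra.comul h) := by
    refine LinearMap.congr_fun (f := L ∘ₗ (j23 k H).toLinearMap)
      (g := TensorProduct.map (act.flip n) (LinearMap.mulRight k g))
      (TensorProduct.ext' fun a b => ?_) (Coalgebra.comul h)
    change L (1 ⊗ₜ (a ⊗ₜ b)) = _
    rw [hL, mul_one]; rfl
  rw [← hr, ← key]
  refine LinearMap.congr_fun (f := TensorProduct.lift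
      ((aydTwist act).flip ∘ₗ TensorProduct.mk k N H n ∘ₗ LinearMap.mulLeft k g))
    (g := L ∘ₗ LinearMap.mul' k _ ∘ₗ TensorProduct.map (j1 k H).toLinearMap
      (cv ((j1 k H).toLinearMap ∘ₗ antipode k) ((j23 k H).toLinearMap ∘ₗ Coalgebra.comul)))
    (TensorProduct.ext' fun a b => ?_) (Coalgebra.comul h)
  change aydTwist act b (n ⊗ₜ (g * a)) = L (j1 k H a * _)
  rw [aydTwist_eq]
  rw [cv, map_comul_left]
  change _ = L (j1 k H a * LinearMap.mul' k _ (TensorProduct.map _ _ (comul3 k H b)))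
  refine LinearMap.congr_fun (f := (aydPre act).flip (n ⊗ₜ (g * a)))
    (g := L ∘ₗ LinearMap.mulLeft k (j1 k H a) ∘ₗ LinearMap.mul' k _ ∘ₗ
      TensorProduct.map ((j1 k H).toLinearMap ∘ₗ antipode k) (j23 k H).toLinearMap)
    (hom_ext_three fun p q r => ?_) (comul3 k H b)
  change aydPre act (p ⊗ₜ (q ⊗ₜ r)) (n ⊗ₜ (g * a)) = L ((a ⊗ₜ 1) * ((antipode k p ⊗ₜ 1) * (1 ⊗ₜ (q ⊗ₜ r))))
  rw [aydPre_tmul, Algebra.TensorProduct.tmul_mul_tmul, Algebra.TensorProduct.tmul_mul_tmul, one_mul,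
    one_mul, mul_one, hL]
  simp only [mul_assoc]

/-- A linear functional of `h₁ ⊗ h₂ ⊗ h₃` which only depends on `S(h₁) h₂₁ ⊗ (h₂₂ ⊗ h₃)`. -/
theorem comul3_antipode_left (Λ : H ⊗[k] (H ⊗[k] H) →ₗ[k] X) (L : H ⊗[k] (H ⊗[k] H) →ₗ[k] X)
    (h : ∀ p q r, Λ (p ⊗ₜ (q ⊗ₜ r)) =
      L (j1 k H (antipode k p) * (TensorProduct.assoc k H H H (Coalgebra.comul q ⊗ₜ r)))) (z : H) :
    Λ (comul3 k H z) = L (j23 k H (Coalgebra.comul z)) := by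
  have key := congrArg L (LinearMap.congr_fun (word_antipode_left (k := k) (H := H)) z)
  refine Eq.trans ?_ key
  rw [← comul3_eq_cv]
  have e : comul3 k H = (TensorProduct.assoc k H H H).toLinearMap ∘ₗ
      (Coalgebra.comul (R := k) (A := H)).rTensor H ∘ₗ Coalgebra.comul := by
    ext x; exact (Coalgebra.coassoc_apply x).symm
  have e2 : cv ((j1 k H).toLinearMap ∘ₗ antipode k) (comul3 k H) =
      LinearMap.mul' k _ ∘ₗ TensorProduct.map ((j1 k H).toLinearMap ∘ₗ antipode k)
        ((TensorProduct.assoc k H H H).toLinearMap ∘ₗ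
          (Coalgebra.comul (R := k) (A := H)).rTensor H) ∘ₗ comul3 k H := by
    conv_lhs => rw [e]
    rw [cv, ← LinearMap.comp_assoc (h := (TensorProduct.assoc k H H H).toLinearMap), map_comul_left]
  rw [e2]
  exact LinearMap.congr_fun (f := Λ) (g := L ∘ₗ LinearMap.mul' k _ ∘ₗ
    TensorProduct.map ((j1 k H).toLinearMap ∘ₗ antipode k)
        ((TensorProduct.assoc k H H H).toLinearMap ∘ₗ
          (Coalgebra.comul (R := k) (A := H)).rTensor H)) (hom_ext_three fun p q r => h p q r) _

end Twist

section CanonicalSAYD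

variable {k : Type u} [Field k] {H : Type v} [Ring H] [HopfAlgebra k H]
variable {A : Type w} [Ring A] [Algebra k A] (ρ : ComoduleAlgebra k H A)

open HopfAlgebra

/-- The subspace of `H ⊗ A` spanned by the elements `h a'₁ ⊗ a a'₀ - h ⊗ a' a`. -/
noncomputable def saydRel : Submodule k (H ⊗[k] A) :=
  Submodule.span k {z | ∃ (h : H) (a a' : A), z =
    TensorProduct.map (LinearMap.mulLeft k h) (LinearMap.mulLeft k a)
      (TensorProduct.comm k A H (ρ.coact a')) - h ⊗ₜ[k] (a' * a)}

/-- The space `M = (H ⊗ A) / ⟨h a'₁ ⊗ a a'₀ - h ⊗ a' a⟩`. -/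
abbrev SAYDSpace : Type (max v w) := (H ⊗[k] A) ⧸ saydRel ρ

theorem saydRel_le_comap (h : H) :
    saydRel ρ ≤ (saydRel ρ).comap ((LinearMap.mulLeft k h).rTensor A) := by
  refine Submodule.span_le.mpr ?_
  rintro _ ⟨g, a, a', rfl⟩
  refine Submodule.subset_span ⟨h * g, a, a', ?_⟩
  rw [map_sub]
  congr 1
  generalize TensorProduct.comm k A H (ρ.coact a') = z
  rw [← LinearMap.comp_apply, LinearMap.rTensor_comp_map]
  congr 2
  ext x; simp

/-- The left action `h' [h ⊗ a] = [h' h ⊗ a]`. -/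
noncomputable def saydAct : H →ₗ[k] SAYDSpace ρ →ₗ[k] SAYDSpace ρ where
  toFun h := (saydRel ρ).mapQ (saydRel ρ) ((LinearMap.mulLeft k h).rTensor A)
    (saydRel_le_comap ρ h)
  map_add' g h := by
    refine Submodule.linearMap_qext _ (TensorProduct.ext' fun x a => ?_)
    change (saydRel ρ).mkQ (((g + h) * x) ⊗ₜ a) = (saydRel ρ).mkQ ((g * x) ⊗ₜ a) +
      (saydRel ρ).mkQ ((h * x) ⊗ₜ a)
    rw [add_mul, TensorProduct.add_tmul, map_add]
  map_smul' c h := by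
    refine Submodule.linearMap_qext _ (TensorProduct.ext' fun x a => ?_)
    change (saydRel ρ).mkQ (((c • h) * x) ⊗ₜ a) = c • (saydRel ρ).mkQ ((h * x) ⊗ₜ a)
    rw [smul_mul_assoc, ← TensorProduct.smul_tmul', map_smul]

/-- The class `[h ⊗ a]`. -/
noncomputable def saydMk : H ⊗[k] A →ₗ[k] SAYDSpace ρ := (saydRel ρ).mkQ

/-- The class `[1 ⊗ a]`. -/
noncomputable def saydOne : A →ₗ[k] SAYDSpace ρ := saydMk ρ ∘ₗ TensorProduct.mk k H A 1

theorem saydAct_mk (g h : H) (a : A) : saydAct ρ g (saydMk ρ (h ⊗ₜ a)) = saydMk ρ ((g * h) ⊗ₜ a) :=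
  rfl

theorem saydAct_one (h : H) (a : A) : saydAct ρ h (saydOne ρ a) = saydMk ρ (h ⊗ₜ a) :=
  (saydAct_mk ρ h 1 a).trans (by rw [mul_one])

theorem saydRel_eq (a a' : A) : TensorProduct.lift (saydAct ρ).flip
    ((saydOne ρ ∘ₗ LinearMap.mulLeft k a).rTensor H (ρ.coact a')) = saydOne ρ (a' * a) := by
  have h : saydMk ρ (TensorProduct.map (LinearMap.mulLeft k (1 : H)) (LinearMap.mulLeft k a)
      (TensorProduct.comm k A H (ρ.coact a')) - (1 : H) ⊗ₜ[k] (a' * a)) = 0 :=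
    (Submodule.Quotient.mk_eq_zero _).mpr (Submodule.subset_span ⟨1, a, a', rfl⟩)
  rw [map_sub, sub_eq_zero] at h
  refine Eq.trans ?_ h
  generalize ρ.coact a' = z
  refine LinearMap.congr_fun
    (f := TensorProduct.lift (saydAct ρ).flip ∘ₗ (saydOne ρ ∘ₗ LinearMap.mulLeft k a).rTensor H)
    (g := saydMk ρ ∘ₗ TensorProduct.map (LinearMap.mulLeft k (1 : H)) (LinearMap.mulLeft k a) ∘ₗ
      (TensorProduct.comm k A H).toLinearMap) (TensorProduct.ext' fun x g => ?_) z
  change saydAct ρ g (saydOne ρ (a * x)) = saydMk ρ ((1 * g) ⊗ₜ (a * x))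
  rw [saydAct_one, one_mul]

theorem saydAct_mul (g h : H) (m : SAYDSpace ρ) :
    saydAct ρ (g * h) m = saydAct ρ g (saydAct ρ h m) := by
  refine LinearMap.congr_fun (f := saydAct ρ (g * h)) (g := saydAct ρ g ∘ₗ saydAct ρ h)
    (Submodule.linearMap_qext _ (TensorProduct.ext' fun x a => ?_)) m
  exact congrArg (fun y => saydMk ρ (y ⊗ₜ a)) (mul_assoc g h x)

theorem saydAct_one_left (m : SAYDSpace ρ) : saydAct ρ 1 m = m := by
  refine LinearMap.congr_fun (f := saydAct ρ 1) (g := LinearMap.id)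
    (Submodule.linearMap_qext _ (TensorProduct.ext' fun x a => ?_)) m
  exact congrArg (fun y => saydMk ρ (y ⊗ₜ a)) (one_mul x)

/-- Maps out of `M` which agree on all `h [1 ⊗ a]` agree. -/
theorem sayd_ext {X : Type y} [AddCommGroup X] [Module k X] {F G : SAYDSpace ρ →ₗ[k] X}
    (h : ∀ g a, F (saydAct ρ g (saydOne ρ a)) = G (saydAct ρ g (saydOne ρ a))) : F = G := by
  refine Submodule.linearMap_qext _ (TensorProduct.ext' fun x a => ?_)
  have := h x a
  rw [saydAct_one] at this
  exact this

/-- `h ⊗ a ↦ [h₂ ⊗ a₀] ⊗ h₃ a₁ S(h₁)`. -/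
noncomputable def saydCoactPre : H ⊗[k] A →ₗ[k] SAYDSpace ρ ⊗[k] H :=
  TensorProduct.lift ((aydTwist (saydAct ρ)).compl₂
    ((saydOne ρ).rTensor H ∘ₗ ρ.coact.toLinearMap))

theorem saydCoactPre_tmul (h : H) (a : A) : saydCoactPre ρ (h ⊗ₜ a) =
    aydTwist (saydAct ρ) h ((saydOne ρ).rTensor H (ρ.coact a)) := rfl

/-- `((u ⊗ x) ⊗ y) ⊗ w ↦ aydTwist y ([1 ⊗ -] (w (u ⊗ x)))`. -/
noncomputable def saydTheta :
    (A ⊗[k] H) ⊗[k] H →ₗ[k] A ⊗[k] H →ₗ[k] SAYDSpace ρ ⊗[k] H :=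
  TensorProduct.lift ((LinearMap.llcomp k (A ⊗[k] H) (SAYDSpace ρ ⊗[k] H)
    (SAYDSpace ρ ⊗[k] H)).flip.compl₁₂
      (LinearMap.llcomp k (A ⊗[k] H) (A ⊗[k] H) (SAYDSpace ρ ⊗[k] H) ((saydOne ρ).rTensor H) ∘ₗ
        (LinearMap.mul k (A ⊗[k] H)).flip) (aydTwist (saydAct ρ)))

theorem saydTheta_tmul (v w : A ⊗[k] H) (y : H) : saydTheta ρ (v ⊗ₜ y) w =
    aydTwist (saydAct ρ) y ((saydOne ρ).rTensor H (w * v)) := rfl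

theorem coact_coassoc' (x : A) : ρ.coact.toLinearMap.rTensor H (ρ.coact x) =
    (TensorProduct.assoc k A H H).symm
      ((Coalgebra.comul (R := k) (A := H)).lTensor A (ρ.coact x)) := by
  rw [← ρ.coassoc, LinearEquiv.symm_apply_apply]

theorem saydTheta_coact (a' : A) (w : A ⊗[k] H) :
    saydTheta ρ (ρ.coact.toLinearMap.rTensor H (ρ.coact a')) w =
      (saydOne ρ).rTensor H (ρ.coact a' * w) := by
  induction w using TensorProduct.induction_on with
  | zero => simp
  | add p q hp hq => rw [map_add, hp, hq, mul_add, map_add]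
  | tmul b g =>
    -- `(u ⊗ x) ⊗ y ↦ x [1 ⊗ b u] ⊗ y g`
    let Ψ : (A ⊗[k] H) ⊗[k] H →ₗ[k] SAYDSpace ρ ⊗[k] H :=
      TensorProduct.map (TensorProduct.lift (saydAct ρ).flip ∘ₗ
        (saydOne ρ ∘ₗ LinearMap.mulLeft k b).rTensor H) (LinearMap.mulRight k g)
    have h1 : saydTheta ρ (ρ.coact.toLinearMap.rTensor H (ρ.coact a')) (b ⊗ₜ g) =
        Ψ (ρ.coact.toLinearMap.rTensor H (ρ.coact a')) := by
      rw [coact_coassoc']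
      generalize ρ.coact a' = z
      refine LinearMap.congr_fun
        (f := (saydTheta ρ).flip (b ⊗ₜ g) ∘ₗ (TensorProduct.assoc k A H H).symm.toLinearMap ∘ₗ
          (Coalgebra.comul (R := k) (A := H)).lTensor A)
        (g := Ψ ∘ₗ (TensorProduct.assoc k A H H).symm.toLinearMap ∘ₗ
          (Coalgebra.comul (R := k) (A := H)).lTensor A) (TensorProduct.ext' fun u h => ?_) z
      change saydTheta ρ ((TensorProduct.assoc k A H H).symm (u ⊗ₜ Coalgebra.comul h)) (b ⊗ₜ g) =
        Ψ ((TensorProduct.assoc k A H H).symm (u ⊗ₜ Coalgebra.comul h))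
      have h3 := aydTwist_right (saydAct ρ) (saydOne ρ (b * u)) g h
      refine Eq.trans ?_ (h3.trans ?_)
      · generalize Coalgebra.comul (R := k) h = t
        refine LinearMap.congr_fun
          (f := (saydTheta ρ).flip (b ⊗ₜ g) ∘ₗ (TensorProduct.assoc k A H H).symm.toLinearMap ∘ₗ
            TensorProduct.mk k A (H ⊗[k] H) u)
          (g := TensorProduct.lift ((aydTwist (saydAct ρ)).flip ∘ₗ
            TensorProduct.mk k (SAYDSpace ρ) H (saydOne ρ (b * u)) ∘ₗ LinearMap.mulLeft k g))
          (TensorProduct.ext' fun x y => ?_) t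
        change saydTheta ρ ((u ⊗ₜ x) ⊗ₜ y) (b ⊗ₜ g) =
          aydTwist (saydAct ρ) y (saydOne ρ (b * u) ⊗ₜ (g * x))
        rw [saydTheta_tmul, Algebra.TensorProduct.tmul_mul_tmul]; rfl
      · generalize Coalgebra.comul (R := k) h = t
        refine LinearMap.congr_fun
          (f := TensorProduct.map ((saydAct ρ).flip (saydOne ρ (b * u))) (LinearMap.mulRight k g))
          (g := Ψ ∘ₗ (TensorProduct.assoc k A H H).symm.toLinearMap ∘ₗ
            TensorProduct.mk k A (H ⊗[k] H) u)
          (TensorProduct.ext' fun x y => rfl) t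
    rw [h1]
    generalize ρ.coact a' = z
    refine LinearMap.congr_fun
      (f := Ψ ∘ₗ ρ.coact.toLinearMap.rTensor H)
      (g := (saydOne ρ).rTensor H ∘ₗ LinearMap.mulRight k (b ⊗ₜ[k] g))
      (TensorProduct.ext' fun u h => ?_) z
    change (TensorProduct.lift (saydAct ρ).flip
      ((saydOne ρ ∘ₗ LinearMap.mulLeft k b).rTensor H (ρ.coact u))) ⊗ₜ[k] (h * g) =
      (saydOne ρ).rTensor H ((u ⊗ₜ[k] h) * (b ⊗ₜ[k] g))
    rw [saydRel_eq, Algebra.TensorProduct.tmul_mul_tmul, LinearMap.rTensor_tmul]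

theorem saydRel_le_ker : saydRel ρ ≤ LinearMap.ker (saydCoactPre ρ) := by
  refine Submodule.span_le.mpr ?_
  rintro _ ⟨h, a, a', rfl⟩
  rw [SetLike.mem_coe, LinearMap.mem_ker, map_sub, sub_eq_zero, saydCoactPre_tmul, map_mul,
    ← saydTheta_coact]
  generalize ρ.coact a' = z
  refine LinearMap.congr_fun
    (f := saydCoactPre ρ ∘ₗ TensorProduct.map (LinearMap.mulLeft k h) (LinearMap.mulLeft k a) ∘ₗ
      (TensorProduct.comm k A H).toLinearMap)
    (g := aydTwist (saydAct ρ) h ∘ₗ (saydTheta ρ).flip (ρ.coact a) ∘ₗ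
      ρ.coact.toLinearMap.rTensor H) (TensorProduct.ext' fun u y => ?_) z
  change aydTwist (saydAct ρ) (h * y) ((saydOne ρ).rTensor H (ρ.coact (a * u))) =
    aydTwist (saydAct ρ) h (aydTwist (saydAct ρ) y
      ((saydOne ρ).rTensor H (ρ.coact a * ρ.coact u)))
  rw [aydTwist_mul _ (saydAct_mul ρ), map_mul]

/-- The coaction `[h ⊗ a] ↦ [h₂ ⊗ a₀] ⊗ h₃ a₁ S(h₁)`. -/
noncomputable def saydCoact : SAYDSpace ρ →ₗ[k] SAYDSpace ρ ⊗[k] H :=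
  (saydRel ρ).liftQ (saydCoactPre ρ) (saydRel_le_ker ρ)

theorem saydCoact_act_one (h : H) (a : A) : saydCoact ρ (saydAct ρ h (saydOne ρ a)) =
    aydTwist (saydAct ρ) h ((saydOne ρ).rTensor H (ρ.coact a)) := by
  rw [saydAct_one]; rfl

theorem saydCoact_one (a : A) : saydCoact ρ (saydOne ρ a) =
    (saydOne ρ).rTensor H (ρ.coact a) := by
  have := saydCoact_act_one ρ 1 a
  rwa [saydAct_one_left, aydTwist_one _ (saydAct_one_left ρ)] at this

theorem saydCoact_ayd (h : H) (m : SAYDSpace ρ) :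
    saydCoact ρ (saydAct ρ h m) = aydTwist (saydAct ρ) h (saydCoact ρ m) := by
  refine LinearMap.congr_fun (f := saydCoact ρ ∘ₗ saydAct ρ h)
    (g := aydTwist (saydAct ρ) h ∘ₗ saydCoact ρ) (sayd_ext ρ fun g a => ?_) m
  simp only [LinearMap.comp_apply]
  rw [← saydAct_mul, saydCoact_act_one, saydCoact_act_one, aydTwist_mul _ (saydAct_mul ρ)]

end CanonicalSAYD

section TwistLaws

variable {k : Type u} [Field k] {H : Type v} [Ring H] [HopfAlgebra k H]
variable {N : Type w} [AddCommGroup N] [Module k N]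

open HopfAlgebra

theorem counit_aydTwist (act : H →ₗ[k] N →ₗ[k] N) (h : H) (w : N ⊗[k] H) :
    TensorProduct.rid k N ((Coalgebra.counit (R := k) (A := H)).lTensor N (aydTwist act h w)) =
      act h (TensorProduct.rid k N ((Coalgebra.counit (R := k) (A := H)).lTensor N w)) := by
  induction w using TensorProduct.induction_on with
  | zero => simp
  | add p q hp hq => simp only [map_add, hp, hq]
  | tmul n g =>
    let L : H ⊗[k] (H ⊗[k] H) →ₗ[k] N :=
      (TensorProduct.lid k N).toLinearMap ∘ₗ TensorProduct.map Coalgebra.counit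
        ((TensorProduct.rid k N).toLinearMap ∘ₗ
          TensorProduct.map (act.flip n) (Coalgebra.counit (R := k) (A := H)))
    have e : TensorProduct.rid k N ((Coalgebra.counit (R := k) (A := H)).lTensor N
        (aydTwist act h (n ⊗ₜ g))) = Coalgebra.counit (R := k) g • L (comul3 k H h) := by
      rw [aydTwist_eq]
      refine LinearMap.congr_fun
        (f := (TensorProduct.rid k N).toLinearMap ∘ₗ
          (Coalgebra.counit (R := k) (A := H)).lTensor N ∘ₗ (aydPre act).flip (n ⊗ₜ g))
        (g := Coalgebra.counit (R := k) g • L) (hom_ext_three fun p q r => ?_) (comul3 k H h)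
      change Coalgebra.counit (R := k) (r * g * antipode k p) • act q n =
        Coalgebra.counit (R := k) g • (Coalgebra.counit (R := k) p •
          (Coalgebra.counit (R := k) r • act q n))
      rw [Bialgebra.counit_mul, Bialgebra.counit_mul, HopfAlgebra.counit_antipode, smul_smul,
        smul_smul]
      congr 1; ring
    have e2 : L (comul3 k H h) = act h n := by
      have h1 : L (comul3 k H h) = (TensorProduct.lid k N) (TensorProduct.map
          (Coalgebra.counit (R := k) (A := H)) (act.flip n) (Coalgebra.comul h)) := by
        refine LinearMap.congr_fun
          (f := L ∘ₗ (Coalgebra.comul (R := k) (A := H)).lTensor H)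
          (g := (TensorProduct.lid k N).toLinearMap ∘ₗ TensorProduct.map
            (Coalgebra.counit (R := k) (A := H)) (act.flip n))
          (TensorProduct.ext' fun p q => ?_) (Coalgebra.comul h)
        change Coalgebra.counit (R := k) p • (TensorProduct.rid k N) (TensorProduct.map (act.flip n)
          (Coalgebra.counit (R := k) (A := H)) (Coalgebra.comul q)) =
          Coalgebra.counit (R := k) p • act q n
        have := congrArg (fun t => TensorProduct.rid k N ((act.flip n).rTensor k t))
          (Coalgebra.lTensor_counit_comul (R := k) q)
        rw [← LinearMap.comp_apply, LinearMap.rTensor_comp_lTensor] at this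
        rw [this]; simp
      rw [h1]
      have := congrArg (fun t => TensorProduct.lid k N ((act.flip n).lTensor k t))
          (Coalgebra.rTensor_counit_comul (R := k) h)
      rw [← LinearMap.comp_apply, LinearMap.lTensor_comp_rTensor] at this
      rw [this]; simp
    rw [e, e2]; simp

theorem stable_aydTwist (act : H →ₗ[k] N →ₗ[k] N)
    (hact : ∀ g h n, act (g * h) n = act g (act h n)) (h : H) (w : N ⊗[k] H) :
    TensorProduct.lift act.flip (aydTwist act h w) = act h (TensorProduct.lift act.flip w) := by
  induction w using TensorProduct.induction_on with
  | zero => simp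
  | add p q hp hq => simp only [map_add, hp, hq]
  | tmul n g =>
    -- `u ⊗ (v ⊗ r) ↦ ε(v) (r g u) n`
    let L : H ⊗[k] (H ⊗[k] H) →ₗ[k] N :=
      TensorProduct.lift ((act.flip n ∘ₗ LinearMap.id : H →ₗ[k] N) |> fun f =>
        ((LinearMap.mul k H).flip.compr₂ f).compl₂ (LinearMap.mulRight k g ∘ₗ
          (TensorProduct.lid k H).toLinearMap ∘ₗ (Coalgebra.counit (R := k) (A := H)).rTensor H))
    have hL : ∀ u v r, L (u ⊗ₜ (v ⊗ₜ r)) =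
        act (((Coalgebra.counit (R := k) v • r) * g) * u) n := fun u v r => rfl
    have key := comul3_antipode_left (TensorProduct.lift act.flip ∘ₗ (aydPre act).flip (n ⊗ₜ g)) L
      (fun p q r => ?_) h
    · rw [aydTwist_eq]
      refine key.trans ?_
      have : ∀ t : H ⊗[k] H, L (j23 k H t) = act ((TensorProduct.lid k H)
          ((Coalgebra.counit (R := k) (A := H)).rTensor H t) * g) n := by
        intro t
        refine LinearMap.congr_fun (f := L ∘ₗ (j23 k H).toLinearMap)
          (g := act.flip n ∘ₗ LinearMap.mulRight k g ∘ₗ (TensorProduct.lid k H).toLinearMap ∘ₗ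
            (Coalgebra.counit (R := k) (A := H)).rTensor H) (TensorProduct.ext' fun x y => ?_) t
        change L (1 ⊗ₜ (x ⊗ₜ y)) = _
        rw [hL, mul_one]; rfl
      rw [this, Coalgebra.rTensor_counit_comul]
      simp [hact]
    · change act (r * g * antipode k p) (act q n) = _
      have : ∀ t : H ⊗[k] H, L (j1 k H (antipode k p) * TensorProduct.assoc k H H H (t ⊗ₜ r)) =
          act (r * g * (antipode k p * TensorProduct.rid k H
            ((Coalgebra.counit (R := k) (A := H)).lTensor H t))) n := by
        intro t
        refine LinearMap.congr_fun
          (f := L ∘ₗ LinearMap.mulLeft k (j1 k H (antipode k p)) ∘ₗ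
            (TensorProduct.assoc k H H H).toLinearMap ∘ₗ (TensorProduct.mk k (H ⊗[k] H) H).flip r)
          (g := act.flip n ∘ₗ LinearMap.mulLeft k (r * g) ∘ₗ LinearMap.mulLeft k (antipode k p) ∘ₗ
            (TensorProduct.rid k H).toLinearMap ∘ₗ
              (Coalgebra.counit (R := k) (A := H)).lTensor H) (TensorProduct.ext' fun x y => ?_) t
        change L ((antipode k p ⊗ₜ 1) * (x ⊗ₜ (y ⊗ₜ r))) =
          act (r * g * (antipode k p * (Coalgebra.counit (R := k) y • x))) n
        rw [Algebra.TensorProduct.tmul_mul_tmul, one_mul, hL]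
        simp only [smul_mul_assoc, mul_smul_comm, mul_assoc]
      rw [this, Coalgebra.lTensor_counit_comul, ← hact]
      simp [mul_assoc]

/-- `p ⊗ (q ⊗ r)` acts on `N ⊗ (H ⊗ H)` by `n ⊗ t ↦ q n ⊗ Δ(r) t Δ(S p)`. -/
noncomputable def aydPre2 (act : H →ₗ[k] N →ₗ[k] N) :
    H ⊗[k] (H ⊗[k] H) →ₗ[k] (N ⊗[k] (H ⊗[k] H) →ₗ[k] N ⊗[k] (H ⊗[k] H)) :=
  TensorProduct.lift ((LinearMap.llcomp k (N ⊗[k] (H ⊗[k] H)) (N ⊗[k] (H ⊗[k] H))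
    (N ⊗[k] (H ⊗[k] H))).compl₁₂
      (LinearMap.lTensorHom N ∘ₗ (LinearMap.mul k (H ⊗[k] H)).flip ∘ₗ Coalgebra.comul ∘ₗ antipode k)
      (TensorProduct.map₂ act (LinearMap.mul k (H ⊗[k] H) ∘ₗ Coalgebra.comul)))

theorem aydPre2_tmul (act : H →ₗ[k] N →ₗ[k] N) (p q r : H) (n : N) (t : H ⊗[k] H) :
    aydPre2 act (p ⊗ₜ (q ⊗ₜ r)) (n ⊗ₜ t) =
      act q n ⊗ₜ (Coalgebra.comul r * t * Coalgebra.comul (antipode k p)) := rfl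

theorem comul_aydTwist (act : H →ₗ[k] N →ₗ[k] N) (h : H) (w : N ⊗[k] H) :
    (Coalgebra.comul (R := k) (A := H)).lTensor N (aydTwist act h w) =
      aydPre2 act (comul3 k H h) ((Coalgebra.comul (R := k) (A := H)).lTensor N w) := by
  rw [aydTwist_eq]
  generalize comul3 k H h = z
  induction w using TensorProduct.induction_on with
  | zero => simp
  | add p q hp hq => simp only [map_add, hp, hq]
  | tmul n g =>
    refine LinearMap.congr_fun
      (f := (Coalgebra.comul (R := k) (A := H)).lTensor N ∘ₗ (aydPre act).flip (n ⊗ₜ g))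
      (g := (aydPre2 act).flip (n ⊗ₜ Coalgebra.comul g)) (hom_ext_three fun p q r => ?_) z
    simp only [LinearMap.comp_apply, LinearMap.flip_apply, aydPre_tmul, aydPre2_tmul,
      LinearMap.lTensor_tmul, Bialgebra.comul_mul]

/-- The algebra `(H ⊗ H) ⊗ (H ⊗ (H ⊗ H))`. -/
def W (k : Type u) [Field k] (H : Type v) [Ring H] [HopfAlgebra k H] : Type v :=
  (H ⊗[k] H) ⊗[k] (H ⊗[k] (H ⊗[k] H))

noncomputable instance (k : Type u) [Field k] (H : Type v) [Ring H] [HopfAlgebra k H] :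
    Ring (W k H) := inferInstanceAs (Ring ((H ⊗[k] H) ⊗[k] (H ⊗[k] (H ⊗[k] H))))

noncomputable instance (k : Type u) [Field k] (H : Type v) [Ring H] [HopfAlgebra k H] :
    Algebra k (W k H) := inferInstanceAs (Algebra k ((H ⊗[k] H) ⊗[k] (H ⊗[k] (H ⊗[k] H))))

/-- The inclusion of the first tensor factor `H ⊗ H`. -/
noncomputable def w1 (k : Type u) [Field k] (H : Type v) [Ring H] [HopfAlgebra k H] :
    H ⊗[k] H →ₐ[k] W k H :=
  (Algebra.TensorProduct.includeLeft : H ⊗[k] H →ₐ[k] (H ⊗[k] H) ⊗[k] (H ⊗[k] (H ⊗[k] H)))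
/-- The inclusion of the middle tensor factor `H`. -/
noncomputable def w2 (k : Type u) [Field k] (H : Type v) [Ring H] [HopfAlgebra k H] :
    H →ₐ[k] W k H :=
  ((Algebra.TensorProduct.includeRight :
    H ⊗[k] (H ⊗[k] H) →ₐ[k] (H ⊗[k] H) ⊗[k] (H ⊗[k] (H ⊗[k] H))).comp
      Algebra.TensorProduct.includeLeft :)
/-- The inclusion of the last tensor factor `H ⊗ H`. -/
noncomputable def w3 (k : Type u) [Field k] (H : Type v) [Ring H] [HopfAlgebra k H] :
    H ⊗[k] H →ₐ[k] W k H :=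
  ((Algebra.TensorProduct.includeRight :
    H ⊗[k] (H ⊗[k] H) →ₐ[k] (H ⊗[k] H) ⊗[k] (H ⊗[k] (H ⊗[k] H))).comp
      Algebra.TensorProduct.includeRight :)

/-- `w1 (1 ⊗ h)`. -/
noncomputable def w1R (k : Type u) [Field k] (H : Type v) [Ring H] [HopfAlgebra k H] :
    H →ₐ[k] W k H :=
  (w1 k H).comp Algebra.TensorProduct.includeRight
/-- `w1 (h ⊗ 1)`. -/
noncomputable def w1L (k : Type u) [Field k] (H : Type v) [Ring H] [HopfAlgebra k H] :
    H →ₐ[k] W k H :=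
  (w1 k H).comp Algebra.TensorProduct.includeLeft
/-- `w1 (Δ h)`. -/
noncomputable def w1D (k : Type u) [Field k] (H : Type v) [Ring H] [HopfAlgebra k H] :
    H →ₐ[k] W k H :=
  (w1 k H).comp (Bialgebra.comulAlgHom k H)
/-- `w3 (1 ⊗ h)`. -/
noncomputable def w3R (k : Type u) [Field k] (H : Type v) [Ring H] [HopfAlgebra k H] :
    H →ₐ[k] W k H :=
  (w3 k H).comp Algebra.TensorProduct.includeRight
/-- `w3 (h ⊗ 1)`. -/
noncomputable def w3L (k : Type u) [Field k] (H : Type v) [Ring H] [HopfAlgebra k H] :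
    H →ₐ[k] W k H :=
  (w3 k H).comp Algebra.TensorProduct.includeLeft
/-- `w3 (Δ h)`. -/
noncomputable def w3D (k : Type u) [Field k] (H : Type v) [Ring H] [HopfAlgebra k H] :
    H →ₐ[k] W k H :=
  (w3 k H).comp (Bialgebra.comulAlgHom k H)

theorem word_coassoc :
    cv (E := W k H) ((w1R k H).toLinearMap ∘ₗ antipode k) (cv (cv ((w1L k H).toLinearMap ∘ₗ antipode k)
      (cv (w2 k H).toLinearMap (w3L k H).toLinearMap)) (w3R k H).toLinearMap) =
    cv (E := W k H) ((w1D k H).toLinearMap ∘ₗ antipode k)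
      (cv (w2 k H).toLinearMap (w3D k H).toLinearMap) := by
  have h1 : (w1D k H).toLinearMap ∘ₗ antipode k =
      cv ((w1R k H).toLinearMap ∘ₗ antipode k) ((w1L k H).toLinearMap ∘ₗ antipode k) :=
    (congrArg (fun f => (w1 k H).toLinearMap ∘ₗ f) (comul_antipode (k := k) (H := H))).trans
      (cv_comp (E := H ⊗[k] H) (F := W k H) (w1 k H) _ _).symm
  have h3 : (w3D k H).toLinearMap = cv (w3L k H).toLinearMap (w3R k H).toLinearMap :=
    (congrArg (fun f => (w3 k H).toLinearMap ∘ₗ f) (cv_inL_inR (k := k) (H := H)).symm).trans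
      (cv_comp (E := H ⊗[k] H) (F := W k H) (w3 k H) _ _).symm
  rw [h1, h3]
  simp only [cv_assoc]

/-- A convolution of three maps as a linear function of `h₁ ⊗ h₂ ⊗ h₃`. -/
theorem cv_three {E : Type x} [Ring E] [Algebra k E] (f g l : H →ₗ[k] E) (h : H) :
    cv f (cv g l) h = LinearMap.mul' k E (TensorProduct.map f
      (LinearMap.mul' k E ∘ₗ TensorProduct.map g l) (comul3 k H h)) := by
  rw [← LinearMap.comp_apply (f := TensorProduct.map f _), ← map_comul_left]
  rfl

theorem coact_aydTwist (act : H →ₗ[k] N →ₗ[k] N) (h : H) (w : (N ⊗[k] H) ⊗[k] H) :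
    TensorProduct.assoc k N H H (aydTwist (aydTwist act) h w) =
      aydPre2 act (comul3 k H h) (TensorProduct.assoc k N H H w) := by
  suffices H1 : ∀ (n : N) (x y : H), TensorProduct.assoc k N H H
      (aydTwist (aydTwist act) h ((n ⊗ₜ x) ⊗ₜ y)) =
      aydPre2 act (comul3 k H h) (n ⊗ₜ (x ⊗ₜ y)) by
    refine LinearMap.congr_fun
      (f := (TensorProduct.assoc k N H H).toLinearMap ∘ₗ aydTwist (aydTwist act) h)
      (g := aydPre2 act (comul3 k H h) ∘ₗ (TensorProduct.assoc k N H H).toLinearMap)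
      (TensorProduct.ext_threefold fun n x y => H1 n x y) w
  intro n x y
  -- `u ⊗ (q ⊗ v) ↦ q n ⊗ v (x ⊗ y) u`
  let L0 : (H ⊗[k] H) ⊗[k] (H ⊗[k] (H ⊗[k] H)) →ₗ[k]
      N ⊗[k] (H ⊗[k] H) := TensorProduct.lift ((LinearMap.llcomp k (H ⊗[k] (H ⊗[k] H)) (N ⊗[k] (H ⊗[k] H)) (N ⊗[k] (H ⊗[k] H))).flip
        (TensorProduct.map (act.flip n) (LinearMap.mulRight k (x ⊗ₜ[k] y))) ∘ₗ
      LinearMap.lTensorHom N ∘ₗ (LinearMap.mul k (H ⊗[k] H)).flip)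
  let L : W k H →ₗ[k] N ⊗[k] (H ⊗[k] H) := L0
  have hL : ∀ u q v, L0 (u ⊗ₜ (q ⊗ₜ v)) = act q n ⊗ₜ (v * (x ⊗ₜ y) * u) := fun u q v => rfl
  have key := congrArg L (LinearMap.congr_fun (word_coassoc (k := k) (H := H)) h)
  have hr : L (cv ((w1D k H).toLinearMap ∘ₗ antipode k)
      (cv (w2 k H).toLinearMap ((w3D k H).toLinearMap)) h) =
      aydPre2 act (comul3 k H h) (n ⊗ₜ (x ⊗ₜ y)) := by
    rw [cv_three]
    refine LinearMap.congr_fun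
      (f := L ∘ₗ LinearMap.mul' k (W k H) ∘ₗ TensorProduct.map ((w1D k H).toLinearMap ∘ₗ antipode k)
        (LinearMap.mul' k (W k H) ∘ₗ TensorProduct.map (w2 k H).toLinearMap
          ((w3D k H).toLinearMap)))
      (g := (aydPre2 act).flip (n ⊗ₜ (x ⊗ₜ y))) (hom_ext_three fun p q r => ?_) (comul3 k H h)
    change L0 ((Coalgebra.comul (antipode k p) ⊗ₜ 1) * ((1 ⊗ₜ (q ⊗ₜ 1)) * (1 ⊗ₜ (1 ⊗ₜ Coalgebra.comul r)))) =
      aydPre2 act (p ⊗ₜ (q ⊗ₜ r)) (n ⊗ₜ (x ⊗ₜ y))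
    simp only [Algebra.TensorProduct.tmul_mul_tmul, one_mul, mul_one]
    rw [hL, aydPre2_tmul]
  refine Eq.trans ?_ (key.trans hr)
  rw [cv_three]
  refine LinearMap.congr_fun
    (f := (TensorProduct.assoc k N H H).toLinearMap ∘ₗ
      (aydPre (aydTwist act)).flip ((n ⊗ₜ x) ⊗ₜ y))
    (g := L ∘ₗ LinearMap.mul' k (W k H) ∘ₗ TensorProduct.map ((w1R k H).toLinearMap ∘ₗ antipode k)
        (LinearMap.mul' k (W k H) ∘ₗ TensorProduct.map (cv ((w1L k H).toLinearMap ∘ₗ antipode k)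
          (cv (w2 k H).toLinearMap ((w3L k H).toLinearMap))) ((w3R k H).toLinearMap)))
    (hom_ext_three fun p q r => ?_) (comul3 k H h)
  change TensorProduct.assoc k N H H
      ((aydTwist act q (n ⊗ₜ x)) ⊗ₜ (r * y * antipode k p)) =
    L (w1R k H (antipode k p) * (cv ((w1L k H).toLinearMap ∘ₗ antipode k)
          (cv (w2 k H).toLinearMap ((w3L k H).toLinearMap)) q * w3R k H r))
  rw [cv_three, aydTwist_eq]
  refine LinearMap.congr_fun
    (f := (TensorProduct.assoc k N H H).toLinearMap ∘ₗ
      (TensorProduct.mk k (N ⊗[k] H) H).flip (r * y * antipode k p) ∘ₗ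
      (aydPre act).flip (n ⊗ₜ x))
    (g := L ∘ₗ LinearMap.mulLeft k (w1R k H (antipode k p)) ∘ₗ LinearMap.mulRight k (w3R k H r) ∘ₗ
      LinearMap.mul' k (W k H) ∘ₗ TensorProduct.map ((w1L k H).toLinearMap ∘ₗ antipode k)
        (LinearMap.mul' k (W k H) ∘ₗ TensorProduct.map (w2 k H).toLinearMap ((w3L k H).toLinearMap)))
    (hom_ext_three fun p' q' r' => ?_) (comul3 k H q)
  change act q' n ⊗ₜ[k] ((r' * x * antipode k p') ⊗ₜ[k] (r * y * antipode k p)) =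
    L0 (((1 ⊗ₜ antipode k p) ⊗ₜ 1) * ((((antipode k p' ⊗ₜ 1) ⊗ₜ 1) * ((1 ⊗ₜ (q' ⊗ₜ 1)) * (1 ⊗ₜ (1 ⊗ₜ (r' ⊗ₜ 1))))) *
      (1 ⊗ₜ (1 ⊗ₜ (1 ⊗ₜ r)))))
  simp only [Algebra.TensorProduct.tmul_mul_tmul, one_mul, mul_one]
  rw [hL]
  simp only [Algebra.TensorProduct.tmul_mul_tmul, mul_assoc]

end TwistLaws

section CanonicalSAYDModule

variable {k : Type u} [Field k] {H : Type v} [Ring H] [HopfAlgebra k H]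
variable {A : Type w} [Ring A] [Algebra k A] (ρ : ComoduleAlgebra k H A)

theorem saydCoact_coassoc (m : SAYDSpace ρ) :
    TensorProduct.assoc k _ H H ((saydCoact ρ).rTensor H (saydCoact ρ m)) =
    (Coalgebra.comul (R := k) (A := H)).lTensor _ (saydCoact ρ m) := by
  refine LinearMap.congr_fun
    (f := (TensorProduct.assoc k _ H H).toLinearMap ∘ₗ (saydCoact ρ).rTensor H ∘ₗ saydCoact ρ)
    (g := (Coalgebra.comul (R := k) (A := H)).lTensor _ ∘ₗ saydCoact ρ)
    (sayd_ext ρ fun g a => ?_) m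
  simp only [LinearMap.comp_apply, LinearEquiv.coe_coe]
  rw [saydCoact_act_one, comul_aydTwist,
    aydTwist_natural _ (aydTwist (saydAct ρ)) (saydCoact ρ) (saydCoact_ayd ρ), coact_aydTwist]
  congr 1
  have h1 : (saydCoact ρ).rTensor H ((saydOne ρ).rTensor H (ρ.coact a)) =
      ((saydOne ρ).rTensor H).rTensor H (ρ.coact.toLinearMap.rTensor H (ρ.coact a)) := by
    rw [← LinearMap.rTensor_comp_apply, ← LinearMap.rTensor_comp_apply]
    congr 2
    exact LinearMap.ext fun a => saydCoact_one ρ a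
  rw [h1, coact_coassoc']
  generalize ρ.coact a = z
  refine LinearMap.congr_fun
    (f := (TensorProduct.assoc k _ H H).toLinearMap ∘ₗ ((saydOne ρ).rTensor H).rTensor H ∘ₗ
      (TensorProduct.assoc k A H H).symm.toLinearMap ∘ₗ
        (Coalgebra.comul (R := k) (A := H)).lTensor A)
    (g := (Coalgebra.comul (R := k) (A := H)).lTensor _ ∘ₗ (saydOne ρ).rTensor H)
    (TensorProduct.ext' fun u h => ?_) z
  change TensorProduct.assoc k _ H H (((saydOne ρ).rTensor H).rTensor H
    ((TensorProduct.assoc k A H H).symm (u ⊗ₜ Coalgebra.comul h))) =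
    saydOne ρ u ⊗ₜ Coalgebra.comul h
  generalize Coalgebra.comul (R := k) h = t
  refine LinearMap.congr_fun
    (f := (TensorProduct.assoc k _ H H).toLinearMap ∘ₗ ((saydOne ρ).rTensor H).rTensor H ∘ₗ
      (TensorProduct.assoc k A H H).symm.toLinearMap ∘ₗ TensorProduct.mk k A (H ⊗[k] H) u)
    (g := TensorProduct.mk k (SAYDSpace ρ) (H ⊗[k] H) (saydOne ρ u))
    (TensorProduct.ext' fun x y => rfl) t

/-- The stable anti-Yetter-Drinfeld module `M = (H ⊗ A) / ⟨h a'₁ ⊗ a a'₀ - h ⊗ a' a⟩` of the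
comodule algebra `A`, with the action `h' [h ⊗ a] = [h' h ⊗ a]` and the coaction
`[h ⊗ a] ↦ [h₂ ⊗ a₀] ⊗ h₃ a₁ S(h₁)`. -/
noncomputable def canonicalSAYD : SAYDModule k H (SAYDSpace ρ) where
  act := saydAct ρ
  one_act := saydAct_one_left ρ
  mul_act := saydAct_mul ρ
  coact := saydCoact ρ
  coassoc := saydCoact_coassoc ρ
  counit m := by
    refine LinearMap.congr_fun
      (f := (TensorProduct.rid k _).toLinearMap ∘ₗ
        (Coalgebra.counit (R := k) (A := H)).lTensor _ ∘ₗ saydCoact ρ)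
      (g := LinearMap.id) (sayd_ext ρ fun g a => ?_) m
    simp only [LinearMap.comp_apply, LinearEquiv.coe_coe, LinearMap.id_apply]
    rw [saydCoact_act_one, counit_aydTwist]
    congr 1
    have := congrArg (saydOne ρ) (ρ.counit a)
    refine Eq.trans ?_ this
    generalize ρ.coact a = z
    refine LinearMap.congr_fun
      (f := (TensorProduct.rid k _).toLinearMap ∘ₗ
        (Coalgebra.counit (R := k) (A := H)).lTensor _ ∘ₗ (saydOne ρ).rTensor H)
      (g := saydOne ρ ∘ₗ (TensorProduct.rid k A).toLinearMap ∘ₗ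
        (Coalgebra.counit (R := k) (A := H)).lTensor A) (TensorProduct.ext' fun u h => ?_) z
    change Coalgebra.counit (R := k) h • saydOne ρ u = saydOne ρ (Coalgebra.counit (R := k) h • u)
    rw [map_smul]
  ayd := saydCoact_ayd ρ
  stable m := by
    refine LinearMap.congr_fun
      (f := TensorProduct.lift (saydAct ρ).flip ∘ₗ saydCoact ρ)
      (g := LinearMap.id) (sayd_ext ρ fun g a => ?_) m
    simp only [LinearMap.comp_apply, LinearMap.id_apply]
    rw [saydCoact_act_one, stable_aydTwist _ (saydAct_mul ρ)]
    congr 1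
    have := saydRel_eq ρ 1 a
    rw [mul_one, LinearMap.mulLeft_one, LinearMap.comp_id] at this
    exact this

end CanonicalSAYDModule

section TensorActions

variable {k : Type u} [Field k] {H : Type v} [Ring H] [HopfAlgebra k H]
variable {X : Type w} [AddCommGroup X] [Module k X] {Y : Type x} [AddCommGroup Y] [Module k Y]
variable {Z : Type y} [AddCommGroup Z] [Module k Z]

/-- The action `(x ⊗ y) h = x h₁ ⊗ y h₂` of `H` on a tensor product. -/
noncomputable def actT (α : X →ₗ[k] H →ₗ[k] X) (β : Y →ₗ[k] H →ₗ[k] Y) :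
    X ⊗[k] Y →ₗ[k] H →ₗ[k] X ⊗[k] Y := (TensorProduct.map₂ α β).compl₂ Coalgebra.comul

theorem actT_tmul (α : X →ₗ[k] H →ₗ[k] X) (β : Y →ₗ[k] H →ₗ[k] Y) (a : X) (b : Y) (h : H) :
    actT α β (a ⊗ₜ b) h = TensorProduct.map (α a) (β b) (Coalgebra.comul h) := rfl

/-- `f` commutes with the actions `α` and `β`. -/
def Equivariant (α : X →ₗ[k] H →ₗ[k] X) (β : Y →ₗ[k] H →ₗ[k] Y) (f : X →ₗ[k] Y) : Prop :=
  ∀ a, f ∘ₗ α a = β (f a)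

theorem Equivariant.comp {α : X →ₗ[k] H →ₗ[k] X} {β : Y →ₗ[k] H →ₗ[k] Y} {γ : Z →ₗ[k] H →ₗ[k] Z}
    {f : X →ₗ[k] Y} {g : Y →ₗ[k] Z} (hg : Equivariant β γ g) (hf : Equivariant α β f) :
    Equivariant α γ (g ∘ₗ f) := fun a => by
  rw [LinearMap.comp_assoc, hf a, hg]; rfl

theorem equivariant_tensor {α : X →ₗ[k] H →ₗ[k] X} {β : Y →ₗ[k] H →ₗ[k] Y}
    {γ : Z →ₗ[k] H →ₗ[k] Z} {f : X ⊗[k] Y →ₗ[k] Z}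
    (hf : ∀ a b, f ∘ₗ actT α β (a ⊗ₜ b) = γ (f (a ⊗ₜ b))) : Equivariant (actT α β) γ f := by
  intro z
  induction z using TensorProduct.induction_on with
  | zero => simp
  | tmul a b => exact hf a b
  | add p q hp hq => rw [map_add, map_add, map_add, LinearMap.comp_add, hp, hq]

theorem Equivariant.lTensor {α : X →ₗ[k] H →ₗ[k] X} {β : Y →ₗ[k] H →ₗ[k] Y}
    {γ : Z →ₗ[k] H →ₗ[k] Z} {f : Y →ₗ[k] Z} (hf : Equivariant β γ f) :
    Equivariant (actT α β) (actT α γ) (f.lTensor X) := by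
  refine equivariant_tensor fun a b => LinearMap.ext fun h => ?_
  rw [LinearMap.comp_apply, actT_tmul, LinearMap.lTensor_tmul, actT_tmul, ← hf b,
    ← LinearMap.comp_apply, LinearMap.lTensor_comp_map]

theorem Equivariant.rTensor {α : X →ₗ[k] H →ₗ[k] X} {β : Y →ₗ[k] H →ₗ[k] Y}
    {γ : Z →ₗ[k] H →ₗ[k] Z} {f : X →ₗ[k] Z} (hf : Equivariant α γ f) :
    Equivariant (actT α β) (actT γ β) (f.rTensor Y) := by
  refine equivariant_tensor fun a b => LinearMap.ext fun h => ?_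
  rw [LinearMap.comp_apply, actT_tmul, LinearMap.rTensor_tmul, actT_tmul, ← hf a,
    ← LinearMap.comp_apply, LinearMap.rTensor_comp_map]

theorem equivariant_assoc (α : X →ₗ[k] H →ₗ[k] X) (β : Y →ₗ[k] H →ₗ[k] Y)
    (γ : Z →ₗ[k] H →ₗ[k] Z) : Equivariant (actT (actT α β) γ) (actT α (actT β γ))
      (TensorProduct.assoc k X Y Z).toLinearMap := by
  refine equivariant_tensor fun w c => ?_
  induction w using TensorProduct.induction_on with
  | zero => simp
  | add p q hp hq => rw [TensorProduct.add_tmul, map_add, map_add, map_add, LinearMap.comp_add, hp, hq]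
  | tmul a b =>
    ext h
    change TensorProduct.assoc k X Y Z (TensorProduct.map (actT α β (a ⊗ₜ b)) (γ c)
      (Coalgebra.comul h)) = TensorProduct.map (α a) (actT β γ (b ⊗ₜ c)) (Coalgebra.comul h)
    have h1 : ∀ t : H ⊗[k] H, TensorProduct.map (actT α β (a ⊗ₜ b)) (γ c) t =
        TensorProduct.map (TensorProduct.map (α a) (β b)) (γ c)
          ((Coalgebra.comul (R := k) (A := H)).rTensor H t) := fun t => by
      rw [← LinearMap.comp_apply, LinearMap.map_comp_rTensor]; rfl
    have h2 : ∀ t : H ⊗[k] H, TensorProduct.map (α a) (actT β γ (b ⊗ₜ c)) t =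
        TensorProduct.map (α a) (TensorProduct.map (β b) (γ c))
          ((Coalgebra.comul (R := k) (A := H)).lTensor H t) := fun t => by
      rw [← LinearMap.comp_apply, LinearMap.map_comp_lTensor]; rfl
    rw [h1, h2, ← Coalgebra.coassoc_apply]
    generalize (Coalgebra.comul (R := k) (A := H)).rTensor H (Coalgebra.comul h) = t
    exact LinearMap.congr_fun
      (f := (TensorProduct.assoc k X Y Z).toLinearMap ∘ₗ
        TensorProduct.map (TensorProduct.map (α a) (β b)) (γ c))
      (g := TensorProduct.map (α a) (TensorProduct.map (β b) (γ c)) ∘ₗ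
        (TensorProduct.assoc k H H H).toLinearMap)
      (TensorProduct.ext_threefold fun _ _ _ => rfl) t

/-- The trivial action `c h = ε(h) c` on a space. -/
noncomputable def trivialAct : X →ₗ[k] H →ₗ[k] X :=
  (LinearMap.lsmul k X ∘ₗ Coalgebra.counit (R := k) (A := H)).flip

theorem equivariant_lid (β : Y →ₗ[k] H →ₗ[k] Y) :
    Equivariant (actT trivialAct β) β (TensorProduct.lid k Y).toLinearMap := by
  refine equivariant_tensor fun c b => LinearMap.ext fun h => ?_
  have h0 : (TensorProduct.lid k Y) ((β b).lTensor k
      ((Coalgebra.counit (R := k) (A := H)).rTensor H (Coalgebra.comul h))) = β b h := by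
    rw [Coalgebra.rTensor_counit_comul]; simp
  change TensorProduct.lid k Y (TensorProduct.map (trivialAct c) (β b) (Coalgebra.comul h)) =
    β (c • b) h
  rw [map_smul, LinearMap.smul_apply, ← h0]
  generalize Coalgebra.comul (R := k) h = t
  refine LinearMap.congr_fun
    (f := (TensorProduct.lid k Y).toLinearMap ∘ₗ TensorProduct.map (trivialAct c) (β b))
    (g := c • ((TensorProduct.lid k Y).toLinearMap ∘ₗ (β b).lTensor k ∘ₗ
      (Coalgebra.counit (R := k) (A := H)).rTensor H)) (TensorProduct.ext' fun p q => ?_) t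
  change (Coalgebra.counit (R := k) p * c) • β b q = c • Coalgebra.counit (R := k) p • β b q
  rw [smul_smul, mul_comm]

theorem equivariant_rid (β : Y →ₗ[k] H →ₗ[k] Y) :
    Equivariant (actT β trivialAct) β (TensorProduct.rid k Y).toLinearMap := by
  refine equivariant_tensor fun b c => LinearMap.ext fun h => ?_
  have h0 : (TensorProduct.rid k Y) ((β b).rTensor k
      ((Coalgebra.counit (R := k) (A := H)).lTensor H (Coalgebra.comul h))) = β b h := by
    rw [Coalgebra.lTensor_counit_comul]; simp
  change TensorProduct.rid k Y (TensorProduct.map (β b) (trivialAct c) (Coalgebra.comul h)) =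
    β (c • b) h
  rw [map_smul, LinearMap.smul_apply, ← h0]
  generalize Coalgebra.comul (R := k) h = t
  refine LinearMap.congr_fun
    (f := (TensorProduct.rid k Y).toLinearMap ∘ₗ TensorProduct.map (β b) (trivialAct c))
    (g := c • ((TensorProduct.rid k Y).toLinearMap ∘ₗ (β b).rTensor k ∘ₗ
      (Coalgebra.counit (R := k) (A := H)).lTensor H)) (TensorProduct.ext' fun p q => ?_) t
  change (Coalgebra.counit (R := k) q * c) • β b p = c • Coalgebra.counit (R := k) q • β b p
  rw [smul_smul, mul_comm]

end TensorActions

section DiagonalAction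

variable {k : Type u} [Field k] {H : Type v} [Ring H] [HopfAlgebra k H]
variable {C : Type x} [AddCommGroup C] [Module k C] [Coalgebra k C] (μ : ModuleCoalgebra k H C)

/-- The diagonal action `(c⁰ ⊗ ⋯ ⊗ cⁿ) h = c⁰ h₁ ⊗ ⋯ ⊗ cⁿ hₙ₊₁`. -/
noncomputable def diag : ∀ n : ℕ, TPow k C n →ₗ[k] H →ₗ[k] TPow k C n
  | 0 => μ.act
  | n + 1 => actT μ.act (diag n)

theorem diag_succ (n : ℕ) : diag μ (n + 1) = actT μ.act (diag μ n) := rfl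

theorem diag_cons (n : ℕ) (a : C) (y : TPow k C n) (h : H) :
    diag μ (n + 1) (cons n a y) h = TensorProduct.map (μ.act a) (diag μ n y) (Coalgebra.comul h) :=
  rfl

theorem equivariant_comul : Equivariant μ.act (actT μ.act μ.act)
    (Coalgebra.comul (R := k) (A := C)) := fun a => LinearMap.ext fun h => μ.comul_act a h

theorem equivariant_counit : Equivariant μ.act trivialAct (Coalgebra.counit (R := k) (A := C)) :=
  fun a => LinearMap.ext fun h => (μ.counit_act a h).trans (mul_comm _ _)

theorem equivariant_splitAt (n : ℕ) (j : Fin (n + 1)) :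
    Equivariant (diag μ n) (diag μ (n + 1)) (splitAt Coalgebra.comul n j) := by
  induction n with
  | zero => rw [Subsingleton.elim (α := Fin 1) j 0]; exact equivariant_comul μ
  | succ n ih =>
    cases j using Fin.cases with
    | zero =>
      exact (equivariant_assoc μ.act μ.act (diag μ n)).comp (equivariant_comul μ).rTensor
    | succ j => exact (ih j).lTensor

theorem equivariant_dropAt (n : ℕ) (j : Fin (n + 2)) :
    Equivariant (diag μ (n + 1)) (diag μ n) (dropAt Coalgebra.counit n j) := by
  induction n with
  | zero =>
    cases j using Fin.cases with
    | zero => exact (equivariant_lid μ.act).comp (equivariant_counit μ).rTensor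
    | succ j => exact (equivariant_rid μ.act).comp (equivariant_counit μ).lTensor
  | succ n ih =>
    cases j using Fin.cases with
    | zero => exact (equivariant_lid (diag μ (n + 1))).comp (equivariant_counit μ).rTensor
    | succ j => exact (ih j).lTensor

theorem equivariant_snoc (n : ℕ) :
    Equivariant (actT (diag μ n) μ.act) (diag μ (n + 1))
      (TensorProduct.lift (snoc (k := k) (V := C) n)) := by
  induction n with
  | zero =>
    have : TensorProduct.lift (snoc (k := k) (V := C) 0) = LinearMap.id :=
      TensorProduct.ext' fun _ _ => rfl
    rw [this]
    exact fun a => rfl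
  | succ n ih =>
    have : TensorProduct.lift (snoc (k := k) (V := C) (n + 1)) =
        (TensorProduct.lift (snoc (k := k) (V := C) n)).lTensor C ∘ₗ
          (TensorProduct.assoc k C (TPow k C n) C).toLinearMap :=
      TensorProduct.ext_threefold fun _ _ _ => rfl
    rw [this]
    exact ih.lTensor.comp (equivariant_assoc μ.act (diag μ n) μ.act)

theorem diag_snoc (n : ℕ) (y : TPow k C n) (c : C) (h : H) :
    diag μ (n + 1) (snoc n y c) h = TensorProduct.lift (snoc n)
      (TensorProduct.map (diag μ n y) (μ.act c) (Coalgebra.comul h)) :=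
  (LinearMap.congr_fun (equivariant_snoc μ n (y ⊗ₜ c)) h).symm

/-- The action of `H` on the factor number `0`. -/
noncomputable def actHead : ∀ n : ℕ, TPow k C n →ₗ[k] H →ₗ[k] TPow k C n
  | 0 => μ.act
  | n + 1 => (LinearMap.rTensorHom (TPow k C n) ∘ₗ μ.act.flip).flip

theorem actHead_cons (n : ℕ) (a : C) (y : TPow k C n) (h : H) :
    actHead μ (n + 1) (cons n a y) h = cons n (μ.act a h) y := rfl

/-- `(c⁰ ⊗ ⋯ ⊗ cⁿ, h) ↦ cⁿ h ⊗ c⁰ ⊗ ⋯ ⊗ cⁿ⁻¹`. -/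
noncomputable def rotAct (n : ℕ) : TPow k C n →ₗ[k] H →ₗ[k] TPow k C n :=
  actHead μ n ∘ₗ rot k C n

theorem rotAct_snoc (n : ℕ) (y : TPow k C n) (c : C) (h : H) :
    rotAct μ (n + 1) (snoc n y c) h = cons n (μ.act c h) y := by
  rw [rotAct, LinearMap.comp_apply, rot_snoc, actHead_cons]

theorem dropAt_succ_actHead (n : ℕ) (i : Fin (n + 1)) (y : TPow k C (n + 1)) (h : H) :
    dropAt Coalgebra.counit n i.succ (actHead μ (n + 1) y h) =
      actHead μ n (dropAt Coalgebra.counit n i.succ y) h := by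
  refine LinearMap.congr_fun
    (f := dropAt Coalgebra.counit n i.succ ∘ₗ (actHead μ (n + 1)).flip h)
    (g := (actHead μ n).flip h ∘ₗ dropAt Coalgebra.counit n i.succ) (hom_ext_cons fun a z => ?_) y
  cases n with
  | zero =>
    change Coalgebra.counit (R := k) (show C from z) • μ.act a h =
      μ.act (Coalgebra.counit (R := k) (show C from z) • a) h
    rw [map_smul, LinearMap.smul_apply]
  | succ n => rfl

theorem dropAt_zero_actHead (n : ℕ) (y : TPow k C (n + 1)) (h : H) :
    dropAt Coalgebra.counit n 0 (actHead μ (n + 1) y h) =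
      Coalgebra.counit (R := k) h • dropAt Coalgebra.counit n 0 y := by
  refine LinearMap.congr_fun
    (f := dropAt Coalgebra.counit n 0 ∘ₗ (actHead μ (n + 1)).flip h)
    (g := Coalgebra.counit (R := k) h • dropAt Coalgebra.counit n 0)
    (hom_ext_cons fun a z => ?_) y
  simp only [LinearMap.comp_apply, LinearMap.flip_apply, LinearMap.smul_apply]
  rw [actHead_cons, dropAt_zero_cons, dropAt_zero_cons, μ.counit_act, smul_smul, mul_comm]

theorem splitAt_succ_actHead (n : ℕ) (i : Fin (n + 1)) (y : TPow k C (n + 1)) (h : H) :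
    splitAt Coalgebra.comul (n + 1) i.succ (actHead μ (n + 1) y h) =
      actHead μ (n + 2) (splitAt Coalgebra.comul (n + 1) i.succ y) h := by
  refine LinearMap.congr_fun
    (f := splitAt Coalgebra.comul (n + 1) i.succ ∘ₗ (actHead μ (n + 1)).flip h)
    (g := (actHead μ (n + 2)).flip h ∘ₗ splitAt Coalgebra.comul (n + 1) i.succ)
    (hom_ext_cons fun a z => rfl) y

theorem dropAt_succ_rotAct (n : ℕ) (i : Fin (n + 1)) (y : TPow k C (n + 1)) (h : H) :
    dropAt Coalgebra.counit n i.succ (rotAct μ (n + 1) y h) =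
      rotAct μ n (dropAt Coalgebra.counit n i.castSucc y) h := by
  rw [rotAct, rotAct, LinearMap.comp_apply, LinearMap.comp_apply, dropAt_succ_actHead]
  cases n with
  | zero => rw [dropAt_one_rot]
  | succ n => rw [dropAt_rot]

theorem dropAt_zero_rotAct (n : ℕ) (y : TPow k C (n + 1)) (h : H) :
    dropAt Coalgebra.counit n 0 (rotAct μ (n + 1) y h) =
      Coalgebra.counit (R := k) h • dropAt Coalgebra.counit n (Fin.last _) y := by
  rw [rotAct, LinearMap.comp_apply, dropAt_zero_actHead, dropAt_zero_rot]

theorem splitAt_succ_rotAct (n : ℕ) (i : Fin (n + 1)) (y : TPow k C (n + 1)) (h : H) :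
    splitAt Coalgebra.comul (n + 1) i.succ (rotAct μ (n + 1) y h) =
      rotAct μ (n + 2) (splitAt Coalgebra.comul (n + 1) i.castSucc y) h := by
  rw [rotAct, rotAct, LinearMap.comp_apply, LinearMap.comp_apply, splitAt_succ_actHead,
    splitAt_rot]

/-- For `β : H → C ⊗ ⋯ ⊗ C`, the map `h ↦ Σ rotAct (β(h₂), h₁)`. -/
noncomputable def rotStep (n : ℕ) : (H →ₗ[k] TPow k C n) →ₗ[k] H →ₗ[k] TPow k C n where
  toFun β := TensorProduct.lift (rotAct μ n ∘ₗ β).flip ∘ₗ Coalgebra.comul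
  map_add' β β' := by
    rw [← LinearMap.add_comp]
    congr 1
    exact TensorProduct.ext' fun _ _ => by simp
  map_smul' c β := by
    rw [RingHom.id_apply, ← LinearMap.smul_comp]
    congr 1
    exact TensorProduct.ext' fun _ _ => by simp

theorem rotStep_apply (n : ℕ) (β : H →ₗ[k] TPow k C n) (h : H) :
    rotStep μ n β h = TensorProduct.lift (rotAct μ n ∘ₗ β).flip (Coalgebra.comul h) := rfl

theorem snoc2_rotAct (n : ℕ) (y : TPow k C n) (z : C ⊗[k] C) (h : H) :
    rotStep μ (n + 2) (rotAct μ (n + 2) (snoc2 n y z)) h = cons2 n (actT μ.act μ.act z h) y := by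
  refine LinearMap.congr_fun
    (f := (rotStep μ (n + 2) ∘ₗ rotAct μ (n + 2) ∘ₗ snoc2 n y).flip h)
    (g := (cons2 n).flip y ∘ₗ (actT μ.act μ.act).flip h) (TensorProduct.ext' fun a b => ?_) z
  change rotStep μ (n + 2) (rotAct μ (n + 2) (snoc (n + 1) (snoc n y a) b)) h =
    cons2 n (TensorProduct.map (μ.act a) (μ.act b) (Coalgebra.comul h)) y
  rw [rotStep_apply]
  generalize Coalgebra.comul (R := k) h = t
  refine LinearMap.congr_fun
    (f := TensorProduct.lift (rotAct μ (n + 2) ∘ₗ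
      rotAct μ (n + 2) (snoc (n + 1) (snoc n y a) b)).flip)
    (g := (cons2 n).flip y ∘ₗ TensorProduct.map (μ.act a) (μ.act b))
    (TensorProduct.ext' fun p q => ?_) t
  change rotAct μ (n + 2) (rotAct μ (n + 2) (snoc (n + 1) (snoc n y a) b) q) p =
    cons (n + 1) (μ.act a p) (cons n (μ.act b q) y)
  rw [rotAct_snoc, ← snoc_cons, rotAct_snoc]

theorem rotAct_one (z : C ⊗[k] C) (h : H) :
    rotStep μ 1 (rotAct μ 1 z) h = actT μ.act μ.act z h := by
  refine LinearMap.congr_fun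
    (f := (rotStep μ 1 ∘ₗ rotAct μ 1).flip h)
    (g := (actT μ.act μ.act).flip h) (TensorProduct.ext' fun a b => ?_) z
  change rotStep μ 1 (rotAct μ 1 (snoc (k := k) (V := C) 0 a b)) h =
    TensorProduct.map (μ.act a) (μ.act b) (Coalgebra.comul h)
  rw [rotStep_apply]
  generalize Coalgebra.comul (R := k) h = t
  refine LinearMap.congr_fun
    (f := TensorProduct.lift (rotAct μ 1 ∘ₗ rotAct μ 1 (snoc (k := k) (V := C) 0 a b)).flip)
    (g := TensorProduct.map (μ.act a) (μ.act b))
    (TensorProduct.ext' fun p q => ?_) t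
  rfl

theorem splitAt_zero_rotAct (n : ℕ) (y : TPow k C n) (h : H) :
    splitAt Coalgebra.comul n 0 (rotAct μ n y h) =
      rotStep μ (n + 1) (rotAct μ (n + 1) (splitAt Coalgebra.comul n (Fin.last n) y)) h := by
  cases n with
  | zero => exact (μ.comul_act y h).trans (rotAct_one μ _ h).symm
  | succ n =>
    refine LinearMap.congr_fun
      (f := splitAt Coalgebra.comul (n + 1) 0 ∘ₗ (rotAct μ (n + 1)).flip h)
      (g := (rotStep μ (n + 2) ∘ₗ rotAct μ (n + 2)).flip h ∘ₗ
        splitAt Coalgebra.comul (n + 1) (Fin.last _)) (hom_ext_snoc fun x v => ?_) y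
    simp only [LinearMap.comp_apply, LinearMap.flip_apply]
    rw [rotAct_snoc, splitAt_zero_cons, splitAt_last_snoc, snoc2_rotAct, μ.comul_act]
    rfl

/-- The diagonal action on the first `j` factors. -/
noncomputable def partDiag : ∀ n : ℕ, ℕ → (TPow k C n →ₗ[k] H →ₗ[k] TPow k C n)
  | _, 0 => trivialAct
  | 0, _ + 1 => μ.act
  | n + 1, j + 1 => actT μ.act (partDiag n j)

theorem partDiag_full (n : ℕ) : partDiag μ n (n + 1) = diag μ n := by
  induction n with
  | zero => rfl
  | succ n ih => rw [partDiag, ih]; rfl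

theorem partDiag_zero (n : ℕ) : partDiag μ n 0 = trivialAct := by cases n <;> rfl

theorem actT_trivialAct (a : C) (c : C) (h : H) :
    actT μ.act (trivialAct (X := C)) (a ⊗ₜ c) h = μ.act a h ⊗ₜ c := by
  have h0 : TensorProduct.map (μ.act a) ((LinearMap.toSpanSingleton k C c))
      ((Coalgebra.counit (R := k) (A := H)).lTensor H (Coalgebra.comul h)) = μ.act a h ⊗ₜ c := by
    rw [Coalgebra.lTensor_counit_comul]; simp
  rw [← h0, actT_tmul]
  generalize Coalgebra.comul (R := k) h = t
  exact LinearMap.congr_fun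
    (f := TensorProduct.map (μ.act a) (trivialAct c))
    (g := TensorProduct.map (μ.act a) ((LinearMap.toSpanSingleton k C c)) ∘ₗ
      (Coalgebra.counit (R := k) (A := H)).lTensor H) (TensorProduct.ext' fun p q => rfl) t

theorem partDiag_snoc (n j : ℕ) (hj : j ≤ n + 1) (z : TPow k C n) (c : C) :
    partDiag μ (n + 1) j (snoc n z c) = (snoc n).flip c ∘ₗ partDiag μ n j z := by
  induction n generalizing j with
  | zero =>
    cases j with
    | zero => ext h; exact ((LinearMap.flip (snoc 0) c).map_smul _ _).symm
    | succ j =>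
      obtain rfl : j = 0 := by omega
      exact LinearMap.ext fun h => actT_trivialAct μ z c h
  | succ n ih =>
    cases j with
    | zero => ext h; exact ((LinearMap.flip (snoc (n + 1)) c).map_smul _ _).symm
    | succ j =>
      refine LinearMap.congr_fun
        (f := partDiag μ (n + 2) (j + 1) ∘ₗ (snoc (n + 1)).flip c)
        (g := LinearMap.llcomp k _ _ _ ((snoc (n + 1)).flip c) ∘ₗ partDiag μ (n + 1) (j + 1))
        (hom_ext_cons fun a y => LinearMap.ext fun h => ?_) z
      change TensorProduct.map (μ.act a) (partDiag μ (n + 1) j (snoc n y c)) (Coalgebra.comul h) =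
        (snoc (n + 1)).flip c (TensorProduct.map (μ.act a) (partDiag μ n j y) (Coalgebra.comul h))
      rw [ih j (by omega)]
      generalize Coalgebra.comul (R := k) h = t
      exact LinearMap.congr_fun
        (f := TensorProduct.map (μ.act a) ((snoc n).flip c ∘ₗ partDiag μ n j y))
        (g := (snoc (n + 1)).flip c ∘ₗ TensorProduct.map (μ.act a) (partDiag μ n j y))
        (TensorProduct.ext' fun p q => rfl) t

theorem rotStep_partDiag (n j : ℕ) (hj : j ≤ n) (y : TPow k C n) :
    rotStep μ n (partDiag μ n j y) = partDiag μ n (j + 1) (rot k C n y) := by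
  cases n with
  | zero =>
    obtain rfl : j = 0 := by omega
    refine LinearMap.ext fun h => ?_
    have h0 : μ.act y ((TensorProduct.rid k H)
        ((Coalgebra.counit (R := k) (A := H)).lTensor H (Coalgebra.comul h))) = μ.act y h := by
      rw [Coalgebra.lTensor_counit_comul]; simp
    refine Eq.trans ?_ h0
    rw [rotStep_apply]
    generalize Coalgebra.comul (R := k) h = t
    refine LinearMap.congr_fun
      (f := TensorProduct.lift (rotAct μ 0 ∘ₗ partDiag μ 0 0 y).flip)
      (g := μ.act y ∘ₗ (TensorProduct.rid k H).toLinearMap ∘ₗ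
        (Coalgebra.counit (R := k) (A := H)).lTensor H) (TensorProduct.ext' fun p q => ?_) t
    change μ.act (Coalgebra.counit (R := k) q • (show C from y)) p =
      μ.act y (Coalgebra.counit (R := k) q • p)
    rw [map_smul, LinearMap.smul_apply, map_smul]
  | succ n =>
    refine LinearMap.congr_fun
      (f := rotStep μ (n + 1) ∘ₗ partDiag μ (n + 1) j)
      (g := partDiag μ (n + 1) (j + 1) ∘ₗ rot k C (n + 1))
      (hom_ext_snoc fun z c => LinearMap.ext fun h => ?_) y
    simp only [LinearMap.comp_apply]
    rw [rot_snoc, partDiag_snoc _ _ _ hj, rotStep_apply]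
    change _ = TensorProduct.map (μ.act c) (partDiag μ n j z) (Coalgebra.comul h)
    generalize Coalgebra.comul (R := k) h = t
    refine LinearMap.congr_fun
      (f := TensorProduct.lift (rotAct μ (n + 1) ∘ₗ (snoc n).flip c ∘ₗ partDiag μ n j z).flip)
      (g := TensorProduct.map (μ.act c) (partDiag μ n j z)) (TensorProduct.ext' fun p q => ?_) t
    exact rotAct_snoc μ n (partDiag μ n j z q) c p

/-- `Σ (rotAct (x, h₃ g S(h₁))) h₂ = rotAct (x h, g)` for the diagonal action. -/
theorem rotAct_diag (n : ℕ) (y : TPow k C n) (g h : H)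
    (Λ : H ⊗[k] (H ⊗[k] H) →ₗ[k] TPow k C n) (hΛ : ∀ p q r, Λ (p ⊗ₜ (q ⊗ₜ r)) =
      diag μ n (rotAct μ n y (r * g * HopfAlgebra.antipode k p)) q) :
    Λ (comul3 k H h) = rotAct μ n (diag μ n y h) g := by
  suffices key : ∃ L : H ⊗[k] (H ⊗[k] H) →ₗ[k] TPow k C n,
      (∀ s q r, L (j1 k H s * (TensorProduct.assoc k H H H (Coalgebra.comul q ⊗ₜ r))) =
        diag μ n (rotAct μ n y (r * g * s)) q) ∧
      L (j23 k H (Coalgebra.comul h)) = rotAct μ n (diag μ n y h) g by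
    obtain ⟨L, h1, h2⟩ := key
    rw [← h2]
    exact comul3_antipode_left Λ L (fun p q r => by rw [hΛ, h1]) h
  clear hΛ Λ
  cases n with
  | zero =>
    -- `u ⊗ (a ⊗ b) ↦ ε(a) y (b g u)`
    let L : H ⊗[k] (H ⊗[k] H) →ₗ[k] C :=
      TensorProduct.lift (((LinearMap.mul k H).flip.compr₂ (μ.act y)).compl₂
        (LinearMap.mulRight k g ∘ₗ (TensorProduct.lid k H).toLinearMap ∘ₗ
          (Coalgebra.counit (R := k) (A := H)).rTensor H))
    have hL : ∀ u a b, L (u ⊗ₜ (a ⊗ₜ b)) =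
        μ.act y ((Coalgebra.counit (R := k) a • b) * g * u) := fun u a b => rfl
    refine ⟨L, fun s q r => ?_, ?_⟩
    · refine Eq.trans ?_ (μ.act_mul y (r * g * s) q)
      have h0 : μ.act y (r * g * s * (TensorProduct.rid k H)
          ((Coalgebra.counit (R := k) (A := H)).lTensor H (Coalgebra.comul q))) =
          μ.act y (r * g * s * q) := by
        rw [Coalgebra.lTensor_counit_comul]; simp
      refine Eq.trans ?_ h0
      generalize Coalgebra.comul (R := k) q = t
      refine LinearMap.congr_fun
        (f := L ∘ₗ LinearMap.mulLeft k (j1 k H s) ∘ₗ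
          (TensorProduct.assoc k H H H).toLinearMap ∘ₗ (TensorProduct.mk k (H ⊗[k] H) H).flip r)
        (g := μ.act y ∘ₗ LinearMap.mulLeft k (r * g * s) ∘ₗ
          (TensorProduct.rid k H).toLinearMap ∘ₗ
            (Coalgebra.counit (R := k) (A := H)).lTensor H) (TensorProduct.ext' fun a b => ?_) t
      change L ((s ⊗ₜ 1) * (a ⊗ₜ (b ⊗ₜ r))) =
        μ.act y (r * g * s * (Coalgebra.counit (R := k) b • a))
      rw [Algebra.TensorProduct.tmul_mul_tmul, one_mul, hL]
      simp only [smul_mul_assoc, mul_smul_comm, mul_assoc]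
    · refine Eq.trans ?_ (μ.act_mul y h g)
      have h0 : μ.act y ((TensorProduct.lid k H)
          ((Coalgebra.counit (R := k) (A := H)).rTensor H (Coalgebra.comul h)) * g) =
          μ.act y (h * g) := by
        rw [Coalgebra.rTensor_counit_comul]; simp
      refine Eq.trans ?_ h0
      generalize Coalgebra.comul (R := k) h = t
      refine LinearMap.congr_fun (f := L ∘ₗ (j23 k H).toLinearMap)
        (g := μ.act y ∘ₗ LinearMap.mulRight k g ∘ₗ (TensorProduct.lid k H).toLinearMap ∘ₗ
          (Coalgebra.counit (R := k) (A := H)).rTensor H) (TensorProduct.ext' fun a b => ?_) t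
      change L (1 ⊗ₜ (a ⊗ₜ b)) = _
      rw [hL, mul_one]; rfl
  | succ n =>
    induction y using snoc_induction with
    | h0 => exact ⟨0, fun s q r => by simp, by simp⟩
    | hadd y y' ih ih' =>
      obtain ⟨L, h1, h2⟩ := ih
      obtain ⟨L', h1', h2'⟩ := ih'
      refine ⟨L + L', fun s q r => ?_, ?_⟩
      · rw [LinearMap.add_apply, h1, h1']; simp only [map_add, LinearMap.add_apply]
      · rw [LinearMap.add_apply, h2, h2']; simp only [map_add, LinearMap.add_apply]
    | hsnoc z v =>
    -- `u ⊗ (a ⊗ b) ↦ v (b g u) ⊗ z a`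
    let L : H ⊗[k] (H ⊗[k] H) →ₗ[k] TPow k C (n + 1) :=
      TensorProduct.lift ((LinearMap.lTensorHom H ∘ₗ (LinearMap.mul k H).flip ∘ₗ
        LinearMap.mulLeft k g).compr₂ (TensorProduct.map (μ.act v) (diag μ n z) ∘ₗ
          (TensorProduct.comm k H H).toLinearMap))
    have hL : ∀ u a b, L (u ⊗ₜ (a ⊗ₜ b)) =
        cons n (μ.act v (b * (g * u))) (diag μ n z a) := fun u a b => rfl
    refine ⟨L, fun s q r => ?_, ?_⟩
    · rw [rotAct_snoc, diag_cons]
      generalize Coalgebra.comul (R := k) q = t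
      refine LinearMap.congr_fun
        (f := L ∘ₗ LinearMap.mulLeft k (j1 k H s) ∘ₗ
          (TensorProduct.assoc k H H H).toLinearMap ∘ₗ (TensorProduct.mk k (H ⊗[k] H) H).flip r)
        (g := TensorProduct.map (μ.act (μ.act v (r * g * s))) (diag μ n z))
        (TensorProduct.ext' fun a b => ?_) t
      change L ((s ⊗ₜ 1) * (a ⊗ₜ (b ⊗ₜ r))) =
        cons n (μ.act (μ.act v (r * g * s)) a) (diag μ n z b)
      rw [Algebra.TensorProduct.tmul_mul_tmul, one_mul, hL, ← μ.act_mul]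
      simp only [mul_assoc]
    · rw [diag_snoc]
      generalize Coalgebra.comul (R := k) h = t
      refine LinearMap.congr_fun (f := L ∘ₗ (j23 k H).toLinearMap)
        (g := (rotAct μ (n + 1)).flip g ∘ₗ TensorProduct.lift (snoc n) ∘ₗ
          TensorProduct.map (diag μ n z) (μ.act v)) (TensorProduct.ext' fun a b => ?_) t
      change L (1 ⊗ₜ (a ⊗ₜ b)) = rotAct μ (n + 1) (snoc n (diag μ n z a) (μ.act v b)) g
      rw [hL, mul_one, rotAct_snoc, ← μ.act_mul]

end DiagonalAction

section HopfCyclicModule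

variable {k : Type u} [Field k] {H : Type v} [Ring H] [HopfAlgebra k H]
variable {C : Type x} [AddCommGroup C] [Module k C] [Coalgebra k C] (μ : ModuleCoalgebra k H C)
variable {N : Type w} [AddCommGroup N] [Module k N] (𝔫 : SAYDModule k H N)

/-- `n ⊗ h ↦ β(h) ⊗ n`. -/
noncomputable def swapMap {X : Type y} [AddCommGroup X] [Module k X] (β : H →ₗ[k] X) :
    N ⊗[k] H →ₗ[k] X ⊗[k] N := (TensorProduct.comm k N X).toLinearMap ∘ₗ β.lTensor N

theorem swapMap_tmul {X : Type y} [AddCommGroup X] [Module k X] (β : H →ₗ[k] X) (n : N) (h : H) :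
    swapMap β (n ⊗ₜ h) = β h ⊗ₜ n := rfl

/-- The cyclic operator before passing to the quotient:
`c⁰ ⊗ ⋯ ⊗ cⁿ ⊗ m ↦ cⁿ m₁ ⊗ c⁰ ⊗ ⋯ ⊗ cⁿ⁻¹ ⊗ m₀`. -/
noncomputable def twist (n : ℕ) : TPow k C n ⊗[k] N →ₗ[k] TPow k C n ⊗[k] N :=
  (TensorProduct.lift (rotAct μ n)).rTensor N ∘ₗ
    (TensorProduct.assoc k (TPow k C n) H N).symm.toLinearMap ∘ₗ
      ((TensorProduct.comm k N H).toLinearMap ∘ₗ 𝔫.coact).lTensor (TPow k C n)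

theorem twist_tmul (n : ℕ) (y : TPow k C n) (m : N) :
    twist μ 𝔫 n (y ⊗ₜ m) = swapMap (rotAct μ n y) (𝔫.coact m) := by
  change (TensorProduct.lift (rotAct μ n)).rTensor N ((TensorProduct.assoc k (TPow k C n) H N).symm
    (y ⊗ₜ TensorProduct.comm k N H (𝔫.coact m))) = _
  generalize 𝔫.coact m = z
  exact LinearMap.congr_fun
    (f := (TensorProduct.lift (rotAct μ n)).rTensor N ∘ₗ
      (TensorProduct.assoc k (TPow k C n) H N).symm.toLinearMap ∘ₗ
        TensorProduct.mk k (TPow k C n) (H ⊗[k] N) y ∘ₗ (TensorProduct.comm k N H).toLinearMap)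
    (g := swapMap (rotAct μ n y)) (TensorProduct.ext' fun _ _ => rfl) z

theorem rTensor_swapMap {X Y : Type y} [AddCommGroup X] [Module k X] [AddCommGroup Y] [Module k Y]
    (f : X →ₗ[k] Y) (β : H →ₗ[k] X) (z : N ⊗[k] H) :
    f.rTensor N (swapMap β z) = swapMap (f ∘ₗ β) z :=
  LinearMap.congr_fun (f := f.rTensor N ∘ₗ swapMap β) (g := swapMap (f ∘ₗ β))
    (TensorProduct.ext' fun _ _ => rfl) z

theorem twist_swapMap (n : ℕ) (β : H →ₗ[k] TPow k C n) (m : N) :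
    twist μ 𝔫 n (swapMap β (𝔫.coact m)) = swapMap (rotStep μ n β) (𝔫.coact m) := by
  -- `n ⊗ (p ⊗ q) ↦ rotAct (β q) p ⊗ n`
  let Θ : N ⊗[k] (H ⊗[k] H) →ₗ[k] TPow k C n ⊗[k] N :=
    (TensorProduct.comm k N (TPow k C n)).toLinearMap ∘ₗ
      (TensorProduct.lift (rotAct μ n ∘ₗ β).flip).lTensor N
  have h1 : ∀ z, twist μ 𝔫 n (swapMap β z) =
      Θ (TensorProduct.assoc k N H H (𝔫.coact.rTensor H z)) := fun z => by
    refine LinearMap.congr_fun (f := twist μ 𝔫 n ∘ₗ swapMap β)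
      (g := Θ ∘ₗ (TensorProduct.assoc k N H H).toLinearMap ∘ₗ 𝔫.coact.rTensor H)
      (TensorProduct.ext' fun a h => ?_) z
    change twist μ 𝔫 n (β h ⊗ₜ a) = Θ (TensorProduct.assoc k N H H (𝔫.coact a ⊗ₜ h))
    rw [twist_tmul]
    generalize 𝔫.coact a = z
    exact LinearMap.congr_fun (f := swapMap (rotAct μ n (β h)))
      (g := Θ ∘ₗ (TensorProduct.assoc k N H H).toLinearMap ∘ₗ
        (TensorProduct.mk k (N ⊗[k] H) H).flip h) (TensorProduct.ext' fun _ _ => rfl) z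
  rw [h1, 𝔫.coassoc]
  generalize 𝔫.coact m = z
  exact LinearMap.congr_fun (f := Θ ∘ₗ (Coalgebra.comul (R := k) (A := H)).lTensor N)
    (g := swapMap (rotStep μ n β)) (TensorProduct.ext' fun _ _ => rfl) z

theorem swapMap_counit {X : Type y} [AddCommGroup X] [Module k X] (a : X) (m : N) :
    swapMap (trivialAct a) (𝔫.coact m) = a ⊗ₜ m := by
  conv_rhs => rw [← 𝔫.counit m]
  generalize 𝔫.coact m = z
  refine LinearMap.congr_fun (f := swapMap (trivialAct a))
    (g := TensorProduct.mk k X N a ∘ₗ (TensorProduct.rid k N).toLinearMap ∘ₗ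
      (Coalgebra.counit (R := k) (A := H)).lTensor N) (TensorProduct.ext' fun n h => ?_) z
  change (Coalgebra.counit (R := k) h • a) ⊗ₜ[k] n = a ⊗ₜ (Coalgebra.counit (R := k) h • n)
  rw [TensorProduct.smul_tmul]

theorem rTensor_congr {X Y Y' Z : Type y} [AddCommGroup X] [Module k X] [AddCommGroup Y]
    [Module k Y] [AddCommGroup Y'] [Module k Y'] [AddCommGroup Z] [Module k Z]
    {f : X →ₗ[k] Y} {g : Y →ₗ[k] Z} {f' : X →ₗ[k] Y'} {g' : Y' →ₗ[k] Z}
    (h : ∀ a, g (f a) = g' (f' a)) (z : X ⊗[k] N) :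
    g.rTensor N (f.rTensor N z) = g'.rTensor N (f'.rTensor N z) := by
  rw [← LinearMap.rTensor_comp_apply, ← LinearMap.rTensor_comp_apply]
  congr 2
  exact LinearMap.ext h

theorem rTensor_congr_id {X Y : Type y} [AddCommGroup X] [Module k X] [AddCommGroup Y]
    [Module k Y] {f : X →ₗ[k] Y} {g : Y →ₗ[k] X} (h : ∀ a, g (f a) = a) (z : X ⊗[k] N) :
    g.rTensor N (f.rTensor N z) = z := by
  rw [← LinearMap.rTensor_comp_apply, show g ∘ₗ f = LinearMap.id from LinearMap.ext h,
    LinearMap.rTensor_id, LinearMap.id_apply]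

/-- Operators commuting with `rotAct` commute with `twist`. -/
theorem twist_natural {n m : ℕ} (f f' : TPow k C n →ₗ[k] TPow k C m)
    (h : ∀ y g, f (rotAct μ n y g) = rotAct μ m (f' y) g) (z : TPow k C n ⊗[k] N) :
    f.rTensor N (twist μ 𝔫 n z) = twist μ 𝔫 m (f'.rTensor N z) := by
  refine LinearMap.congr_fun (f := f.rTensor N ∘ₗ twist μ 𝔫 n) (g := twist μ 𝔫 m ∘ₗ f'.rTensor N)
    (TensorProduct.ext' fun y a => ?_) z
  simp only [LinearMap.comp_apply, LinearMap.rTensor_tmul]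
  rw [twist_tmul, twist_tmul, rTensor_swapMap]
  congr 1
  exact congrArg swapMap (LinearMap.ext fun g => h y g)

/-- The spaces `C ⊗ ⋯ ⊗ C ⊗ N` with `n + 1` factors `C`: the face `dᵢ` applies the counit to the
factor number `i`, the degeneracy `sⱼ` the comultiplication to the factor number `j`, and the
cyclic operator is `c⁰ ⊗ ⋯ ⊗ cⁿ ⊗ m ↦ cⁿ m₁ ⊗ c⁰ ⊗ ⋯ ⊗ cⁿ⁻¹ ⊗ m₀`. -/
noncomputable def hopfParacyclic : ParacyclicModule.{u, max x w} k where
  X n := TPow k C n ⊗[k] N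
  d n i := (dropAt Coalgebra.counit n i).rTensor N
  s n j := (splitAt Coalgebra.comul n j).rTensor N
  t := twist μ 𝔫
  d_d n i j h := rTensor_congr fun a => dropAt_dropAt _ n i j h a
  s_s n i j h := rTensor_congr fun a => splitAt_splitAt _ Coalgebra.coassoc_apply n i j h a
  d_s_of_le n i j h := rTensor_congr fun a => dropAt_splitAt_le _ _ n i j h a
  d_s_self n i := rTensor_congr_id fun a => dropAt_splitAt_self _ _
    (fun c => by rw [Coalgebra.rTensor_counit_comul]; simp) n i a
  d_s_succ n i := rTensor_congr_id fun a => dropAt_splitAt_succ _ _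
    (fun c => by rw [Coalgebra.lTensor_counit_comul]; simp) n i a
  d_s_of_gt n i j h := rTensor_congr fun a => dropAt_splitAt_gt _ _ n i j h a
  d_succ_t n i := twist_natural μ 𝔫 _ _ fun y g => dropAt_succ_rotAct μ n i y g
  d_zero_t n z := by
    refine LinearMap.congr_fun
      (f := (dropAt Coalgebra.counit n 0).rTensor N ∘ₗ twist μ 𝔫 (n + 1))
      (g := (dropAt Coalgebra.counit n (Fin.last (n + 1))).rTensor N)
      (TensorProduct.ext' fun y m => ?_) z
    rw [LinearMap.comp_apply, twist_tmul, rTensor_swapMap, LinearMap.rTensor_tmul,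
      ← swapMap_counit 𝔫]
    congr 1
    exact congrArg swapMap (LinearMap.ext fun g => dropAt_zero_rotAct μ n y g)
  s_succ_t n j := twist_natural μ 𝔫 _ _ fun y g => splitAt_succ_rotAct μ n j y g
  s_zero_t n z := by
    refine LinearMap.congr_fun
      (f := (splitAt Coalgebra.comul n 0).rTensor N ∘ₗ twist μ 𝔫 n)
      (g := twist μ 𝔫 (n + 1) ∘ₗ twist μ 𝔫 (n + 1) ∘ₗ
        (splitAt Coalgebra.comul n (Fin.last n)).rTensor N)
      (TensorProduct.ext' fun y m => ?_) z
    simp only [LinearMap.comp_apply, LinearMap.rTensor_tmul]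
    rw [twist_tmul, twist_tmul, rTensor_swapMap, twist_swapMap]
    congr 1
    exact congrArg swapMap (LinearMap.ext fun g => splitAt_zero_rotAct μ n y g)

/-- The subspace of `C ⊗ ⋯ ⊗ C ⊗ N` spanned by the elements `x h ⊗ m - x ⊗ h m`. -/
noncomputable def hopfRel (n : ℕ) : Submodule k (TPow k C n ⊗[k] N) :=
  Submodule.span k {z | ∃ (y : TPow k C n) (h : H) (m : N),
    z = diag μ n y h ⊗ₜ[k] m - y ⊗ₜ[k] 𝔫.act h m}

theorem hopfRel_mem {n : ℕ} (y : TPow k C n) (h : H) (m : N) :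
    diag μ n y h ⊗ₜ[k] m - y ⊗ₜ[k] 𝔫.act h m ∈ hopfRel μ 𝔫 n :=
  Submodule.subset_span ⟨y, h, m, rfl⟩

theorem hopfRel_equivariant {n m : ℕ} {f : TPow k C n →ₗ[k] TPow k C m}
    (hf : Equivariant (diag μ n) (diag μ m) f) :
    hopfRel μ 𝔫 n ≤ (hopfRel μ 𝔫 m).comap (f.rTensor N) := by
  refine Submodule.span_le.mpr ?_
  rintro _ ⟨y, h, a, rfl⟩
  change f.rTensor N (diag μ n y h ⊗ₜ[k] a - y ⊗ₜ[k] 𝔫.act h a) ∈ hopfRel μ 𝔫 m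
  rw [map_sub, LinearMap.rTensor_tmul, LinearMap.rTensor_tmul, ← LinearMap.comp_apply, hf y]
  exact hopfRel_mem μ 𝔫 (f y) h a

theorem swapMap_diag_sub_mem (n : ℕ) (y : TPow k C n) (h : H) (z : N ⊗[k] H) :
    swapMap (rotAct μ n (diag μ n y h)) z - swapMap (rotAct μ n y) (aydTwist 𝔫.act h z) ∈
      hopfRel μ 𝔫 n := by
  induction z using TensorProduct.induction_on with
  | zero => simp
  | add p q hp hq =>
    have := add_mem hp hq
    rw [map_add, map_add, map_add]
    convert this using 1; abel
  | tmul a g =>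
    rw [swapMap_tmul, aydTwist_eq]
    -- `p ⊗ (q ⊗ r) ↦ (rotAct (y, r g S(p))) q`
    let Λ : H ⊗[k] (H ⊗[k] H) →ₗ[k] TPow k C n :=
      TensorProduct.lift (LinearMap.flip (TensorProduct.lift
        ((LinearMap.llcomp k H (TPow k C n) (TPow k C n)).compl₁₂
          (diag μ n).flip
          ((LinearMap.llcomp k H H (TPow k C n) (rotAct μ n y)) ∘ₗ
            (LinearMap.mul k H) ∘ₗ LinearMap.mulRight k g))) ∘ₗ HopfAlgebra.antipode k)
    have hΛ : ∀ p q r, Λ (p ⊗ₜ (q ⊗ₜ r)) =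
        diag μ n (rotAct μ n y (r * g * HopfAlgebra.antipode k p)) q := fun p q r => rfl
    rw [← rotAct_diag μ n y g h Λ hΛ, ← Submodule.Quotient.eq]
    refine LinearMap.congr_fun
      (f := (hopfRel μ 𝔫 n).mkQ ∘ₗ (TensorProduct.mk k (TPow k C n) N).flip a ∘ₗ Λ)
      (g := (hopfRel μ 𝔫 n).mkQ ∘ₗ swapMap (rotAct μ n y) ∘ₗ (aydPre 𝔫.act).flip (a ⊗ₜ g))
      (hom_ext_three fun p q r => ?_) (comul3 k H h)
    exact (Submodule.Quotient.eq _).mpr (hopfRel_mem μ 𝔫 _ q a)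

theorem hopfRel_twist (n : ℕ) : hopfRel μ 𝔫 n ≤ (hopfRel μ 𝔫 n).comap (twist μ 𝔫 n) := by
  refine Submodule.span_le.mpr ?_
  rintro _ ⟨y, h, a, rfl⟩
  change twist μ 𝔫 n (diag μ n y h ⊗ₜ[k] a - y ⊗ₜ[k] 𝔫.act h a) ∈ hopfRel μ 𝔫 n
  rw [map_sub, twist_tmul, twist_tmul, 𝔫.ayd]
  exact swapMap_diag_sub_mem μ 𝔫 n y h _

theorem twist_pow (n j : ℕ) (hj : j ≤ n + 1) (y : TPow k C n) (m : N) :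
    (twist μ 𝔫 n ^ j) (y ⊗ₜ m) = swapMap (partDiag μ n j ((rot k C n ^ j) y)) (𝔫.coact m) := by
  induction j with
  | zero => rw [partDiag_zero, swapMap_counit]; rfl
  | succ j ih =>
    rw [pow_succ', Module.End.mul_apply, ih (by omega), twist_swapMap,
      rotStep_partDiag μ n j (by omega), pow_succ', Module.End.mul_apply]

theorem twist_pow_sub_mem (n : ℕ) (z : TPow k C n ⊗[k] N) :
    (twist μ 𝔫 n ^ (n + 1)) z - z ∈ hopfRel μ 𝔫 n := by
  induction z using TensorProduct.induction_on with
  | zero => simp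
  | add p q hp hq =>
    have := add_mem hp hq
    rw [map_add]
    convert this using 1; abel
  | tmul y m =>
    rw [twist_pow μ 𝔫 n (n + 1) le_rfl, rot_pow, partDiag_full, Module.End.one_apply]
    have hs : y ⊗ₜ[k] m = y ⊗ₜ[k] TensorProduct.lift 𝔫.act.flip (𝔫.coact m) := by
      rw [𝔫.stable]
    rw [hs]
    generalize 𝔫.coact m = z
    rw [← Submodule.Quotient.eq]
    refine LinearMap.congr_fun
      (f := (hopfRel μ 𝔫 n).mkQ ∘ₗ swapMap (diag μ n y))
      (g := (hopfRel μ 𝔫 n).mkQ ∘ₗ TensorProduct.mk k (TPow k C n) N y ∘ₗ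
        TensorProduct.lift 𝔫.act.flip) (TensorProduct.ext' fun a h => ?_) z
    exact (Submodule.Quotient.eq _).mpr (hopfRel_mem μ 𝔫 y h a)

/-- The cyclic module of the module coalgebra `C` with coefficients in `N`. -/
noncomputable def hopfCyclic : CyclicModule.{u, max x w} k :=
  (hopfParacyclic μ 𝔫).quot (hopfRel μ 𝔫)
    (fun n i => hopfRel_equivariant μ 𝔫 (equivariant_dropAt μ n i))
    (fun n j => hopfRel_equivariant μ 𝔫 (equivariant_splitAt μ n j))
    (hopfRel_twist μ 𝔫) (twist_pow_sub_mem μ 𝔫)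

end HopfCyclicModule

section GaloisExtensions

variable {k : Type u} [Field k] {H : Type v} [Ring H] [HopfAlgebra k H]
variable {A : Type w} [Ring A] [Algebra k A] (ρ : ComoduleAlgebra k H A)
variable {C : Type x} [AddCommGroup C] [Module k C] [Coalgebra k C] (μ : ModuleCoalgebra k H C)
variable (e : C)

/-- The coaction `a ↦ a₀ ⊗ e a₁` of `C` on `A` induced by the element `e` of `C`. -/
noncomputable def inducedCoact : A →ₗ[k] A ⊗[k] C :=
  (μ.act e).lTensor A ∘ₗ ρ.coact.toLinearMap

/-- The algebra of coinvariants: the elements `b` of `A` such that the induced coaction of `C`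
commutes with the left multiplication by `b`. -/
noncomputable def coinvariants : Subalgebra k A where
  carrier := {b | ∀ a, inducedCoact ρ μ e (b * a) =
    (LinearMap.mulLeft k b).rTensor C (inducedCoact ρ μ e a)}
  mul_mem' {b c} hb hc a := by
    rw [mul_assoc, hb, hc, ← LinearMap.rTensor_comp_apply, LinearMap.mulLeft_mul]
  add_mem' {b c} hb hc a := by
    have : LinearMap.mulLeft k (b + c) = LinearMap.mulLeft k b + LinearMap.mulLeft k c := by
      ext x; simp [add_mul]
    rw [add_mul, map_add, hb, hc, this, LinearMap.rTensor_add, LinearMap.add_apply]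
  algebraMap_mem' c a := by
    have : LinearMap.mulLeft k (algebraMap k A c) = c • LinearMap.id := by
      ext x; simp [Algebra.smul_def]
    rw [← Algebra.smul_def, map_smul, this, LinearMap.rTensor_smul, LinearMap.rTensor_id]
    rfl

/-- The subspace of `A ⊗ A` spanned by the elements `a b ⊗ a' - a ⊗ b a'` with `b ∈ B`. -/
noncomputable def balancedRel (B : Subalgebra k A) : Submodule k (A ⊗[k] A) :=
  Submodule.span k {z | ∃ (a b a' : A) (_ : b ∈ B), z = (a * b) ⊗ₜ[k] a' - a ⊗ₜ[k] (b * a')}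

/-- The tensor product `A ⊗ A` over the subalgebra `B`. -/
abbrev BalancedTensor (B : Subalgebra k A) : Type w := (A ⊗[k] A) ⧸ balancedRel B

/-- The map `a ⊗ a' ↦ a a'₀ ⊗ e a'₁` on `A ⊗ A`. -/
noncomputable def canonicalPre : A ⊗[k] A →ₗ[k] A ⊗[k] C :=
  TensorProduct.lift (((LinearMap.rTensorHom C ∘ₗ LinearMap.mul k A).compl₂
    (inducedCoact ρ μ e)))

theorem canonicalPre_tmul (a a' : A) : canonicalPre ρ μ e (a ⊗ₜ a') =
    (LinearMap.mulLeft k a).rTensor C (inducedCoact ρ μ e a') := rfl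

/-- The canonical map from the tensor square of `A` over its coinvariants to `A ⊗ C`, which sends
the class of `a ⊗ a'` to `a a'₀ ⊗ e a'₁`. -/
noncomputable def canonicalMap : BalancedTensor (coinvariants ρ μ e) →ₗ[k] A ⊗[k] C :=
  (balancedRel (coinvariants ρ μ e)).liftQ (canonicalPre ρ μ e) (by
    refine Submodule.span_le.mpr ?_
    rintro _ ⟨a, b, a', hb, rfl⟩
    rw [SetLike.mem_coe, LinearMap.mem_ker, map_sub, sub_eq_zero, canonicalPre_tmul,
      canonicalPre_tmul, hb a', ← LinearMap.rTensor_comp_apply, LinearMap.mulLeft_mul])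

/-- `(a, x ⊗ a') ↦ (e a'₁ ⊗ x) ⊗ a a'₀`, where `x` is a tensor with `n + 1` factors. -/
noncomputable def wordStep (n : ℕ) :
    A →ₗ[k] TPow k C n ⊗[k] A →ₗ[k] TPow k C (n + 1) ⊗[k] A :=
  LinearMap.compr₂ (((LinearMap.lTensorHom (TPow k C n) ∘ₗ LinearMap.rTensorHom C ∘ₗ
      LinearMap.mul k A)).compl₂ ((inducedCoact ρ μ e).lTensor (TPow k C n)))
    ((TensorProduct.comm k (TPow k C n) C).toLinearMap.rTensor A ∘ₗ
      (TensorProduct.assoc k (TPow k C n) C A).symm.toLinearMap ∘ₗ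
        (TensorProduct.comm k A C).toLinearMap.lTensor (TPow k C n))

/-- The map `A ⊗ ⋯ ⊗ A → (C ⊗ ⋯ ⊗ C) ⊗ A` (with `n + 1` factors `A` and `n + 1` factors `C`),
`a⁰ ⊗ ⋯ ⊗ aⁿ ↦ (e a¹₁ ⋯ aⁿ₁ ⊗ e a²₂ ⋯ aⁿ₂ ⊗ ⋯ ⊗ e aⁿₙ ⊗ e) ⊗ a⁰ a¹₀ ⋯ aⁿ₀`. It is built from the
right, multiplying by one more element of `A` from the left at each step. -/
noncomputable def word : ∀ n : ℕ, TPow k A n →ₗ[k] TPow k C n ⊗[k] A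
  | 0 => TensorProduct.mk k C A e
  | n + 1 => TensorProduct.lift ((wordStep ρ μ e n).compl₂ (word n))

end GaloisExtensions

section Comparison

/-- The class of a tensor `a⁰ ⊗ ⋯ ⊗ aⁿ` in the cyclic module of the extension. -/
noncomputable def relativeMk {k : Type u} [Field k] {A : Type v} [Ring A] [Algebra k A]
    (B : Subalgebra k A) (n : ℕ) : TPow k A n →ₗ[k] (relativeCyclic B).X n := (cyclicRel B n).mkQ

/-- The class of a tensor `c⁰ ⊗ ⋯ ⊗ cⁿ ⊗ m` in the Hopf-cyclic module. -/
noncomputable def hopfMk {k : Type u} [Field k] {H : Type v} [Ring H] [HopfAlgebra k H]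
    {C : Type x} [AddCommGroup C] [Module k C] [Coalgebra k C] (μ : ModuleCoalgebra k H C)
    {N : Type w} [AddCommGroup N] [Module k N] (𝔫 : SAYDModule k H N) (n : ℕ) :
    TPow k C n ⊗[k] N →ₗ[k] (hopfCyclic μ 𝔫).X n := (hopfRel μ 𝔫 n).mkQ

/-- An isomorphism of cyclic modules: linear isomorphisms in all degrees which commute with the
faces, the degeneracies and the cyclic operators. -/
structure CyclicModule.Iso {k : Type u} [Field k] (Z : CyclicModule.{u, w} k)
    (Y : CyclicModule.{u, x} k) where
  equiv : ∀ n, Z.X n ≃ₗ[k] Y.X n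
  map_d : ∀ n i z, equiv n (Z.d n i z) = Y.d n i (equiv (n + 1) z)
  map_s : ∀ n j z, equiv (n + 1) (Z.s n j z) = Y.s n j (equiv n z)
  map_t : ∀ n z, equiv n (Z.t n z) = Y.t n (equiv n z)

/-- The map on periodic chains induced by an isomorphism of cyclic modules. -/
noncomputable def CyclicModule.Iso.onChains {k : Type u} [Field k] {Z : CyclicModule.{u, w} k}
    {Y : CyclicModule.{u, x} k} (Φ : Z.Iso Y) (p : ZMod 2) : Z.PChain p →ₗ[k] Y.PChain p :=
  LinearMap.pi fun q => (Φ.equiv q.1).toLinearMap ∘ₗ LinearMap.proj q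

end Comparison

end HopfCyclic

/-! The space (C ⊗ ⋯ ⊗ C) ⊗ A with n + 1 factors C is an A-bimodule: A multiplies the factor A on
the left (`leftMul`), and on the right it acts by (y ⊗ x) a = y a₁ ⊗ x a₀ (`rightMul`). The tensor
power of A over B with n + 2 factors is an A-bimodule through its two outer factors. For a bimodule
V let V / [A, V] be the quotient by all a v - v a. The theorem holds because both cyclic modules are
such commutator quotients in degree n, and the iterated canonical map `iterCan` is an isomorphism
between the two bimodules.

On the Hopf side, (C ⊗ ⋯ ⊗ C) ⊗_H (H ⊗ A) is (C ⊗ ⋯ ⊗ C) ⊗ A, and the relations defining M become y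
a'₁ ⊗ a a'₀ = y ⊗ a' a. These are the commutator relations, and there are no others
(`hopfClass_rightMul`, `hopfClass_surjective`, `exists_hopfClass_lift`). On the algebra side, the
last face a⁰ ⊗ ⋯ ⊗ aⁿ⁺¹ ↦ aⁿ⁺¹ a⁰ ⊗ a¹ ⊗ ⋯ ⊗ aⁿ identifies the commutator quotient of the tensor
power over B with the cyclic tensor product; its inverse appends a factor 1. Appending 1 before
applying `iterCan` gives `word`, so the map induced on commutator quotients is Φ.

Two facts about `iterCan` carry this. It is linear for the right action, which follows from
`wordStep_rightMul`: the coaction is multiplicative and coassociative. And it is bijective modulo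
the relations over B. For the latter a k-linear section σ of the canonical map suffices: applied
once per factor it gives `iterSection`, an exact right inverse (`iterCan_iterSection`), and a left
inverse up to the relations over B (`iterSection_iterCan`). The two bimodules are then compared in
`comparison_bijective`.

For the cyclic structure it is enough to treat t, d₀ and s₀, because t is invertible and conjugates
the other faces and degeneracies to these (`isoOfZero`). The last letter of a word is always e. The
cyclic operator moves it to the front, where the coaction of M turns it into e x₁: this is precisely
one recursive step of the word. It remains to carry the last factor of A from the right to the left,
which the commutator relations permit (`hopfClass_word_rot`). The cases d₀ and s₀ come from ε(e) = 1
and Δ(e) = e ⊗ e, together with the counit and coassociativity of the coaction.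

Finally b and B are built from the cyclic operators, faces and degeneracies, so an isomorphism of
cyclic modules is an isomorphism of periodic complexes, taken degree by degree in the product. -/

open scoped TensorProduct

namespace HopfCyclic

universe u v w x y

/-! ### Isomorphisms of cyclic modules and periodic cyclic homology. -/

section HomologyOfIso

variable {k : Type u} [Field k]

namespace CyclicModule.Iso

variable {Z : CyclicModule.{u, w} k} {Y : CyclicModule.{u, x} k} (Φ : Z.Iso Y)

theorem map_b (n : ℕ) (z : Z.X (n + 1)) : Φ.equiv n (Z.b n z) = Y.b n (Φ.equiv (n + 1) z) := by
  simp only [CyclicModule.b, LinearMap.sum_apply, LinearMap.smul_apply, map_sum, map_smul, Φ.map_d]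

theorem map_st (n : ℕ) (z : Z.X n) : Φ.equiv n (Z.st n z) = Y.st n (Φ.equiv n z) := by
  simp only [CyclicModule.st, LinearMap.smul_apply, map_smul, Φ.map_t]

theorem map_st_pow (n i : ℕ) (z : Z.X n) :
    Φ.equiv n ((Z.st n ^ i) z) = (Y.st n ^ i) (Φ.equiv n z) := by
  induction i with
  | zero => rfl
  | succ i ih => rw [pow_succ', pow_succ', Module.End.mul_apply, Module.End.mul_apply, map_st, ih]

theorem map_norm (n : ℕ) (z : Z.X n) : Φ.equiv n (Z.norm n z) = Y.norm n (Φ.equiv n z) := by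
  simp only [CyclicModule.norm, LinearMap.sum_apply, map_sum, map_st_pow]

/-- The Connes operator is composed of the cyclic operator, the norm and the last degeneracy, so it
is preserved strictly and not only up to homotopy. -/
theorem map_B (n : ℕ) (z : Z.X n) : Φ.equiv (n + 1) (Z.B n z) = Y.B n (Φ.equiv n z) := by
  simp only [CyclicModule.B, LinearMap.comp_apply, LinearMap.sub_apply, LinearMap.id_apply, map_sub,
    map_st, Φ.map_t, Φ.map_s, map_norm]

/-- The component of b + B in degree q involves the chain only in degrees q + 1 and q - 1, so a
check in each degree suffices although the chains form an infinite product. -/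
theorem map_D (p p' : ZMod 2) (h : p' = p + 1) (z : Z.PChain p) :
    Φ.onChains p' (Z.D p p' h z) = Y.D p p' h (Φ.onChains p z) := by
  funext q
  change Φ.equiv q.1 (Z.b q.1 (z ⟨q.1 + 1, _⟩) + Z.BInto p p' h q z) =
    Y.b q.1 (Φ.equiv (q.1 + 1) (z ⟨q.1 + 1, _⟩)) + Y.BInto p p' h q (Φ.onChains p z)
  rw [map_add, map_b]
  congr 1
  obtain ⟨q, hq⟩ := q
  cases q with
  -- Nothing lies below degree 0, so the Connes component vanishes on both sides.
  | zero => exact map_zero _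
  | succ q => exact Φ.map_B q _

/-- The linear isomorphism on periodic chains induced by an isomorphism of cyclic modules. -/
noncomputable def chainsEquiv (p : ZMod 2) : Z.PChain p ≃ₗ[k] Y.PChain p :=
  LinearEquiv.piCongrRight fun q => Φ.equiv q.1

/-- Commutation with the differentials sends cycles to cycles; injectivity in parity p + 1 gives
that nothing else is sent to a cycle. -/
theorem map_cycles (p : ZMod 2) :
    (Z.PCycles p).map (Φ.chainsEquiv p : Z.PChain p →ₗ[k] Y.PChain p) = Y.PCycles p := by
  ext y
  rw [Submodule.mem_map_equiv, LinearMap.mem_ker, LinearMap.mem_ker]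
  have h := Φ.map_D p (p + 1) rfl ((Φ.chainsEquiv p).symm y)
  have h' : Φ.onChains p ((Φ.chainsEquiv p).symm y) = y := (Φ.chainsEquiv p).apply_symm_apply y
  rw [h'] at h
  rw [← h]
  exact ((Φ.chainsEquiv (p + 1)).map_eq_zero_iff).symm

/-- The linear isomorphism on periodic cycles induced by an isomorphism of cyclic modules. -/
noncomputable def cyclesEquiv (p : ZMod 2) : Z.PCycles p ≃ₗ[k] Y.PCycles p :=
  (Φ.chainsEquiv p).ofSubmodules _ _ (Φ.map_cycles p)

theorem map_boundaries (p : ZMod 2) :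
    ((Z.PBoundaries p).comap (Z.PCycles p).subtype).map
      (Φ.cyclesEquiv p : Z.PCycles p →ₗ[k] Y.PCycles p) =
    (Y.PBoundaries p).comap (Y.PCycles p).subtype := by
  ext y
  obtain ⟨z, rfl⟩ := (Φ.cyclesEquiv p).surjective y
  rw [Submodule.mem_map_equiv, LinearEquiv.symm_apply_apply, Submodule.mem_comap,
    Submodule.mem_comap]
  -- Boundaries of parity p are images of chains of parity p + 1, and in ℤ/2 the differential leads
  -- from there back to p.
  have hp : p = (p + 1) + 1 := by rw [add_assoc, CharTwo.add_self_eq_zero, add_zero]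
  constructor
  · rintro ⟨c, hc⟩
    exact ⟨Φ.onChains (p + 1) c, (Φ.map_D (p + 1) p hp c).symm.trans (congrArg (Φ.onChains p) hc)⟩
  · rintro ⟨c, hc⟩
    -- A chain bounding the image of a cycle is itself an image; injectivity in parity p then brings
    -- the equation back to the source.
    obtain ⟨c, rfl⟩ := (Φ.chainsEquiv (p + 1)).surjective c
    exact ⟨c, (Φ.chainsEquiv p).injective ((Φ.map_D (p + 1) p hp c).trans hc)⟩

/-- The linear isomorphism on periodic cyclic homology induced by an isomorphism of cyclic
modules. -/
noncomputable def hpEquiv (p : ZMod 2) : Z.HP p ≃ₗ[k] Y.HP p :=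
  Submodule.Quotient.equiv _ _ (Φ.cyclesEquiv p) (Φ.map_boundaries p)

/-- This records that the isomorphism on homology is the one induced by the degreewise maps on
representing cycles, as the main theorem asserts. -/
theorem hpEquiv_mk (p : ZMod 2) (z : Z.PCycles p) : ∃ hz : Φ.onChains p z ∈ Y.PCycles p,
    Φ.hpEquiv p (Submodule.Quotient.mk z) = Submodule.Quotient.mk ⟨_, hz⟩ :=
  ⟨(Φ.cyclesEquiv p z).2, rfl⟩

end CyclicModule.Iso

/-- A family of linear isomorphisms between cyclic modules which commutes with the cyclic operators,
the faces `d₀` and the degeneracies `s₀` is an isomorphism of cyclic modules. -/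
def CyclicModule.isoOfZero {Z : CyclicModule.{u, w} k} {Y : CyclicModule.{u, x} k}
    (E : ∀ n, Z.X n ≃ₗ[k] Y.X n) (ht : ∀ n z, E n (Z.t n z) = Y.t n (E n z))
    (hd : ∀ n z, E n (Z.d n 0 z) = Y.d n 0 (E (n + 1) z))
    (hs : ∀ n z, E (n + 1) (Z.s n 0 z) = Y.s n 0 (E n z)) : Z.Iso Y where
  equiv := E
  map_d n i z := by
    induction i using Fin.induction generalizing z with
    | zero => exact hd n z
    | succ i ih =>
      -- Since the power n + 2 of tₙ₊₁ is the identity, its power n + 1 supplies a preimage. Once z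
      -- is a value of t, the identity dᵢ₊₁ t = t dᵢ lowers the index of the face.
      obtain ⟨z, rfl⟩ : ∃ z', Z.t (n + 1) z' = z :=
        ⟨(Z.t (n + 1) ^ (n + 1)) z, by
          rw [← Module.End.mul_apply, ← pow_succ']; exact Z.t_pow (n + 1) z⟩
      rw [Z.d_succ_t, ht, ht, Y.d_succ_t, ih]
  map_s n j z := by
    induction j using Fin.induction generalizing z with
    | zero => exact hs n z
    | succ j ih =>
      -- The same reduction, now through sⱼ₊₁ t = t sⱼ. In degree 0 the only degeneracy is s₀, so
      -- there is nothing to reduce.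
      cases n with
      | zero => exact j.elim0
      | succ n =>
        obtain ⟨z, rfl⟩ : ∃ z', Z.t (n + 1) z' = z :=
          ⟨(Z.t (n + 1) ^ (n + 1)) z, by
            rw [← Module.End.mul_apply, ← pow_succ']; exact Z.t_pow (n + 1) z⟩
        rw [Z.s_succ_t, ht, ht, Y.s_succ_t, ih]
  map_t := ht

end HomologyOfIso

/-! ### The bimodule (C ⊗ ⋯ ⊗ C) ⊗ A, words, and the iterated canonical map. -/

section Words

set_option linter.unusedSectionVars false

variable {k : Type u} [Field k] {H : Type v} [Ring H] [HopfAlgebra k H]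
variable {A : Type w} [Ring A] [Algebra k A] (ρ : ComoduleAlgebra k H A)
variable {C : Type x} [AddCommGroup C] [Module k C] [Coalgebra k C] (μ : ModuleCoalgebra k H C)
variable (e : C)

/-- Left multiplication by `a` on the factor `A` of `(C ⊗ ⋯ ⊗ C) ⊗ A`. -/
noncomputable def leftMul (C : Type x) [AddCommGroup C] [Module k C] (n : ℕ) (a : A) :
    TPow k C n ⊗[k] A →ₗ[k] TPow k C n ⊗[k] A :=
  (LinearMap.mulLeft k a).lTensor (TPow k C n)

theorem leftMul_tmul (n : ℕ) (a : A) (y : TPow k C n) (x : A) :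
    leftMul C n a (y ⊗ₜ x) = y ⊗ₜ (a * x) := rfl

theorem leftMul_leftMul (n : ℕ) (a b : A) (z : TPow k C n ⊗[k] A) :
    leftMul C n a (leftMul C n b z) = leftMul C n (a * b) z := by
  rw [leftMul, leftMul, leftMul, ← LinearMap.lTensor_comp_apply, LinearMap.mulLeft_mul]

theorem leftMul_one (n : ℕ) (z : TPow k C n ⊗[k] A) : leftMul C n (1 : A) z = z := by
  rw [leftMul, LinearMap.mulLeft_one, LinearMap.lTensor_id, LinearMap.id_apply]

/-- `(y ⊗ x, a) ↦ y a₁ ⊗ x a₀`, for the diagonal action on `y`. -/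
noncomputable def rightMul (n : ℕ) : TPow k C n ⊗[k] A →ₗ[k] A →ₗ[k] TPow k C n ⊗[k] A :=
  (TensorProduct.map₂ (diag μ n) (LinearMap.mul k A)).compl₂
    ((TensorProduct.comm k A H).toLinearMap ∘ₗ ρ.coact.toLinearMap)

/-- Splitting off the left multiplication by x leaves an expression that is linear in the coaction
of a. -/
theorem rightMul_tmul (n : ℕ) (y : TPow k C n) (x a : A) : rightMul ρ μ n (y ⊗ₜ x) a =
    leftMul C n x (swapMap (diag μ n y) (ρ.coact a)) := by
  change TensorProduct.map (diag μ n y) (LinearMap.mulLeft k x)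
    (TensorProduct.comm k A H (ρ.coact a)) = _
  -- Both sides are linear in the coaction of a, so it may be replaced by an arbitrary tensor and
  -- then by a pure one. This device takes the place of Sweedler notation throughout.
  generalize ρ.coact a = z
  exact LinearMap.congr_fun
    (f := TensorProduct.map (diag μ n y) (LinearMap.mulLeft k x) ∘ₗ
      (TensorProduct.comm k A H).toLinearMap)
    (g := leftMul C n x ∘ₗ swapMap (diag μ n y)) (TensorProduct.ext' fun _ _ => rfl) z

/-- A normal form parallel to `rightMul_tmul`: the new letter e x₁ depends on x only through its
coaction, and y is a spectator. -/
theorem wordStep_tmul (n : ℕ) (a : A) (y : TPow k C n) (x : A) :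
    wordStep ρ μ e n a (y ⊗ₜ x) =
      leftMul C (n + 1) a (swapMap ((cons n).flip y ∘ₗ μ.act e) (ρ.coact x)) := by
  change (TensorProduct.comm k (TPow k C n) C).toLinearMap.rTensor A
    ((TensorProduct.assoc k (TPow k C n) C A).symm ((TensorProduct.comm k A C).toLinearMap.lTensor
      (TPow k C n) (y ⊗ₜ ((LinearMap.mulLeft k a).rTensor C ((μ.act e).lTensor A (ρ.coact x)))))) = _
  generalize ρ.coact x = z
  exact LinearMap.congr_fun
    (f := (TensorProduct.comm k (TPow k C n) C).toLinearMap.rTensor A ∘ₗ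
      (TensorProduct.assoc k (TPow k C n) C A).symm.toLinearMap ∘ₗ
        (TensorProduct.comm k A C).toLinearMap.lTensor (TPow k C n) ∘ₗ
          TensorProduct.mk k (TPow k C n) (A ⊗[k] C) y ∘ₗ (LinearMap.mulLeft k a).rTensor C ∘ₗ
            (μ.act e).lTensor A)
    (g := leftMul C (n + 1) a ∘ₗ swapMap ((cons n).flip y ∘ₗ μ.act e))
    (TensorProduct.ext' fun _ _ => rfl) z

/-- The argument of a step is the outermost left coefficient of its value, and left multiplication
touches nothing else. -/
theorem leftMul_wordStep (n : ℕ) (a b : A) (z : TPow k C n ⊗[k] A) :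
    leftMul C (n + 1) a (wordStep ρ μ e n b z) = wordStep ρ μ e n (a * b) z := by
  refine LinearMap.congr_fun (f := leftMul C (n + 1) a ∘ₗ wordStep ρ μ e n b)
    (g := wordStep ρ μ e n (a * b)) (TensorProduct.ext' fun y x => ?_) z
  rw [LinearMap.comp_apply, wordStep_tmul, wordStep_tmul, leftMul_leftMul]

/-- The bimodule axiom: one action multiplies x on the left, the other on the right, so
associativity of A makes them commute. -/
theorem rightMul_leftMul (n : ℕ) (a b : A) (z : TPow k C n ⊗[k] A) :
    rightMul ρ μ n (leftMul C n a z) b = leftMul C n a (rightMul ρ μ n z b) := by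
  refine LinearMap.congr_fun (f := (rightMul ρ μ n).flip b ∘ₗ leftMul C n a)
    (g := leftMul C n a ∘ₗ (rightMul ρ μ n).flip b) (TensorProduct.ext' fun y x => ?_) z
  change rightMul ρ μ n (y ⊗ₜ (a * x)) b = leftMul C n a (rightMul ρ μ n (y ⊗ₜ x) b)
  rw [rightMul_tmul, rightMul_tmul, leftMul_leftMul]

theorem diag_one (n : ℕ) (y : TPow k C n) : diag μ n y 1 = y := by
  induction n with
  | zero => exact μ.act_one y
  | succ n ih =>
    refine LinearMap.congr_fun (f := (diag μ (n + 1)).flip 1) (g := LinearMap.id)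
      (hom_ext_cons fun a z => ?_) y
    change diag μ (n + 1) (cons n a z) 1 = cons n a z
    rw [diag_cons, Bialgebra.comul_one]
    change cons n (μ.act a 1) (diag μ n z 1) = cons n a z
    rw [μ.act_one, ih]

/-- Multiplicativity of the comultiplication of H is what makes the diagonal operation an action. -/
theorem diag_mul (n : ℕ) (y : TPow k C n) (g h : H) :
    diag μ n y (g * h) = diag μ n (diag μ n y g) h := by
  induction n generalizing g h with
  | zero => exact μ.act_mul y g h
  | succ n ih =>
    refine LinearMap.congr_fun (f := (diag μ (n + 1)).flip (g * h))
      (g := (diag μ (n + 1)).flip h ∘ₗ (diag μ (n + 1)).flip g) (hom_ext_cons fun a z => ?_) y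
    change TensorProduct.map (μ.act a) (diag μ n z) (Coalgebra.comul (g * h)) =
      actT μ.act (diag μ n) (TensorProduct.map (μ.act a) (diag μ n z) (Coalgebra.comul g)) h
    rw [Bialgebra.comul_mul]
    generalize Coalgebra.comul (R := k) g = s
    induction s using TensorProduct.induction_on with
    | zero => simp
    | add p q hp hq => simp only [add_mul, map_add, LinearMap.add_apply, hp, hq]
    | tmul p q =>
      change _ = TensorProduct.map (μ.act (μ.act a p)) (diag μ n (diag μ n z q))
        (Coalgebra.comul h)
      generalize Coalgebra.comul (R := k) h = t
      refine LinearMap.congr_fun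
        (f := TensorProduct.map (μ.act a) (diag μ n z) ∘ₗ LinearMap.mulLeft k (p ⊗ₜ[k] q))
        (g := TensorProduct.map (μ.act (μ.act a p)) (diag μ n (diag μ n z q)))
        (TensorProduct.ext' fun r s => ?_) t
      rw [LinearMap.comp_apply, LinearMap.mulLeft_apply, Algebra.TensorProduct.tmul_mul_tmul,
        TensorProduct.map_tmul, TensorProduct.map_tmul, μ.act_mul, ih]

theorem rightMul_one (n : ℕ) (z : TPow k C n ⊗[k] A) : rightMul ρ μ n z 1 = z := by
  refine LinearMap.congr_fun (f := (rightMul ρ μ n).flip 1) (g := LinearMap.id)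
    (TensorProduct.ext' fun y x => ?_) z
  change rightMul ρ μ n (y ⊗ₜ x) 1 = y ⊗ₜ x
  rw [rightMul_tmul, map_one]
  change diag μ n y 1 ⊗ₜ[k] (x * 1) = y ⊗ₜ x
  rw [diag_one, mul_one]

/-- The coaction is an algebra map and the diagonal action is an action; together these make
`rightMul` a right action of A. -/
theorem rightMul_mul (n : ℕ) (z : TPow k C n ⊗[k] A) (a b : A) :
    rightMul ρ μ n z (a * b) = rightMul ρ μ n (rightMul ρ μ n z a) b := by
  refine LinearMap.congr_fun (f := (rightMul ρ μ n).flip (a * b))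
    (g := (rightMul ρ μ n).flip b ∘ₗ (rightMul ρ μ n).flip a) (TensorProduct.ext' fun y x => ?_) z
  change rightMul ρ μ n (y ⊗ₜ x) (a * b) = rightMul ρ μ n (rightMul ρ μ n (y ⊗ₜ x) a) b
  rw [rightMul_tmul, rightMul_tmul, rightMul_leftMul, map_mul]
  congr 1
  generalize ρ.coact a = s
  induction s using TensorProduct.induction_on with
  | zero => simp
  | add p q hp hq => simp only [add_mul, map_add, LinearMap.add_apply, hp, hq]
  | tmul u g =>
    rw [swapMap_tmul, rightMul_tmul]
    generalize ρ.coact b = t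
    refine LinearMap.congr_fun
      (f := swapMap (diag μ n y) ∘ₗ LinearMap.mulLeft k (u ⊗ₜ[k] g))
      (g := leftMul C n u ∘ₗ swapMap (diag μ n (diag μ n y g)))
      (TensorProduct.ext' fun r h => ?_) t
    rw [LinearMap.comp_apply, LinearMap.mulLeft_apply, Algebra.TensorProduct.tmul_mul_tmul,
      swapMap_tmul, diag_mul]
    rfl

/-- The central computation. Applied to y a₁ ⊗ x a₀, the step gives (e (x a₀)₁ ⊗ y a₁) ⊗ b (x a₀)₀.
Since the coaction is multiplicative and coassociative, this is (e x₁ a₁ ⊗ y a₂) ⊗ b x₀ a₀, in which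
a acts diagonally on the longer word e x₁ ⊗ y. -/
theorem wordStep_rightMul (n : ℕ) (b a : A) (z : TPow k C n ⊗[k] A) :
    wordStep ρ μ e n b (rightMul ρ μ n z a) = rightMul ρ μ (n + 1) (wordStep ρ μ e n b z) a := by
  refine LinearMap.congr_fun (f := wordStep ρ μ e n b ∘ₗ (rightMul ρ μ n).flip a)
    (g := (rightMul ρ μ (n + 1)).flip a ∘ₗ wordStep ρ μ e n b)
    (TensorProduct.ext' fun y x => ?_) z
  change wordStep ρ μ e n b (rightMul ρ μ n (y ⊗ₜ x) a) =
    rightMul ρ μ (n + 1) (wordStep ρ μ e n b (y ⊗ₜ x)) a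
  rw [rightMul_tmul, wordStep_tmul, rightMul_leftMul]
  -- `(u ⊗ p) ⊗ h ↦ (e p ⊗ y h) ⊗ u`
  let Ω : (A ⊗[k] H) ⊗[k] H →ₗ[k] TPow k C (n + 1) ⊗[k] A :=
    (TensorProduct.comm k A (TPow k C (n + 1))).toLinearMap ∘ₗ
      LinearMap.lTensor A (TensorProduct.map (μ.act e) (diag μ n y)) ∘ₗ
        (TensorProduct.assoc k A H H).toLinearMap
  have hΩ : ∀ (v : A ⊗[k] H) (h : H),
      Ω (v ⊗ₜ h) = swapMap ((cons n).flip (diag μ n y h) ∘ₗ μ.act e) v := fun v h =>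
    LinearMap.congr_fun (f := Ω ∘ₗ (TensorProduct.mk k (A ⊗[k] H) H).flip h)
      (g := swapMap ((cons n).flip (diag μ n y h) ∘ₗ μ.act e)) (TensorProduct.ext' fun _ _ => rfl) v
  -- Multiplicativity: the coaction of x a₀ is the product of the coactions of x and a₀, while a₁
  -- keeps acting on y.
  have h1 : wordStep ρ μ e n b (leftMul C n x (swapMap (diag μ n y) (ρ.coact a))) =
      leftMul C (n + 1) b (Ω ((LinearMap.mulLeft k (ρ.coact x)).rTensor H
        (ρ.coact.toLinearMap.rTensor H (ρ.coact a)))) := by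
    generalize ρ.coact a = t
    refine LinearMap.congr_fun
      (f := wordStep ρ μ e n b ∘ₗ leftMul C n x ∘ₗ swapMap (diag μ n y))
      (g := leftMul C (n + 1) b ∘ₗ Ω ∘ₗ (LinearMap.mulLeft k (ρ.coact x)).rTensor H ∘ₗ
        ρ.coact.toLinearMap.rTensor H) (TensorProduct.ext' fun u h => ?_) t
    change wordStep ρ μ e n b (diag μ n y h ⊗ₜ (x * u)) =
      leftMul C (n + 1) b (Ω ((ρ.coact x * ρ.coact u) ⊗ₜ h))
    rw [wordStep_tmul, hΩ, map_mul]
  -- Coassociativity replaces the coaction of a₀, tensored with a₁, by a₀ ⊗ Δ(a₁), which is what the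
  -- diagonal action on e x₁ ⊗ y consumes.
  rw [h1, coact_coassoc']
  congr 1
  generalize ρ.coact x = s
  induction s using TensorProduct.induction_on with
  | zero => simp
  | add p q hp hq =>
    rw [map_add, map_add, LinearMap.add_apply, ← hp, ← hq, ← map_add, ← LinearMap.add_apply,
      ← LinearMap.rTensor_add]
    congr 4
    exact LinearMap.ext fun z => add_mul p q z
  | tmul u g =>
    rw [swapMap_tmul, rightMul_tmul]
    generalize ρ.coact a = t
    refine LinearMap.congr_fun
      (f := Ω ∘ₗ (LinearMap.mulLeft k (u ⊗ₜ[k] g)).rTensor H ∘ₗ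
        (TensorProduct.assoc k A H H).symm.toLinearMap ∘ₗ
          (Coalgebra.comul (R := k) (A := H)).lTensor A)
      (g := leftMul C (n + 1) u ∘ₗ swapMap (diag μ (n + 1) (cons n (μ.act e g) y)))
      (TensorProduct.ext' fun r h => ?_) t
    change Ω ((LinearMap.mulLeft k (u ⊗ₜ[k] g)).rTensor H ((TensorProduct.assoc k A H H).symm
      (r ⊗ₜ Coalgebra.comul h))) = TensorProduct.map (μ.act (μ.act e g)) (diag μ n y)
        (Coalgebra.comul h) ⊗ₜ (u * r)
    generalize Coalgebra.comul (R := k) h = t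
    refine LinearMap.congr_fun
      (f := Ω ∘ₗ (LinearMap.mulLeft k (u ⊗ₜ[k] g)).rTensor H ∘ₗ
        (TensorProduct.assoc k A H H).symm.toLinearMap ∘ₗ TensorProduct.mk k A (H ⊗[k] H) r)
      (g := (TensorProduct.mk k (TPow k C (n + 1)) A).flip (u * r) ∘ₗ
        TensorProduct.map (μ.act (μ.act e g)) (diag μ n y))
      (TensorProduct.ext' fun p q => ?_) t
    change Ω (((u ⊗ₜ[k] g) * (r ⊗ₜ[k] p)) ⊗ₜ q) =
      (μ.act (μ.act e g) p ⊗ₜ diag μ n y q) ⊗ₜ (u * r)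
    rw [Algebra.TensorProduct.tmul_mul_tmul, ← μ.act_mul]
    rfl

theorem word_succ_cons (n : ℕ) (a : A) (v : TPow k A n) :
    word ρ μ e (n + 1) (cons n a v) = wordStep ρ μ e n a (word ρ μ e n v) := rfl

theorem word_leftMul (n : ℕ) (a : A) (v : TPow k A n) :
    word ρ μ e n (slot (LinearMap.mulLeft k a) n 0 v) = leftMul C n a (word ρ μ e n v) := by
  cases n with
  | zero => rfl
  | succ n =>
    refine LinearMap.congr_fun
      (f := word ρ μ e (n + 1) ∘ₗ slot (LinearMap.mulLeft k a) (n + 1) 0)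
      (g := leftMul C (n + 1) a ∘ₗ word ρ μ e (n + 1)) (hom_ext_cons fun b z => ?_) v
    simp only [LinearMap.comp_apply]
    rw [slot_zero_cons, word_succ_cons, word_succ_cons, leftMul_wordStep, LinearMap.mulLeft_apply]

/-- The map `a⁰ ⊗ ⋯ ⊗ aⁿ⁺¹ ↦ (e a¹₁ ⋯ aⁿ⁺¹₁ ⊗ ⋯ ⊗ e aⁿ⁺¹ₙ₊₁) ⊗ a⁰ a¹₀ ⋯ aⁿ⁺¹₀` from
`A ⊗ ⋯ ⊗ A` (with `n + 2` factors) to `(C ⊗ ⋯ ⊗ C) ⊗ A` (with `n + 1` factors `C`), the iterated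
canonical map. -/
noncomputable def iterCan : ∀ n : ℕ, TPow k A (n + 1) →ₗ[k] TPow k C n ⊗[k] A
  | 0 => (TensorProduct.comm k A C).toLinearMap ∘ₗ canonicalPre ρ μ e
  | n + 1 => TensorProduct.lift ((wordStep ρ μ e n).compl₂ (iterCan n))

theorem iterCan_cons (n : ℕ) (a : A) (u : TPow k A (n + 1)) :
    iterCan ρ μ e (n + 1) (cons (n + 1) a u) = wordStep ρ μ e n a (iterCan ρ μ e n u) := rfl

theorem iterCan_zero (a x : A) :
    iterCan ρ μ e 0 (a ⊗ₜ x) = leftMul C 0 a (swapMap (μ.act e) (ρ.coact x)) := by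
  change TensorProduct.comm k A C ((LinearMap.mulLeft k a).rTensor C
    ((μ.act e).lTensor A (ρ.coact x))) = _
  generalize ρ.coact x = z
  exact LinearMap.congr_fun
    (f := (TensorProduct.comm k A C).toLinearMap ∘ₗ (LinearMap.mulLeft k a).rTensor C ∘ₗ
      (μ.act e).lTensor A)
    (g := leftMul C 0 a ∘ₗ swapMap (μ.act e)) (TensorProduct.ext' fun _ _ => rfl) z

/-- The bridge between the two families of maps. A word ends in e, and the diagonal right action of
a turns this e into the letter that a further tensor factor a contributes to the iterated canonical
map. The induction rests on right linearity of each step. -/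
theorem iterCan_snoc (n : ℕ) (v : TPow k A n) (a : A) :
    iterCan ρ μ e n (snoc n v a) = rightMul ρ μ n (word ρ μ e n v) a := by
  induction n with
  | zero =>
    refine (iterCan_zero ρ μ e v a).trans ?_
    exact (rightMul_tmul ρ μ 0 e v a).symm
  | succ n ih =>
    refine LinearMap.congr_fun
      (f := iterCan ρ μ e (n + 1) ∘ₗ (snoc (n + 1)).flip a)
      (g := (rightMul ρ μ (n + 1)).flip a ∘ₗ word ρ μ e (n + 1)) (hom_ext_cons fun b z => ?_) v
    change iterCan ρ μ e (n + 1) (cons (n + 1) b (snoc n z a)) =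
      rightMul ρ μ (n + 1) (wordStep ρ μ e n b (word ρ μ e n z)) a
    rw [iterCan_cons, ih, wordStep_rightMul]

/-- The unit acts trivially. Hence a word is a value of the bimodule map `iterCan` on a tensor
ending in 1, and facts about `iterCan` transfer to words. -/
theorem iterCan_snoc_one (n : ℕ) (v : TPow k A n) :
    iterCan ρ μ e n (snoc n v 1) = word ρ μ e n v := by
  rw [iterCan_snoc, rightMul_one]

/-- One half of the bimodule linearity of the iterated canonical map; the other half is
`iterCan_slot_last`. -/
theorem iterCan_leftMul (n : ℕ) (a : A) (u : TPow k A (n + 1)) :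
    iterCan ρ μ e n (slot (LinearMap.mulLeft k a) (n + 1) 0 u) =
      leftMul C n a (iterCan ρ μ e n u) := by
  refine LinearMap.congr_fun
    (f := iterCan ρ μ e n ∘ₗ slot (LinearMap.mulLeft k a) (n + 1) 0)
    (g := leftMul C n a ∘ₗ iterCan ρ μ e n) (hom_ext_cons fun b z => ?_) u
  simp only [LinearMap.comp_apply]
  rw [slot_zero_cons, LinearMap.mulLeft_apply]
  cases n with
  | zero =>
    refine (iterCan_zero ρ μ e (a * b) z).trans ?_
    exact (leftMul_leftMul 0 a b _).symm.trans
      (congrArg (leftMul C 0 a) (iterCan_zero ρ μ e b z).symm)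
  | succ n => rw [iterCan_cons, iterCan_cons, leftMul_wordStep]

/-- By `iterCan_snoc` the last factor enters through the right action, so associativity of that
action gives right linearity. -/
theorem iterCan_slot_last (n : ℕ) (a : A) (u : TPow k A (n + 1)) :
    iterCan ρ μ e n (slot (LinearMap.mulRight k a) (n + 1) (Fin.last _) u) =
      rightMul ρ μ n (iterCan ρ μ e n u) a := by
  refine LinearMap.congr_fun
    (f := iterCan ρ μ e n ∘ₗ slot (LinearMap.mulRight k a) (n + 1) (Fin.last _))
    (g := (rightMul ρ μ n).flip a ∘ₗ iterCan ρ μ e n) (hom_ext_snoc fun v b => ?_) u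
  simp only [LinearMap.comp_apply, LinearMap.flip_apply]
  rw [slot_last_snoc, iterCan_snoc, iterCan_snoc, LinearMap.mulRight_apply, rightMul_mul]

/-- `y ⊗ x ↦ (y ⊗ e) ⊗ x`. -/
noncomputable def snocE (A : Type w) [Ring A] [Algebra k A] (n : ℕ) :
    TPow k C n ⊗[k] A →ₗ[k] TPow k C (n + 1) ⊗[k] A :=
  ((snoc n).flip e).rTensor A

/-- Prepending and appending letters do not interact, so the final e can be carried through the
recursion. -/
theorem wordStep_snocE (n : ℕ) (a : A) (z : TPow k C n ⊗[k] A) :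
    wordStep ρ μ e (n + 1) a (snocE e A n z) = snocE e A (n + 1) (wordStep ρ μ e n a z) := by
  refine LinearMap.congr_fun (f := wordStep ρ μ e (n + 1) a ∘ₗ snocE e A n)
    (g := snocE e A (n + 1) ∘ₗ wordStep ρ μ e n a) (TensorProduct.ext' fun y x => ?_) z
  change wordStep ρ μ e (n + 1) a (snoc n y e ⊗ₜ x) =
    snocE e A (n + 1) (wordStep ρ μ e n a (y ⊗ₜ x))
  rw [wordStep_tmul, wordStep_tmul]
  generalize ρ.coact x = t
  exact LinearMap.congr_fun
    (f := leftMul C (n + 2) a ∘ₗ swapMap ((cons (n + 1)).flip (snoc n y e) ∘ₗ μ.act e))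
    (g := snocE e A (n + 1) ∘ₗ leftMul C (n + 1) a ∘ₗ swapMap ((cons n).flip y ∘ₗ μ.act e))
    (TensorProduct.ext' fun _ _ => rfl) t

/-- The recursion starts from e and only prepends letters, so every word ends in e and the iterated
canonical map accounts for the letters before it. This isolates the letter that the cyclic operator
moves. -/
theorem word_succ (n : ℕ) (u : TPow k A (n + 1)) :
    word ρ μ e (n + 1) u = snocE e A n (iterCan ρ μ e n u) := by
  induction n with
  | zero =>
    refine LinearMap.congr_fun (f := word ρ μ e 1) (g := snocE e A 0 ∘ₗ iterCan ρ μ e 0)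
      (hom_ext_cons fun a v => ?_) u
    refine (wordStep_tmul ρ μ e 0 a e v).trans
      (Eq.trans ?_ (congrArg (snocE e A 0) (iterCan_zero ρ μ e a v).symm))
    generalize ρ.coact (show A from v) = t
    exact LinearMap.congr_fun
      (f := leftMul C 1 a ∘ₗ swapMap ((cons 0).flip e ∘ₗ μ.act e))
      (g := snocE e A 0 ∘ₗ leftMul C 0 a ∘ₗ swapMap (μ.act e))
      (TensorProduct.ext' fun _ _ => rfl) t
  | succ n ih =>
    refine LinearMap.congr_fun (f := word ρ μ e (n + 2))
      (g := snocE e A (n + 1) ∘ₗ iterCan ρ μ e (n + 1)) (hom_ext_cons fun a v => ?_) u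
    rw [LinearMap.comp_apply, word_succ_cons, iterCan_cons, ← wordStep_snocE, ih]

end Words

/-! ### The Hopf-cyclic module as a commutator quotient. -/

section ClassMap

set_option linter.unusedSectionVars false

variable {k : Type u} [Field k] {H : Type v} [Ring H] [HopfAlgebra k H]
variable {A : Type w} [Ring A] [Algebra k A] (ρ : ComoduleAlgebra k H A)
variable {C : Type x} [AddCommGroup C] [Module k C] [Coalgebra k C] (μ : ModuleCoalgebra k H C)
variable (e : C)

/-- The class of `y ⊗ [1 ⊗ a]` in the Hopf-cyclic module. -/
noncomputable def hopfClass (n : ℕ) :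
    TPow k C n ⊗[k] A →ₗ[k] (hopfCyclic μ (canonicalSAYD ρ)).X n :=
  hopfMk μ (canonicalSAYD ρ) n ∘ₗ (saydOne ρ).lTensor (TPow k C n)

theorem hopfMk_diag (n : ℕ) (y : TPow k C n) (h : H) (m : SAYDSpace ρ) :
    hopfMk μ (canonicalSAYD ρ) n (diag μ n y h ⊗ₜ m) =
      hopfMk μ (canonicalSAYD ρ) n (y ⊗ₜ saydAct ρ h m) :=
  (Submodule.Quotient.eq _).mpr (hopfRel_mem μ (canonicalSAYD ρ) y h m)

/-- Moving a₁ across the tensor sign over H turns y a₁ ⊗ [1 ⊗ x a₀] into y ⊗ [a₁ ⊗ x a₀], and the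
defining relation of M rewrites this as y ⊗ [1 ⊗ a x]. Commutators with A therefore vanish in the
Hopf-cyclic module. -/
theorem hopfClass_rightMul (n : ℕ) (z : TPow k C n ⊗[k] A) (a : A) :
    hopfClass ρ μ n (rightMul ρ μ n z a) = hopfClass ρ μ n (leftMul C n a z) := by
  refine LinearMap.congr_fun (f := hopfClass ρ μ n ∘ₗ (rightMul ρ μ n).flip a)
    (g := hopfClass ρ μ n ∘ₗ leftMul C n a) (TensorProduct.ext' fun y x => ?_) z
  change hopfClass ρ μ n (rightMul ρ μ n (y ⊗ₜ x) a) =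
    hopfMk μ (canonicalSAYD ρ) n (y ⊗ₜ saydOne ρ (a * x))
  rw [rightMul_tmul, ← saydRel_eq]
  generalize ρ.coact a = t
  refine LinearMap.congr_fun
    (f := hopfClass ρ μ n ∘ₗ leftMul C n x ∘ₗ swapMap (diag μ n y))
    (g := hopfMk μ (canonicalSAYD ρ) n ∘ₗ TensorProduct.mk k (TPow k C n) (SAYDSpace ρ) y ∘ₗ
      TensorProduct.lift (saydAct ρ).flip ∘ₗ (saydOne ρ ∘ₗ LinearMap.mulLeft k x).rTensor H)
    (TensorProduct.ext' fun u h => ?_) t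
  exact hopfMk_diag ρ μ n y h (saydOne ρ (x * u))

/-- The factor H of M is absorbed by C ⊗ ⋯ ⊗ C: the class of y ⊗ [h ⊗ a] is that of y h ⊗ [1 ⊗ a].
-/
theorem hopfClass_surjective (n : ℕ) : Function.Surjective (hopfClass ρ μ n) := by
  rw [← LinearMap.range_eq_top, eq_top_iff]
  rintro z -
  obtain ⟨z, rfl⟩ := (hopfRel μ (canonicalSAYD ρ) n).mkQ_surjective z
  induction z using TensorProduct.induction_on with
  | zero => rw [map_zero]; exact zero_mem _
  | add p q hp hq => rw [map_add]; exact add_mem hp hq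
  | tmul y m =>
    obtain ⟨t, rfl⟩ := (saydRel ρ).mkQ_surjective m
    induction t using TensorProduct.induction_on with
    | zero => rw [map_zero, TensorProduct.tmul_zero, map_zero]; exact zero_mem _
    | add p q hp hq => rw [map_add, TensorProduct.tmul_add, map_add]; exact add_mem hp hq
    | tmul h a =>
      refine ⟨diag μ n y h ⊗ₜ a, (hopfMk_diag ρ μ n y h (saydOne ρ a)).trans ?_⟩
      rw [saydAct_one]; rfl

/-- A linear map on `(C ⊗ ⋯ ⊗ C) ⊗ A` which identifies `y a₁ ⊗ x a₀` with `y ⊗ a x` factors through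
the Hopf-cyclic module. -/
theorem exists_hopfClass_lift {X : Type y} [AddCommGroup X] [Module k X] (n : ℕ)
    (F : TPow k C n ⊗[k] A →ₗ[k] X)
    (hF : ∀ z a, F (rightMul ρ μ n z a) = F (leftMul C n a z)) :
    ∃ G : (hopfCyclic μ (canonicalSAYD ρ)).X n →ₗ[k] X, ∀ z, G (hopfClass ρ μ n z) = F z := by
  -- The value is forced: y ⊗ [h ⊗ a] has the same class as y h ⊗ [1 ⊗ a].
  let F₁ : TPow k C n →ₗ[k] H ⊗[k] A →ₗ[k] X :=
    (TensorProduct.uncurry (.id k) H A X) ∘ₗ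
      LinearMap.llcomp k H (TPow k C n) (A →ₗ[k] X) (TensorProduct.curry F) ∘ₗ diag μ n
  have hF₁ : ∀ y h a, F₁ y (h ⊗ₜ a) = F (diag μ n y h ⊗ₜ a) := fun y h a => rfl
  have hk : saydRel ρ ≤ LinearMap.ker F₁.flip := by
    refine Submodule.span_le.mpr ?_
    rintro _ ⟨h, a, a', rfl⟩
    rw [SetLike.mem_coe, LinearMap.mem_ker, map_sub, sub_eq_zero]
    refine LinearMap.ext fun y => ?_
    -- The relation of M with coefficient h, placed next to y, is the commutator of a' with y h ⊗ a.
    have h1 := hF (diag μ n y h ⊗ₜ a) a'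
    rw [rightMul_tmul] at h1
    refine Eq.trans ?_ h1
    change F₁ y _ = _
    generalize ρ.coact a' = t
    refine LinearMap.congr_fun
      (f := F₁ y ∘ₗ TensorProduct.map (LinearMap.mulLeft k h) (LinearMap.mulLeft k a) ∘ₗ
        (TensorProduct.comm k A H).toLinearMap)
      (g := F ∘ₗ leftMul C n a ∘ₗ swapMap (diag μ n (diag μ n y h)))
      (TensorProduct.ext' fun u g => ?_) t
    change F (diag μ n y (h * g) ⊗ₜ (a * u)) = F (diag μ n (diag μ n y h) g ⊗ₜ (a * u))
    rw [diag_mul]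
  let F₂ : TPow k C n ⊗[k] SAYDSpace ρ →ₗ[k] X :=
    TensorProduct.lift ((saydRel ρ).liftQ F₁.flip hk).flip
  have hF₂ : ∀ y h a, F₂ (y ⊗ₜ saydMk ρ (h ⊗ₜ a)) = F (diag μ n y h ⊗ₜ a) := fun y h a => rfl
  -- Balancing over H is automatic because C ⊗ ⋯ ⊗ C is an H-module: both sides evaluate F at (y h)
  -- g ⊗ a.
  have hk₂ : hopfRel μ (canonicalSAYD ρ) n ≤ LinearMap.ker F₂ := by
    refine Submodule.span_le.mpr ?_
    rintro _ ⟨y, h, m, rfl⟩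
    rw [SetLike.mem_coe, LinearMap.mem_ker, map_sub, sub_eq_zero]
    refine LinearMap.congr_fun
      (f := F₂ ∘ₗ TensorProduct.mk k (TPow k C n) (SAYDSpace ρ) (diag μ n y h))
      (g := F₂ ∘ₗ TensorProduct.mk k (TPow k C n) (SAYDSpace ρ) y ∘ₗ saydAct ρ h)
      (sayd_ext ρ fun g a => ?_) m
    rw [saydAct_one]
    change F₂ (diag μ n y h ⊗ₜ saydMk ρ (g ⊗ₜ a)) = F₂ (y ⊗ₜ saydMk ρ ((h * g) ⊗ₜ a))
    rw [hF₂, hF₂, diag_mul]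
  refine ⟨(hopfRel μ (canonicalSAYD ρ) n).liftQ F₂ hk₂, fun z => ?_⟩
  refine LinearMap.congr_fun (f := F₂ ∘ₗ (saydOne ρ).lTensor (TPow k C n)) (g := F)
    (TensorProduct.ext' fun y a => ?_) z
  -- The class [1 ⊗ a] has the unit as its H-component, and the unit acts trivially on y.
  refine (hF₂ y 1 a).trans ?_
  rw [diag_one]

end ClassMap

/-! ### Words and the operators t, d₀ and s₀. -/

section CyclicStructure

set_option linter.unusedSectionVars false

variable {k : Type u} [Field k] {H : Type v} [Ring H] [HopfAlgebra k H]
variable {A : Type w} [Ring A] [Algebra k A] (ρ : ComoduleAlgebra k H A)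
variable {C : Type x} [AddCommGroup C] [Module k C] [Coalgebra k C] (μ : ModuleCoalgebra k H C)
variable (e : C)

/-- The coaction of M sends [1 ⊗ x] to [1 ⊗ x₀] ⊗ x₁, so the cyclic operator changes a final e into
the leading letter e x₁. That is a step of the word with coefficient 1. -/
theorem twist_snocE (n : ℕ) (z : TPow k C n ⊗[k] A) :
    twist μ (canonicalSAYD ρ) (n + 1) ((saydOne ρ).lTensor _ (snocE e A n z)) =
      (saydOne ρ).lTensor _ (wordStep ρ μ e n 1 z) := by
  refine LinearMap.congr_fun
    (f := twist μ (canonicalSAYD ρ) (n + 1) ∘ₗ (saydOne ρ).lTensor _ ∘ₗ snocE e A n)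
    (g := (saydOne ρ).lTensor _ ∘ₗ wordStep ρ μ e n 1) (TensorProduct.ext' fun y x => ?_) z
  change twist μ (canonicalSAYD ρ) (n + 1) (snoc n y e ⊗ₜ saydOne ρ x) =
    (saydOne ρ).lTensor _ (wordStep ρ μ e n 1 (y ⊗ₜ x))
  rw [twist_tmul, wordStep_tmul, leftMul_one]
  change swapMap _ (saydCoact ρ (saydOne ρ x)) = _
  rw [saydCoact_one]
  generalize ρ.coact x = t
  refine LinearMap.congr_fun
    (f := swapMap (rotAct μ (n + 1) (snoc n y e)) ∘ₗ (saydOne ρ).rTensor H)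
    (g := (saydOne ρ).lTensor _ ∘ₗ swapMap ((cons n).flip y ∘ₗ μ.act e))
    (TensorProduct.ext' fun u h => ?_) t
  change rotAct μ (n + 1) (snoc n y e) h ⊗ₜ saydOne ρ u = cons n (μ.act e h) y ⊗ₜ saydOne ρ u
  rw [rotAct_snoc]

/-- For v ⊗ a the word is (word of v) · a followed by e. Rotating e gives the step with coefficient
1 on (word of v) · a. By right linearity a comes out on the right, by the commutator relation it
crosses to the left, and there it becomes the coefficient of the step: the result is the word of a ⊗
v. -/
theorem hopfClass_word_rot (n : ℕ) (u : TPow k A n) :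
    hopfClass ρ μ n (word ρ μ e n (rot k A n u)) =
      (hopfCyclic μ (canonicalSAYD ρ)).t n (hopfClass ρ μ n (word ρ μ e n u)) := by
  cases n with
  | zero =>
    -- In degree 0 the rotation is the identity, and the cyclic identity with exponent 1 says the
    -- same of t₀.
    have h := (hopfCyclic μ (canonicalSAYD ρ)).t_pow 0 (hopfClass ρ μ 0 (word ρ μ e 0 u))
    rw [zero_add, pow_one] at h
    exact h.symm
  | succ n =>
    refine LinearMap.congr_fun
      (f := hopfClass ρ μ (n + 1) ∘ₗ word ρ μ e (n + 1) ∘ₗ rot k A (n + 1))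
      (g := (hopfCyclic μ (canonicalSAYD ρ)).t (n + 1) ∘ₗ hopfClass ρ μ (n + 1) ∘ₗ
        word ρ μ e (n + 1)) (hom_ext_snoc fun v a => ?_) u
    simp only [LinearMap.comp_apply]
    rw [rot_snoc, word_succ_cons, word_succ, iterCan_snoc]
    have h := congrArg (hopfMk μ (canonicalSAYD ρ) (n + 1))
      (twist_snocE ρ μ e n (rightMul ρ μ n (word ρ μ e n v) a))
    refine Eq.trans ?_ h.symm
    change _ = hopfClass ρ μ (n + 1) (wordStep ρ μ e n 1 (rightMul ρ μ n (word ρ μ e n v) a))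
    rw [wordStep_rightMul, hopfClass_rightMul, leftMul_wordStep, mul_one]

/-- Since ε(e) = 1, the counit of the letter e x₁ is ε(x₁), and counitality of the coaction gives
back x. -/
theorem dropAt_zero_wordStep (he : IsGroupLikeElem k e) (n : ℕ) (a : A) (z : TPow k C n ⊗[k] A) :
    (dropAt Coalgebra.counit n 0).rTensor A (wordStep ρ μ e n a z) = leftMul C n a z := by
  refine LinearMap.congr_fun
    (f := (dropAt Coalgebra.counit n 0).rTensor A ∘ₗ wordStep ρ μ e n a)
    (g := leftMul C n a) (TensorProduct.ext' fun y x => ?_) z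
  rw [LinearMap.comp_apply, wordStep_tmul, leftMul_tmul]
  conv_rhs => rw [← ρ.counit x]
  generalize ρ.coact x = t
  refine LinearMap.congr_fun
    (f := (dropAt Coalgebra.counit n 0).rTensor A ∘ₗ leftMul C (n + 1) a ∘ₗ
      swapMap ((cons n).flip y ∘ₗ μ.act e))
    (g := TensorProduct.mk k (TPow k C n) A y ∘ₗ LinearMap.mulLeft k a ∘ₗ
      (TensorProduct.rid k A).toLinearMap ∘ₗ (Coalgebra.counit (R := k) (A := H)).lTensor A)
    (TensorProduct.ext' fun u h => ?_) t
  change dropAt Coalgebra.counit n 0 (cons n (μ.act e h) y) ⊗ₜ[k] (a * u) =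
    y ⊗ₜ[k] (a * (Coalgebra.counit (R := k) h • u))
  rw [dropAt_zero_cons, μ.counit_act, he.counit_eq_one, one_mul, TensorProduct.smul_tmul,
    mul_smul_comm]

/-- Deleting the first letter of the word and merging the first two factors both produce a⁰ times
the word of the remaining factors. -/
theorem word_mergeAt_zero (he : IsGroupLikeElem k e) (n : ℕ) (u : TPow k A (n + 1)) :
    word ρ μ e n (mergeAt (LinearMap.mul' k A) n 0 u) =
      (dropAt Coalgebra.counit n 0).rTensor A (word ρ μ e (n + 1) u) := by
  refine LinearMap.congr_fun
    (f := word ρ μ e n ∘ₗ mergeAt (LinearMap.mul' k A) n 0)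
    (g := (dropAt Coalgebra.counit n 0).rTensor A ∘ₗ word ρ μ e (n + 1))
    (hom_ext_cons fun a v => ?_) u
  simp only [LinearMap.comp_apply]
  rw [word_succ_cons, dropAt_zero_wordStep ρ μ e he, ← word_leftMul]
  congr 1
  cases n with
  | zero => rfl
  | succ n =>
    exact LinearMap.congr_fun
      (f := mergeAt (LinearMap.mul' k A) (n + 1) 0 ∘ₗ cons (n + 1) a)
      (g := slot (LinearMap.mulLeft k a) (n + 1) 0) (hom_ext_cons fun _ _ => rfl) v

/-- As e is group-like, Δ(e x₁) = e x₁ ⊗ e x₂. By coassociativity these are the letters of two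
successive steps, the inner one having as coefficient the 1 that the degeneracy inserts. -/
theorem splitAt_zero_wordStep (he : IsGroupLikeElem k e) (n : ℕ) (a : A)
    (z : TPow k C n ⊗[k] A) :
    (splitAt Coalgebra.comul (n + 1) 0).rTensor A (wordStep ρ μ e n a z) =
      wordStep ρ μ e (n + 1) a (wordStep ρ μ e n 1 z) := by
  refine LinearMap.congr_fun
    (f := (splitAt Coalgebra.comul (n + 1) 0).rTensor A ∘ₗ wordStep ρ μ e n a)
    (g := wordStep ρ μ e (n + 1) a ∘ₗ wordStep ρ μ e n 1) (TensorProduct.ext' fun y x => ?_) z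
  simp only [LinearMap.comp_apply]
  rw [wordStep_tmul, wordStep_tmul, leftMul_one]
  -- `(u ⊗ g) ⊗ h ↦ (e g ⊗ e h ⊗ y) ⊗ a u`
  let Ω : (A ⊗[k] H) ⊗[k] H →ₗ[k] TPow k C (n + 2) ⊗[k] A :=
    leftMul C (n + 2) a ∘ₗ (TensorProduct.comm k A (TPow k C (n + 2))).toLinearMap ∘ₗ
      LinearMap.lTensor A ((cons2 n).flip y ∘ₗ TensorProduct.map (μ.act e) (μ.act e)) ∘ₗ
        (TensorProduct.assoc k A H H).toLinearMap
  -- The intermediate term applies the coaction twice. Coassociativity and Δ(e) = e ⊗ e match it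
  -- with the degeneracy; unfolding two steps matches it with the right side.
  trans Ω (ρ.coact.toLinearMap.rTensor H (ρ.coact x))
  · rw [coact_coassoc']
    generalize ρ.coact x = t
    refine LinearMap.congr_fun
      (f := (splitAt Coalgebra.comul (n + 1) 0).rTensor A ∘ₗ leftMul C (n + 1) a ∘ₗ
        swapMap ((cons n).flip y ∘ₗ μ.act e))
      (g := Ω ∘ₗ (TensorProduct.assoc k A H H).symm.toLinearMap ∘ₗ
        (Coalgebra.comul (R := k) (A := H)).lTensor A) (TensorProduct.ext' fun u h => ?_) t
    change splitAt Coalgebra.comul (n + 1) 0 (cons n (μ.act e h) y) ⊗ₜ[k] (a * u) =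
      Ω ((TensorProduct.assoc k A H H).symm (u ⊗ₜ Coalgebra.comul h))
    rw [splitAt_zero_cons, μ.comul_act, he.comul_eq_tmul_self]
    generalize Coalgebra.comul (R := k) h = t
    exact LinearMap.congr_fun
      (f := (TensorProduct.mk k (TPow k C (n + 2)) A).flip (a * u) ∘ₗ (cons2 n).flip y ∘ₗ
        TensorProduct.map (μ.act e) (μ.act e))
      (g := Ω ∘ₗ (TensorProduct.assoc k A H H).symm.toLinearMap ∘ₗ
        TensorProduct.mk k A (H ⊗[k] H) u) (TensorProduct.ext' fun _ _ => rfl) t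
  · generalize ρ.coact x = t
    refine LinearMap.congr_fun
      (f := Ω ∘ₗ ρ.coact.toLinearMap.rTensor H)
      (g := wordStep ρ μ e (n + 1) a ∘ₗ swapMap ((cons n).flip y ∘ₗ μ.act e))
      (TensorProduct.ext' fun u h => ?_) t
    change Ω (ρ.coact u ⊗ₜ h) = wordStep ρ μ e (n + 1) a (cons n (μ.act e h) y ⊗ₜ u)
    rw [wordStep_tmul]
    generalize ρ.coact u = t
    exact LinearMap.congr_fun
      (f := Ω ∘ₗ (TensorProduct.mk k (A ⊗[k] H) H).flip h)
      (g := leftMul C (n + 2) a ∘ₗ swapMap ((cons (n + 1)).flip (cons n (μ.act e h) y) ∘ₗ μ.act e))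
      (TensorProduct.ext' fun _ _ => rfl) t

theorem word_splitAt_zero (he : IsGroupLikeElem k e) (n : ℕ) (u : TPow k A n) :
    word ρ μ e (n + 1) (splitAt (insertRight (1 : A)) n 0 u) =
      (splitAt Coalgebra.comul n 0).rTensor A (word ρ μ e n u) := by
  cases n with
  | zero =>
    -- In degree 0 the single letter is e itself, and the claim reduces to Δ(e) = e ⊗ e.
    refine (word_succ ρ μ e 0 (snoc 0 u (1 : A))).trans ?_
    rw [iterCan_snoc_one]
    change (e ⊗ₜ[k] e) ⊗ₜ[k] (show A from u) = (Coalgebra.comul (R := k) e) ⊗ₜ[k] (show A from u)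
    rw [he.comul_eq_tmul_self]
  | succ n =>
    refine LinearMap.congr_fun
      (f := word ρ μ e (n + 2) ∘ₗ splitAt (insertRight (1 : A)) (n + 1) 0)
      (g := (splitAt Coalgebra.comul (n + 1) 0).rTensor A ∘ₗ word ρ μ e (n + 1))
      (hom_ext_cons fun a v => ?_) u
    simp only [LinearMap.comp_apply]
    rw [splitAt_insert_zero_cons, word_succ_cons, word_succ_cons, word_succ_cons,
      splitAt_zero_wordStep ρ μ e he]

/-- Operators on the factors C commute with a ↦ [1 ⊗ a], which concerns the other factor. Faces and
degeneracies can thus be compared before passing to M. -/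
theorem hopfClass_rTensor (n m : ℕ) (f : TPow k C n →ₗ[k] TPow k C m) (z : TPow k C n ⊗[k] A) :
    hopfClass ρ μ m (f.rTensor A z) = hopfMk μ (canonicalSAYD ρ) m
      (f.rTensor (SAYDSpace ρ) ((saydOne ρ).lTensor (TPow k C n) z)) := by
  rw [hopfClass, LinearMap.comp_apply, ← LinearMap.comp_apply (f.rTensor _),
    LinearMap.rTensor_comp_lTensor, ← LinearMap.comp_apply (LinearMap.lTensor _ _),
    LinearMap.lTensor_comp_rTensor]

theorem hopfClass_dropAt (n : ℕ) (i : Fin (n + 2)) (z : TPow k C (n + 1) ⊗[k] A) :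
    hopfClass ρ μ n ((dropAt Coalgebra.counit n i).rTensor A z) =
      (hopfCyclic μ (canonicalSAYD ρ)).d n i (hopfClass ρ μ (n + 1) z) :=
  hopfClass_rTensor ρ μ (n + 1) n _ z

theorem hopfClass_splitAt (n : ℕ) (j : Fin (n + 1)) (z : TPow k C n ⊗[k] A) :
    hopfClass ρ μ (n + 1) ((splitAt Coalgebra.comul n j).rTensor A z) =
      (hopfCyclic μ (canonicalSAYD ρ)).s n j (hopfClass ρ μ n z) :=
  hopfClass_rTensor ρ μ n (n + 1) _ z

end CyclicStructure

/-! ### Relations of the tensor powers over B, and closing up by the last face. -/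

section LinearRelations

variable {k : Type u} [Field k] {A : Type w} [Ring A] [Algebra k A] (B : Subalgebra k A)

/-- The kernel of the projection of `A ⊗ ⋯ ⊗ A` (`n + 1` factors) to the tensor power over `B`: the
span of the elements `⋯ ⊗ aᵢ b ⊗ aᵢ₊₁ ⊗ ⋯ - ⋯ ⊗ aᵢ ⊗ b aᵢ₊₁ ⊗ ⋯` with `b ∈ B` and `i < n`. -/
noncomputable def linearRel (n : ℕ) : Submodule k (TPow k A n) :=
  Submodule.span k {z | ∃ (i : Fin n) (b : A) (_ : b ∈ B) (x : TPow k A n),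
    z = slot (LinearMap.mulRight k b) n i.castSucc x - slot (LinearMap.mulLeft k b) n i.succ x}

theorem linearRel_mem {n : ℕ} (i : Fin n) {b : A} (hb : b ∈ B) (x : TPow k A n) :
    slot (LinearMap.mulRight k b) n i.castSucc x - slot (LinearMap.mulLeft k b) n i.succ x ∈
      linearRel B n := Submodule.subset_span ⟨i, b, hb, x, rfl⟩

theorem linearRel_le {n : ℕ} {P : Submodule k (TPow k A n)}
    (h : ∀ (i : Fin n) (b : A) (_ : b ∈ B) (x : TPow k A n),
      slot (LinearMap.mulRight k b) n i.castSucc x -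
        slot (LinearMap.mulLeft k b) n i.succ x ∈ P) :
    linearRel B n ≤ P := by
  refine Submodule.span_le.mpr ?_
  rintro _ ⟨i, b, hb, x, rfl⟩
  exact h i b hb x

/-- The linear relations are the cyclic ones that do not wrap around: for i < n the cyclic successor
is the ordinary one. -/
theorem linearRel_le_cyclicRel (n : ℕ) : linearRel B n ≤ cyclicRel B n :=
  linearRel_le B fun i b hb x => by
    have h := cyclicRel_mem B i.castSucc hb x
    rwa [Fin.coeSucc_eq_succ] at h

theorem cons_mem_linearRel (n : ℕ) (a : A) :
    linearRel B n ≤ (linearRel B (n + 1)).comap (cons n a) :=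
  linearRel_le B fun i b hb x => by
    rw [Submodule.mem_comap, map_sub, ← slot_succ_cons, ← slot_succ_cons, Fin.succ_castSucc]
    exact linearRel_mem B i.succ hb _

/-- The relation at the first position, in the form that moves an element of B from a prepended
factor into the tail. -/
theorem cons_mul_sub_mem (n : ℕ) (a : A) {b : A} (hb : b ∈ B) (v : TPow k A n) :
    cons n (a * b) v - cons n a (slot (LinearMap.mulLeft k b) n 0 v) ∈ linearRel B (n + 1) :=
  linearRel_mem B 0 hb (cons n a v)

/-- The last face closes a linear tensor into a cyclic one: the appended factor wraps around and
multiplies the first factor on the left. With an appended 1 it returns the original tensor. -/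
theorem algFace_last_snoc (n : ℕ) (v : TPow k A n) (a : A) :
    algFace k A n (Fin.last _) (snoc n v a) = slot (LinearMap.mulLeft k a) n 0 v := by
  rw [algFace_last, rot_snoc]
  cases n with
  | zero => rfl
  | succ n =>
    exact LinearMap.congr_fun
      (f := mergeAt (LinearMap.mul' k A) (n + 1) 0 ∘ₗ cons (n + 1) a)
      (g := slot (LinearMap.mulLeft k a) (n + 1) 0) (hom_ext_cons fun _ _ => rfl) v

theorem slot_slot_mulLeft (n : ℕ) (a b : A) (v : TPow k A n) :
    slot (LinearMap.mulLeft k a) n 0 (slot (LinearMap.mulLeft k b) n 0 v) =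
      slot (LinearMap.mulLeft k (a * b)) n 0 v := by
  cases n with
  | zero => exact (mul_assoc a b v).symm
  | succ n =>
    refine LinearMap.congr_fun
      (f := slot (LinearMap.mulLeft k a) (n + 1) 0 ∘ₗ slot (LinearMap.mulLeft k b) (n + 1) 0)
      (g := slot (LinearMap.mulLeft k (a * b)) (n + 1) 0) (hom_ext_cons fun x y => ?_) v
    exact congrArg (fun c => cons n c y) (mul_assoc a b x).symm

theorem slot_mulLeft_one (n : ℕ) (v : TPow k A n) :
    slot (LinearMap.mulLeft k (1 : A)) n 0 v = v := by
  cases n with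
  | zero => exact one_mul (show A from v)
  | succ n =>
    refine LinearMap.congr_fun (f := slot (LinearMap.mulLeft k (1 : A)) (n + 1) 0)
      (g := LinearMap.id) (hom_ext_cons fun x y => ?_) v
    exact congrArg (fun c => cons n c y) (one_mul x)

theorem slot_zero_snoc_mulLeft (n : ℕ) (a b : A) (v : TPow k A n) :
    slot (LinearMap.mulLeft k a) (n + 1) 0 (snoc n v b) =
      snoc n (slot (LinearMap.mulLeft k a) n 0 v) b :=
  slot_castSucc_snoc _ n 0 v b

/-- The last face multiplies `a u` and `u a` to the same element. -/
theorem algFace_last_slot (n : ℕ) (a : A) (u : TPow k A (n + 1)) :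
    algFace k A n (Fin.last _) (slot (LinearMap.mulRight k a) (n + 1) (Fin.last _) u) =
      algFace k A n (Fin.last _) (slot (LinearMap.mulLeft k a) (n + 1) 0 u) := by
  refine LinearMap.congr_fun
    (f := algFace k A n (Fin.last _) ∘ₗ slot (LinearMap.mulRight k a) (n + 1) (Fin.last _))
    (g := algFace k A n (Fin.last _) ∘ₗ slot (LinearMap.mulLeft k a) (n + 1) 0)
    (hom_ext_snoc fun v b => ?_) u
  simp only [LinearMap.comp_apply]
  rw [slot_last_snoc, slot_zero_snoc_mulLeft, algFace_last_snoc, algFace_last_snoc,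
    slot_slot_mulLeft, LinearMap.mulRight_apply]

theorem relativeMk_surjective (n : ℕ) : Function.Surjective (relativeMk B n) :=
  (cyclicRel B n).mkQ_surjective

end LinearRelations

/-! ### The comparison map and its inverse. -/

section Comparison

set_option linter.unusedSectionVars false

variable {k : Type u} [Field k] {H : Type v} [Ring H] [HopfAlgebra k H]
variable {A : Type w} [Ring A] [Algebra k A] (ρ : ComoduleAlgebra k H A)
variable {C : Type x} [AddCommGroup C] [Module k C] [Coalgebra k C] (μ : ModuleCoalgebra k H C)
variable (e : C)

/-- Coinvariance lets b pass through the induced coaction without contributing to the letter in C,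
so it may be multiplied in before or after the step. -/
theorem wordStep_mul_coinvariant (n : ℕ) (a : A) {b : A} (hb : b ∈ coinvariants ρ μ e)
    (z : TPow k C n ⊗[k] A) :
    wordStep ρ μ e n (a * b) z = wordStep ρ μ e n a (leftMul C n b z) := by
  refine LinearMap.congr_fun (f := wordStep ρ μ e n (a * b))
    (g := wordStep ρ μ e n a ∘ₗ leftMul C n b) (TensorProduct.ext' fun y x => ?_) z
  have h : (LinearMap.mulLeft k (a * b)).rTensor C (inducedCoact ρ μ e x) =
      (LinearMap.mulLeft k a).rTensor C (inducedCoact ρ μ e (b * x)) := by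
    rw [hb x, ← LinearMap.rTensor_comp_apply, LinearMap.mulLeft_mul]
  exact congrArg (fun t => (TensorProduct.comm k (TPow k C n) C).toLinearMap.rTensor A
    ((TensorProduct.assoc k (TPow k C n) C A).symm
      ((TensorProduct.comm k A C).toLinearMap.lTensor (TPow k C n) (y ⊗ₜ t)))) h

/-- The iterated canonical map is defined on the tensor power over B. At the first position b moves
past a tensor sign by coinvariance and left linearity of the tail; positions further right are
handled by induction. -/
theorem iterCan_linearRel (n : ℕ) :
    linearRel (coinvariants ρ μ e) (n + 1) ≤ LinearMap.ker (iterCan ρ μ e n) := by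
  refine linearRel_le _ fun i b hb u => ?_
  rw [LinearMap.mem_ker, map_sub, sub_eq_zero]
  induction n with
  | zero =>
    rw [Subsingleton.elim (α := Fin 1) i 0]
    refine LinearMap.congr_fun
      (f := iterCan ρ μ e 0 ∘ₗ slot (LinearMap.mulRight k b) 1 0)
      (g := iterCan ρ μ e 0 ∘ₗ slot (LinearMap.mulLeft k b) 1 1)
      (hom_ext_cons fun a x => ?_) u
    change TensorProduct.comm k A C (canonicalPre ρ μ e ((a * b) ⊗ₜ (show A from x))) =
      TensorProduct.comm k A C (canonicalPre ρ μ e (a ⊗ₜ (b * (show A from x))))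
    rw [canonicalPre_tmul, canonicalPre_tmul, hb (show A from x), ← LinearMap.rTensor_comp_apply,
      LinearMap.mulLeft_mul]
  | succ n ih =>
    refine LinearMap.congr_fun
      (f := iterCan ρ μ e (n + 1) ∘ₗ slot (LinearMap.mulRight k b) (n + 2) i.castSucc)
      (g := iterCan ρ μ e (n + 1) ∘ₗ slot (LinearMap.mulLeft k b) (n + 2) i.succ)
      (hom_ext_cons fun a x => ?_) u
    simp only [LinearMap.comp_apply]
    rw [slot_succ_cons]
    cases i using Fin.cases with
    | zero =>
      rw [Fin.castSucc_zero, slot_zero_cons, iterCan_cons, iterCan_cons, iterCan_leftMul,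
        LinearMap.mulRight_apply, wordStep_mul_coinvariant ρ μ e n a hb]
    | succ i => rw [← Fin.succ_castSucc, slot_succ_cons, iterCan_cons, iterCan_cons, ih]

/-- Appending 1 makes the word a value of `iterCan`, for which the linear relations hold. A cyclic
relation at i < n is one of these. At i = n, b first passes to the appended factor, acts from there
on the right, and reaches the first factor by the commutator relation. -/
theorem hopfClass_word_cyclicRel (n : ℕ) :
    cyclicRel (coinvariants ρ μ e) n ≤ LinearMap.ker (hopfClass ρ μ n ∘ₗ word ρ μ e n) := by
  refine cyclicRel_le _ fun i b hb v => ?_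
  -- In v ⊗ 1 the position n has a right neighbour, so even the wrap-around relation of v begins
  -- with a linear one.
  have hlin : ∀ i : Fin (n + 1),
      iterCan ρ μ e n (slot (LinearMap.mulRight k b) (n + 1) i.castSucc (snoc n v 1)) =
        iterCan ρ μ e n (slot (LinearMap.mulLeft k b) (n + 1) i.succ (snoc n v 1)) := fun i => by
    have h := iterCan_linearRel ρ μ e n
      (linearRel_mem (coinvariants ρ μ e) i hb (snoc n v 1))
    rwa [LinearMap.mem_ker, map_sub, sub_eq_zero] at h
  rw [LinearMap.mem_ker, map_sub, sub_eq_zero, LinearMap.comp_apply, LinearMap.comp_apply,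
    ← iterCan_snoc_one, ← iterCan_snoc_one, ← slot_castSucc_snoc, hlin]
  cases i using Fin.lastCases with
  | last =>
    -- Here b multiplies the appended 1 from the left; as b · 1 = 1 · b, this is also a right
    -- multiplication of the whole tensor.
    rw [Fin.last_add_one, ← slot_zero_snoc_mulLeft, iterCan_leftMul, ← hopfClass_rightMul,
      ← iterCan_slot_last, Fin.succ_last, slot_last_snoc, slot_last_snoc,
      LinearMap.mulLeft_apply, LinearMap.mulRight_apply, mul_one, one_mul]
  | cast i => rw [Fin.coeSucc_eq_succ, ← slot_castSucc_snoc, Fin.castSucc_succ]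

/-- A section of the iterated canonical map built from a map `A ⊗ C → A ⊗ A`. -/
noncomputable def iterSection (σ : A ⊗[k] C →ₗ[k] A ⊗[k] A) :
    ∀ n : ℕ, TPow k C n ⊗[k] A →ₗ[k] TPow k A (n + 1)
  | 0 => σ ∘ₗ (TensorProduct.comm k C A).toLinearMap
  | n + 1 => (iterSection σ n).lTensor A ∘ₗ
      (TensorProduct.leftComm k (TPow k C n) A A).toLinearMap ∘ₗ σ.lTensor (TPow k C n) ∘ₗ
        (TensorProduct.comm k C A).toLinearMap.lTensor (TPow k C n) ∘ₗ
          (TensorProduct.assoc k (TPow k C n) C A).toLinearMap ∘ₗ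
            (TensorProduct.comm k C (TPow k C n)).toLinearMap.rTensor A

/-- `x ⊗ x' ↦ x ⊗ G(y ⊗ x')`. -/
noncomputable def sectionStep (σ : A ⊗[k] C →ₗ[k] A ⊗[k] A) (n : ℕ) (y : TPow k C n) :
    A ⊗[k] A →ₗ[k] TPow k A (n + 2) :=
  (iterSection σ n ∘ₗ TensorProduct.mk k (TPow k C n) A y).lTensor A

theorem sectionStep_tmul (σ : A ⊗[k] C →ₗ[k] A ⊗[k] A) (n : ℕ) (y : TPow k C n) (x x' : A) :
    sectionStep σ n y (x ⊗ₜ x') = cons (n + 1) x (iterSection σ n (y ⊗ₜ x')) := rfl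

/-- The recursion in the form used later: the first component of σ(a ⊗ c) becomes the new first
factor, and the second is passed on together with y. -/
theorem iterSection_succ (σ : A ⊗[k] C →ₗ[k] A ⊗[k] A) (n : ℕ) (c : C) (y : TPow k C n) (a : A) :
    iterSection σ (n + 1) (cons n c y ⊗ₜ a) = sectionStep σ n y (σ (a ⊗ₜ c)) := by
  change (iterSection σ n).lTensor A (TensorProduct.leftComm k (TPow k C n) A A
    (y ⊗ₜ σ (a ⊗ₜ c))) = _
  generalize σ (a ⊗ₜ c) = t
  exact LinearMap.congr_fun
    (f := (iterSection σ n).lTensor A ∘ₗ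
      (TensorProduct.leftComm k (TPow k C n) A A).toLinearMap ∘ₗ
        TensorProduct.mk k (TPow k C n) (A ⊗[k] A) y)
    (g := sectionStep σ n y) (TensorProduct.ext' fun _ _ => rfl) t

/-- `a ⊗ c ↦ (c ⊗ y) ⊗ a`. -/
noncomputable def insertC (A : Type w) [Ring A] [Algebra k A] (n : ℕ) (y : TPow k C n) :
    A ⊗[k] C →ₗ[k] TPow k C (n + 1) ⊗[k] A :=
  (TensorProduct.comm k A (TPow k C (n + 1))).toLinearMap ∘ₗ ((cons n).flip y).lTensor A

theorem insertC_tmul (n : ℕ) (y : TPow k C n) (a : A) (c : C) :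
    insertC A n y (a ⊗ₜ c) = cons n c y ⊗ₜ a := rfl

theorem iterSection_insertC (σ : A ⊗[k] C →ₗ[k] A ⊗[k] A) (n : ℕ) (y : TPow k C n)
    (t : A ⊗[k] C) : iterSection σ (n + 1) (insertC A n y t) = sectionStep σ n y (σ t) :=
  LinearMap.congr_fun (f := iterSection σ (n + 1) ∘ₗ insertC A n y) (g := sectionStep σ n y ∘ₗ σ)
    (TensorProduct.ext' fun a c => iterSection_succ σ n c y a) t

/-- A step is one application of the canonical map with y as a spectator, so a section of the
canonical map undoes it. -/
theorem wordStep_eq_insertC (n : ℕ) (a : A) (y : TPow k C n) (x : A) :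
    wordStep ρ μ e n a (y ⊗ₜ x) = insertC A n y (canonicalPre ρ μ e (a ⊗ₜ x)) := by
  rw [wordStep_tmul, canonicalPre_tmul, inducedCoact, LinearMap.comp_apply]
  change _ = insertC A n y ((LinearMap.mulLeft k a).rTensor C ((μ.act e).lTensor A (ρ.coact x)))
  generalize ρ.coact x = t
  exact LinearMap.congr_fun
    (f := leftMul C (n + 1) a ∘ₗ swapMap ((cons n).flip y ∘ₗ μ.act e))
    (g := insertC A n y ∘ₗ (LinearMap.mulLeft k a).rTensor C ∘ₗ (μ.act e).lTensor A)
    (TensorProduct.ext' fun _ _ => rfl) t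

/-- Letters are restored one at a time: the induction hypothesis rebuilds y from the tail, and the
canonical map applied to σ(a ⊗ c) returns a ⊗ c. A right inverse of the canonical map is all that is
needed. -/
theorem iterCan_iterSection {σ : A ⊗[k] C →ₗ[k] A ⊗[k] A}
    (hσ : ∀ t, canonicalPre ρ μ e (σ t) = t) (n : ℕ) (z : TPow k C n ⊗[k] A) :
    iterCan ρ μ e n (iterSection σ n z) = z := by
  induction n with
  | zero =>
    change TensorProduct.comm k A C (canonicalPre ρ μ e (σ (TensorProduct.comm k C A z))) = z
    rw [hσ]
    exact (TensorProduct.comm k C A).symm_apply_apply z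
  | succ n ih =>
    -- Stated for every s because σ(a ⊗ c) need not be a pure tensor.
    have key : ∀ (y : TPow k C n) (s : A ⊗[k] A),
        iterCan ρ μ e (n + 1) (sectionStep σ n y s) = insertC A n y (canonicalPre ρ μ e s) :=
      fun y s => LinearMap.congr_fun
        (f := iterCan ρ μ e (n + 1) ∘ₗ sectionStep σ n y)
        (g := insertC A n y ∘ₗ canonicalPre ρ μ e) (TensorProduct.ext' fun a x => by
          rw [LinearMap.comp_apply, LinearMap.comp_apply, sectionStep_tmul, iterCan_cons, ih,
            wordStep_eq_insertC]) s
    induction z using TensorProduct.induction_on with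
    | zero => rw [map_zero, map_zero]
    | add p q hp hq => rw [map_add, map_add, hp, hq]
    | tmul z a =>
      refine LinearMap.congr_fun
        (f := iterCan ρ μ e (n + 1) ∘ₗ iterSection σ (n + 1) ∘ₗ
          (TensorProduct.mk k (TPow k C (n + 1)) A).flip a)
        (g := (TensorProduct.mk k (TPow k C (n + 1)) A).flip a) (hom_ext_cons fun c y => ?_) z
      change iterCan ρ μ e (n + 1) (iterSection σ (n + 1) (cons n c y ⊗ₜ a)) = cons n c y ⊗ₜ a
      rw [iterSection_succ, key, hσ, insertC_tmul]

/-- In one step σ after the canonical map differs from the identity by relations over B, which is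
injectivity of the canonical map. The point is that these remain relations after the section has
expanded the tail, although σ is only k-linear. -/
theorem iterSection_iterCan {σ : A ⊗[k] C →ₗ[k] A ⊗[k] A}
    (hσ : ∀ t, canonicalPre ρ μ e (σ t) = t)
    (hk : LinearMap.ker (canonicalPre ρ μ e) ≤ balancedRel (coinvariants ρ μ e))
    (n : ℕ) (u : TPow k A (n + 1)) :
    iterSection σ n (iterCan ρ μ e n u) - u ∈ linearRel (coinvariants ρ μ e) (n + 1) := by
  have hb : ∀ s, σ (canonicalPre ρ μ e s) - s ∈ balancedRel (coinvariants ρ μ e) := fun s =>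
    hk (by rw [LinearMap.mem_ker, map_sub, hσ, sub_self])
  induction n with
  | zero =>
    have h0 : balancedRel (coinvariants ρ μ e) ≤ linearRel (k := k) (coinvariants ρ μ e) 1 := by
      refine Submodule.span_le.mpr ?_
      rintro _ ⟨a, b, a', hb, rfl⟩
      exact cons_mul_sub_mem (coinvariants ρ μ e) 0 a hb a'
    have h1 : iterSection σ 0 (iterCan ρ μ e 0 u) = σ (canonicalPre ρ μ e u) :=
      congrArg σ ((TensorProduct.comm k A C).symm_apply_apply _)
    rw [h1]
    exact h0 (hb u)
  | succ n ih =>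
    have hlin : ∀ (y : TPow k C n) (s : A ⊗[k] A), s ∈ balancedRel (coinvariants ρ μ e) →
        sectionStep σ n y s ∈ linearRel (coinvariants ρ μ e) (n + 2) := by
      intro y
      change balancedRel (coinvariants ρ μ e) ≤
        (linearRel (coinvariants ρ μ e) (n + 2)).comap (sectionStep σ n y)
      refine Submodule.span_le.mpr ?_
      rintro _ ⟨a, b, a', hb, rfl⟩
      rw [SetLike.mem_coe, Submodule.mem_comap, map_sub, sectionStep_tmul, sectionStep_tmul]
      have h1 := cons_mul_sub_mem (coinvariants ρ μ e) (n + 1) a hb (iterSection σ n (y ⊗ₜ a'))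
      -- Write G for the section. It is left B-linear modulo relations: `iterCan` is left linear and
      -- sends b G(y ⊗ a') to y ⊗ b a', so the induction hypothesis for b G(y ⊗ a') compares it with
      -- G(y ⊗ b a').
      have h2 := cons_mem_linearRel (coinvariants ρ μ e) (n + 1) a
        (ih (slot (LinearMap.mulLeft k b) (n + 1) 0 (iterSection σ n (y ⊗ₜ a'))))
      rw [Submodule.mem_comap, iterCan_leftMul, iterCan_iterSection ρ μ e hσ, leftMul_tmul,
        map_sub] at h2
      have h3 := sub_mem h1 h2
      convert h3 using 1
      abel
    -- Undoing one letter costs the difference between σ of the canonical image of a ⊗ x and a ⊗ x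
    -- itself, and `hlin` absorbs it.
    have hstep : ∀ (a : A) (z : TPow k C n ⊗[k] A),
        iterSection σ (n + 1) (wordStep ρ μ e n a z) - cons (n + 1) a (iterSection σ n z) ∈
          linearRel (coinvariants ρ μ e) (n + 2) := by
      intro a z
      induction z using TensorProduct.induction_on with
      | zero => simp only [map_zero, sub_zero, zero_mem]
      | add p q hp hq =>
        have h3 := add_mem hp hq
        simp only [map_add]
        convert h3 using 1
        abel
      | tmul y x =>
        have h3 := hlin y _ (hb (a ⊗ₜ x))
        rwa [map_sub, ← iterSection_insertC, ← wordStep_eq_insertC, sectionStep_tmul] at h3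
    -- In the quotient the membership becomes an equality of linear maps, which may be tested on
    -- tensors a ⊗ v.
    let L : TPow k A (n + 2) →ₗ[k] TPow k A (n + 2) :=
      iterSection σ (n + 1) ∘ₗ iterCan ρ μ e (n + 1) - LinearMap.id
    suffices hL : (linearRel (coinvariants ρ μ e) (n + 2)).mkQ ∘ₗ L = 0 from
      (Submodule.Quotient.mk_eq_zero _).mp (LinearMap.congr_fun hL u)
    refine hom_ext_cons fun a v => (Submodule.Quotient.mk_eq_zero _).mpr ?_
    change iterSection σ (n + 1) (wordStep ρ μ e n a (iterCan ρ μ e n v)) - cons (n + 1) a v ∈ _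
    -- The error for a ⊗ v is the error at the first letter plus a tensored with the error for v.
    have h4 := add_mem (hstep a (iterCan ρ μ e n v))
      (cons_mem_linearRel (coinvariants ρ μ e) (n + 1) a (ih v))
    rwa [map_sub, sub_add_sub_cancel] at h4

/-- A surjection of vector spaces splits. The section takes values in A ⊗ A, before the quotient by
the relations over B, and no linearity beyond that over k is asked of it. -/
theorem exists_canonicalPre_section
    (hcan : Function.Surjective (canonicalMap ρ μ e)) :
    ∃ σ : A ⊗[k] C →ₗ[k] A ⊗[k] A, ∀ t, canonicalPre ρ μ e (σ t) = t := by
  have hs : Function.Surjective (canonicalPre ρ μ e) := fun t => by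
    obtain ⟨z, rfl⟩ := hcan t
    obtain ⟨z, rfl⟩ := (balancedRel (coinvariants ρ μ e)).mkQ_surjective z
    exact ⟨z, rfl⟩
  obtain ⟨σ, hσ⟩ := (canonicalPre ρ μ e).exists_rightInverse_of_surjective
    (LinearMap.range_eq_top.mpr hs)
  exact ⟨σ, fun t => LinearMap.congr_fun hσ t⟩

/-- The form in which injectivity is used: tensors in A ⊗ A with the same canonical image differ by
relations over B. -/
theorem ker_canonicalPre_le (hcan : Function.Injective (canonicalMap ρ μ e)) :
    LinearMap.ker (canonicalPre ρ μ e) ≤ balancedRel (coinvariants ρ μ e) := fun z hz =>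
  (Submodule.Quotient.mk_eq_zero _).mp (hcan ((show canonicalMap ρ μ e
    (Submodule.Quotient.mk z) = 0 from hz).trans (map_zero _).symm))

/-- The comparison map from the cyclic module of the extension to the Hopf-cyclic module. -/
noncomputable def comparison (n : ℕ) : (relativeCyclic (coinvariants ρ μ e)).X n →ₗ[k]
    (hopfCyclic μ (canonicalSAYD ρ)).X n :=
  (cyclicRel (coinvariants ρ μ e) n).liftQ (hopfClass ρ μ n ∘ₗ word ρ μ e n)
    (hopfClass_word_cyclicRel ρ μ e n)

theorem comparison_mk (n : ℕ) (v : TPow k A n) :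
    comparison ρ μ e n (relativeMk (coinvariants ρ μ e) n v) =
      hopfClass ρ μ n (word ρ μ e n v) := rfl

/-- On v ⊗ a the two sides are the classes of a · (word of v) and (word of v) · a, which the
commutator relation identifies. Through `iterCan`, closing up by the last face thus corresponds to
passing to the commutator quotient. -/
theorem hopfClass_word_algFace_last (n : ℕ) (u : TPow k A (n + 1)) :
    hopfClass ρ μ n (word ρ μ e n (algFace k A n (Fin.last _) u)) =
      hopfClass ρ μ n (iterCan ρ μ e n u) := by
  refine LinearMap.congr_fun
    (f := hopfClass ρ μ n ∘ₗ word ρ μ e n ∘ₗ algFace k A n (Fin.last _))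
    (g := hopfClass ρ μ n ∘ₗ iterCan ρ μ e n) (hom_ext_snoc fun v a => ?_) u
  simp only [LinearMap.comp_apply]
  rw [algFace_last_snoc, word_leftMul, iterCan_snoc, hopfClass_rightMul]

/-- An isomorphism of bimodules induces one of commutator quotients. The inverse lifts an element of
(C ⊗ ⋯ ⊗ C) ⊗ A along the iterated canonical map and closes the lift up by the last face. -/
theorem comparison_bijective (hcan : Function.Bijective (canonicalMap ρ μ e)) (n : ℕ) :
    Function.Bijective (comparison ρ μ e n) := by
  obtain ⟨σ, hσ⟩ := exists_canonicalPre_section ρ μ e hcan.surjective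
  have hG := iterSection_iterCan ρ μ e hσ (ker_canonicalPre_le ρ μ e hcan.injective) n
  -- the inverse of the comparison map, on `(C ⊗ ⋯ ⊗ C) ⊗ A`
  let F : TPow k C n ⊗[k] A →ₗ[k] (relativeCyclic (coinvariants ρ μ e)).X n :=
    relativeMk (coinvariants ρ μ e) n ∘ₗ algFace k A n (Fin.last _) ∘ₗ iterSection σ n
  -- The choice of lift does not matter: the section returns u up to linear relations, and the last
  -- face carries these into cyclic relations.
  have hF : ∀ u, F (iterCan ρ μ e n u) =
      relativeMk (coinvariants ρ μ e) n (algFace k A n (Fin.last _) u) := fun u => by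
    refine (Submodule.Quotient.eq (cyclicRel (coinvariants ρ μ e) n)).mpr ?_
    rw [LinearMap.comp_apply, ← map_sub]
    exact cyclicRel_algFace _ n _ (linearRel_le_cyclicRel _ _ (hG u))
  -- Every z has the form `iterCan` of some u, so commutators can be computed on u, where right and
  -- left multiplication by a have the same last face. This avoids any A-linearity of σ.
  have hrel : ∀ z a, F (rightMul ρ μ n z a) = F (leftMul C n a z) := fun z a => by
    obtain ⟨u, rfl⟩ : ∃ u, iterCan ρ μ e n u = z := ⟨_, iterCan_iterSection ρ μ e hσ n z⟩
    rw [← iterCan_slot_last, ← iterCan_leftMul, hF, hF, algFace_last_slot]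
  obtain ⟨G, hG'⟩ := exists_hopfClass_lift ρ μ n F hrel
  refine Function.bijective_iff_has_inverse.mpr ⟨G, fun z => ?_, fun z => ?_⟩
  · obtain ⟨v, rfl⟩ := relativeMk_surjective (coinvariants ρ μ e) n z
    -- The word of v lifts to v ⊗ 1, which closes up to 1 · v = v.
    rw [comparison_mk, hG', ← iterCan_snoc_one, hF, algFace_last_snoc, slot_mulLeft_one]
  · obtain ⟨z, rfl⟩ := hopfClass_surjective ρ μ n z
    obtain ⟨u, rfl⟩ : ∃ u, iterCan ρ μ e n u = z := ⟨_, iterCan_iterSection ρ μ e hσ n z⟩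
    rw [hG', hF, comparison_mk, hopfClass_word_algFace_last]

/-! ### Compatibility of the comparison map with t, d₀ and s₀. -/

theorem comparison_t (n : ℕ) (z : (relativeCyclic (coinvariants ρ μ e)).X n) :
    comparison ρ μ e n ((relativeCyclic (coinvariants ρ μ e)).t n z) =
      (hopfCyclic μ (canonicalSAYD ρ)).t n (comparison ρ μ e n z) := by
  obtain ⟨v, rfl⟩ := relativeMk_surjective (coinvariants ρ μ e) n z
  exact hopfClass_word_rot ρ μ e n v

theorem comparison_d_zero (he : IsGroupLikeElem k e) (n : ℕ)
    (z : (relativeCyclic (coinvariants ρ μ e)).X (n + 1)) :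
    comparison ρ μ e n ((relativeCyclic (coinvariants ρ μ e)).d n 0 z) =
      (hopfCyclic μ (canonicalSAYD ρ)).d n 0 (comparison ρ μ e (n + 1) z) := by
  obtain ⟨v, rfl⟩ := relativeMk_surjective (coinvariants ρ μ e) (n + 1) z
  have h : word ρ μ e n (algFace k A n 0 v) =
      (dropAt Coalgebra.counit n 0).rTensor A (word ρ μ e (n + 1) v) := by
    rw [algFace_zero, word_mergeAt_zero ρ μ e he]
  exact (congrArg (hopfClass ρ μ n) h).trans (hopfClass_dropAt ρ μ n 0 _)

theorem comparison_s_zero (he : IsGroupLikeElem k e) (n : ℕ)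
    (z : (relativeCyclic (coinvariants ρ μ e)).X n) :
    comparison ρ μ e (n + 1) ((relativeCyclic (coinvariants ρ μ e)).s n 0 z) =
      (hopfCyclic μ (canonicalSAYD ρ)).s n 0 (comparison ρ μ e n z) := by
  obtain ⟨v, rfl⟩ := relativeMk_surjective (coinvariants ρ μ e) n z
  exact (congrArg (hopfClass ρ μ (n + 1)) (word_splitAt_zero ρ μ e he n v)).trans
    (hopfClass_splitAt ρ μ n 0 _)

end Comparison

end HopfCyclic

theorem theorem5p1 {k : Type*} [Field k] {H : Type*} [Ring H] [HopfAlgebra k H]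
    {A : Type*} [Ring A] [Algebra k A] (ρ : HopfCyclic.ComoduleAlgebra k H A)
    {C : Type*} [AddCommGroup C] [Module k C] [Coalgebra k C]
    (μ : HopfCyclic.ModuleCoalgebra k H C) (e : C) (he : IsGroupLikeElem k e)
    (hcan : Function.Bijective (HopfCyclic.canonicalMap ρ μ e)) :
    ∃ Φ : (HopfCyclic.relativeCyclic (HopfCyclic.coinvariants ρ μ e)).Iso
        (HopfCyclic.hopfCyclic μ (HopfCyclic.canonicalSAYD ρ)),
      (∀ n x, Φ.equiv n (HopfCyclic.relativeMk (HopfCyclic.coinvariants ρ μ e) n x) =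
        HopfCyclic.hopfMk μ (HopfCyclic.canonicalSAYD ρ) n
          ((HopfCyclic.saydOne ρ).lTensor (HopfCyclic.TPow k C n) (HopfCyclic.word ρ μ e n x))) ∧
      ∀ p : ZMod 2,
        ∃ F : (HopfCyclic.relativeCyclic (HopfCyclic.coinvariants ρ μ e)).HP p ≃ₗ[k]
            (HopfCyclic.hopfCyclic μ (HopfCyclic.canonicalSAYD ρ)).HP p,
          ∀ z : (HopfCyclic.relativeCyclic (HopfCyclic.coinvariants ρ μ e)).PCycles p,
            ∃ hz : Φ.onChains p z ∈
                (HopfCyclic.hopfCyclic μ (HopfCyclic.canonicalSAYD ρ)).PCycles p,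
              F (Submodule.Quotient.mk z) = Submodule.Quotient.mk ⟨_, hz⟩ := by
  -- The Galois condition is spent on bijectivity in each degree, and group-likeness of e on d₀ and
  -- s₀. The formula for Φ holds by definition, the comparison map being induced by the word map.
  refine ⟨HopfCyclic.CyclicModule.isoOfZero
    (fun n => LinearEquiv.ofBijective _ (HopfCyclic.comparison_bijective ρ μ e hcan n))
    (HopfCyclic.comparison_t ρ μ e) (HopfCyclic.comparison_d_zero ρ μ e he)
    (HopfCyclic.comparison_s_zero ρ μ e he), fun n x => rfl, fun p =>
      ⟨HopfCyclic.CyclicModule.Iso.hpEquiv _ p, HopfCyclic.CyclicModule.Iso.hpEquiv_mk _ p⟩⟩
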